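/- Let $\mathbb{C}_{1/2}=\{s\in\mathbb{C}:\operatorname{Re}s>1/2\}$ and let $\mathscr{H}^2$ be the Hilbert space of Dirichlet series $f(s)=\sum_{n\ge1}x(n)n^{-s}$ with $\|f\|^2=\sum_{n\ge 1}|x(n)|^2<\infty$; these converge absolutely in $\mathbb{C}_{1/2}$, and the reproducing kernel of $\mathscr{H}^2$ at $w\in\mathbb{C}_{1/2}$ is $\mathscr{K}_w(s)=\sum_{n\ge1}n^{-\overline{w}}n^{-s}=\zeta(s+\overline{w})$. For an analytic map $\varphi\colon\mathbb{C}_{1/2}\to\mathbb{C}_{1/2}$ such that $\mathscr{C}_\varphi f=f\circ\varphi$ defines a bounded operator on $\mathscr{H}^2$, we say that $\varphi$ (or $\mathscr{C}_\varphi$) satisfies the reproducing kernel thesis if $$\sup_{w\in\mathbb{C}_{1/2}}\frac{\|\mathscr{C}_\varphi\mathscr{K}_w\|}{\|\mathscr{K}_w\|}=\|\mathscr{C}_\varphi\|.$$ **Theorem D.** For every real $\alpha>0$, the function $$\varphi_\alpha(s)=\frac12+\alpha\,\frac{1-2^{-s}}{1+2^{-s}}$$ is an analytic self-map of $\mathbb{C}_{1/2}$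 that induces a bounded composition operator on $\mathscr{H}^2$, the infinite matrix $$\left(\frac{(nm)^{-1/2+\alpha}}{[\max(n,m)]^{2\alpha}}\right)_{n,m\ge1}$$ defines a bounded operator $K_\alpha$ on $\ell^2$, and $\varphi_\alpha$ satisfies the reproducing kernel thesis if and only if $K_\alpha$ has no eigenvalues. In particular, $\varphi_\alpha$ satisfies the reproducing kernel thesis for all $0<\alpha\le1$ and does not satisfy it for any $\alpha\ge2$. Hence the reproducing kernel thesis does not hold for all bounded composition operators on $\mathscr{H}^2$. -/

import Mathlib

noncomputable section

/-- The half-plane of complex numbers with real part greater than `1/2`. -/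
def halfPlane : Set ℂ := {s | 1 / 2 < s.re}

/-- The Hilbert space of Dirichlet series `∑ x(n) n^{-s}`, `n ≥ 1`, with square summable
coefficients. An element is recorded by its coefficient sequence, so that the norm is
`(∑ |x(n)|²)^{1/2}`; by `DirichletH2.eval_injOn` below, an element is determined by the function
it represents on `halfPlane`. -/
abbrev DirichletH2 : Type := lp (fun _ : ℕ+ => ℂ) 2

namespace DirichletH2

/-- The value of a Dirichlet series at the point `s`. The series converges absolutely for
`s ∈ halfPlane`. -/
def eval (f : DirichletH2) (s : ℂ) : ℂ := ∑' n : ℕ+, f n * (n : ℂ) ^ (-s)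

theorem memlp_kernel {w : ℂ} (hw : w ∈ halfPlane) :
    Memℓp (fun n : ℕ+ => (n : ℂ) ^ (-(starRingEnd ℂ) w)) 2 := by
  have hw' : 1 / 2 < w.re := hw
  refine memℓp_gen ?_
  have h : Summable fun n : ℕ => (n : ℝ) ^ (-(2 * w.re)) :=
    Real.summable_nat_rpow.2 (by linarith)
  refine (h.comp_injective PNat.coe_injective).congr fun n => ?_
  have hn : (0 : ℝ) < ((n : ℕ) : ℝ) := by exact_mod_cast n.pos
  have h1 : ‖((n : ℕ) : ℂ) ^ (-(starRingEnd ℂ) w)‖ = ((n : ℕ) : ℝ) ^ (-w.re) := by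
    rw [Complex.norm_natCast_cpow_of_pos n.pos]
    simp
  rw [h1]
  simp only [Function.comp, ENNReal.toReal_ofNat]
  rw [← Real.rpow_mul hn.le]
  ring_nf

/-- The reproducing kernel `s ↦ ζ(s + conj w) = ∑ n^{-conj w} n^{-s}` at the point `w`. -/
def kernel (w : halfPlane) : DirichletH2 :=
  ⟨fun n : ℕ+ => (n : ℂ) ^ (-(starRingEnd ℂ) (w : ℂ)), memlp_kernel w.2⟩

/-- The reproducing property: at every `w ∈ halfPlane` the series `eval f w` converges absolutely
and its sum is `⟪kernel w, f⟫`. -/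
theorem hasSum_eval (f : DirichletH2) (w : halfPlane) :
    HasSum (fun n : ℕ+ => f n * (n : ℂ) ^ (-(w : ℂ))) (inner ℂ (kernel w) f) := by
  have e : (fun n : ℕ+ => f n * (n : ℂ) ^ (-(w : ℂ))) = fun n => inner ℂ (kernel w n) (f n) := by
    funext n
    have hn : Complex.arg ((n : ℕ) : ℂ) ≠ Real.pi := by
      rw [Complex.natCast_arg]
      exact Real.pi_pos.ne
    have h2 : (starRingEnd ℂ) (((n : ℕ) : ℂ) ^ (-(starRingEnd ℂ) (w : ℂ)))
        = ((n : ℕ) : ℂ) ^ (-(w : ℂ)) := by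
      rw [← map_neg, Complex.cpow_conj _ _ hn, Complex.conj_conj, Complex.conj_natCast]
    rw [RCLike.inner_apply, ← h2]
    rfl
  rw [e]
  exact lp.hasSum_inner (𝕜 := ℂ) (kernel w) f

/-- A Dirichlet series with square summable coefficients is determined by the function that it
represents on the half-plane. -/
theorem eval_injOn {f g : DirichletH2} (h : Set.EqOn f.eval g.eval halfPlane) : f = g := by
  let e : DirichletH2 → ℕ → ℂ := fun x k => if hk : 0 < k then x ⟨k, hk⟩ else 0
  have he : ∀ (x : DirichletH2) (s : ℂ), LSeries (e x) s = x.eval s := by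
    intro x s
    unfold LSeries eval
    rw [← PNat.coe_injective.tsum_eq]
    · refine tsum_congr fun n => ?_
      rw [LSeries.term_of_ne_zero n.ne_zero, Complex.cpow_neg, div_eq_mul_inv]
      simp only [e, n.pos, dif_pos]
      rfl
    · intro k hk
      have hk0 : k ≠ 0 := by
        rintro rfl
        simp at hk
      exact ⟨⟨k, Nat.pos_of_ne_zero hk0⟩, rfl⟩
  have hb : ∀ x : DirichletH2, LSeries.abscissaOfAbsConv (e x) < ⊤ := by
    intro x
    refine (LSeries.abscissaOfAbsConv_le_of_le_const ⟨‖x‖, fun k hk => ?_⟩).trans_lt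
      (EReal.coe_lt_top 1)
    simp only [e, Nat.pos_of_ne_zero hk, dif_pos]
    exact lp.norm_apply_le_norm (by norm_num) x _
  ext n
  have hev : (fun x : ℝ => LSeries (e f) x) =ᶠ[Filter.atTop] fun x => LSeries (e g) x := by
    filter_upwards [Filter.eventually_gt_atTop (1 / 2 : ℝ)] with x hx
    rw [he, he]
    exact h (show (1 / 2 : ℝ) < (x : ℂ).re by simpa using hx)
  have := LSeries.eq_of_LSeries_eventually_eq (hb f) (hb g) hev n.ne_zero
  simp only [e, n.pos, dif_pos] at this
  exact this

end DirichletH2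

/-- The bounded operator `C` is the composition operator `f ↦ f ∘ φ`. -/
def IsCompositionOperator (φ : ℂ → ℂ) (C : DirichletH2 →L[ℂ] DirichletH2) : Prop :=
  ∀ f : DirichletH2, Set.EqOn (C f).eval (fun s => f.eval (φ s)) halfPlane

/-- A symbol has at most one composition operator. -/
theorem IsCompositionOperator.unique {φ : ℂ → ℂ} {C D : DirichletH2 →L[ℂ] DirichletH2}
    (hC : IsCompositionOperator φ C) (hD : IsCompositionOperator φ D) : C = D :=
  ContinuousLinearMap.ext fun f => DirichletH2.eval_injOn ((hC f).trans (hD f).symm)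

/-- `φ` is an analytic self-map of the half-plane that induces a bounded composition operator. -/
def IsBoundedSymbol (φ : ℂ → ℂ) : Prop :=
  DifferentiableOn ℂ φ halfPlane ∧ Set.MapsTo φ halfPlane halfPlane ∧
    ∃ C : DirichletH2 →L[ℂ] DirichletH2, IsCompositionOperator φ C

/-- The reproducing kernel thesis for the composition operator with symbol `φ`: its norm is the
supremum of `‖C k‖ / ‖k‖` over all reproducing kernels `k`. -/
def ReproducingKernelThesis (φ : ℂ → ℂ) : Prop :=
  ∃ C : DirichletH2 →L[ℂ] DirichletH2, IsCompositionOperator φ C ∧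
    IsLUB (Set.range fun w : halfPlane =>
      ‖C (DirichletH2.kernel w)‖ / ‖DirichletH2.kernel w‖) ‖C‖

/-- The symbol `φ_α(s) = 1/2 + α (1 - 2^{-s}) / (1 + 2^{-s})`. -/
def phiSymbol (α : ℝ) (s : ℂ) : ℂ :=
  1 / 2 + (α : ℂ) * ((1 - (2 : ℂ) ^ (-s)) / (1 + (2 : ℂ) ^ (-s)))

/-- The matrix entry `(nm)^{-1/2 + α} / max(n, m)^{2α}`. -/
def hardyEntry (α : ℝ) (n m : ℕ+) : ℝ :=
  ((n : ℝ) * (m : ℝ)) ^ (-(1 / 2 : ℝ) + α) / (max (n : ℝ) (m : ℝ)) ^ (2 * α)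

/-- The bounded operator `K` on `ℓ²` is given by the infinite matrix `a`. -/
def IsMatrixOperator (a : ℕ+ → ℕ+ → ℝ)
    (K : lp (fun _ : ℕ+ => ℂ) 2 →L[ℂ] lp (fun _ : ℕ+ => ℂ) 2) : Prop :=
  ∀ (x : lp (fun _ : ℕ+ => ℂ) 2) (n : ℕ+), HasSum (fun m : ℕ+ => (a n m : ℂ) * x m) (K x n)

end

/-! With `z = 2 ^ (-s)`, the function `n ^ (-φ_α(s))` is `n ^ (-1/2)` times the singular inner
function `exp(-t (1 - z) / (1 + z))`, `t = α log n`. On the unit circle these functions are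
unimodular and multiply by adding parameters, so in the Hardy space of the disc their inner products
are `exp(-|t - s|)`. Hence the images of the basis vectors under the composition operator `C` have
the Gram matrix `hardyEntry α` (`inner_symbolPow`), and `K_α = C* C`.

Everything is decided by comparing `‖C‖²` with `2 / α`, the norm of the integral operator on `L²(0,
∞)` with the same kernel. Schur's test with weights `n ^ (-1/2)` shows that `C` is bounded, that
`‖C‖² ≤ 2 / α` when `α ≤ 1`, and that on vectors supported on large indices the bound comes
arbitrarily close to `2 / α` (`exists_tail_bound`). Testing on reproducing kernels at real points
near `1/2` gives at least `2 / α` in the limit (`two_div_le_of_kernel_bound`). So the thesis holds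
if `‖C‖² ≤ 2 / α`.

If `‖C‖² > 2 / α`, every normalized maximizing sequence has a subsequence converging to an
eigenvector of `K_α` (`exists_subseq_tendsto_eigenvector`). Were the sequence made of normalized
kernels, the limit would be a multiple of `n ^ (-σ)` or of the first basis vector, and neither is an
eigenvector (`not_eigenvector_multiplicative`). So the thesis fails and `K_α` has an eigenvalue.

It remains to exclude eigenvalues when `‖C‖² ≤ 2 / α`. As `0 ≤ K_α ≤ ‖C‖²`, they would lie in `[0, 2
/ α]`. For `μ > 0` the entries factor on each side of the diagonal, so the eigenvalue equation
becomes a two-term recurrence for the weighted head and tail sums; for `μ ≤ 2 / α` it is a summable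
perturbation of a system whose solutions do not decay, while square summability forces decay
(`eq_zero_of_eigenvalue_le`). The case `μ = 0` is direct algebra. Finally, for `α ≥ 2` the first
column of the matrix already gives `‖C‖² > 1 ≥ 2 / α`. -/

open Filter Topology Finset
open scoped ComplexConjugate InnerProductSpace

namespace DirichletComposition

/-! ### Parseval's identity on circles inside the unit disc -/

section Parseval

open MeasureTheory Real

theorem circleAverage_pow_mul_conj_pow (r : ℝ) (k l : ℕ) :
    circleAverage (fun z => z ^ k * conj (z ^ l)) 0 r = if k = l then (r : ℂ) ^ (2 * k) else 0 := by
  have h : ∀ θ : ℝ, circleMap 0 r θ ^ k * conj (circleMap 0 r θ ^ l) =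
      (r : ℂ) ^ (k + l) * Complex.exp ((((k : ℂ) - l) * Complex.I) * θ) := by
    intro θ
    simp only [circleMap, zero_add, map_pow, map_mul, Complex.conj_ofReal, mul_pow]
    rw [← Complex.exp_conj, ← Complex.exp_nat_mul, ← Complex.exp_nat_mul, pow_add]
    simp only [map_mul, Complex.conj_ofReal, Complex.conj_I]
    rw [mul_mul_mul_comm, ← Complex.exp_add]
    ring_nf
  rw [circleAverage_def]
  simp only [h]
  rw [intervalIntegral.integral_const_mul]
  split_ifs with hkl
  · subst hkl
    have : (π : ℂ) + π ≠ 0 := by simp [← two_mul, pi_ne_zero]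
    simp only [sub_self, zero_mul, Complex.exp_zero, intervalIntegral.integral_const, two_mul]
    simp only [sub_zero, Complex.real_smul, Complex.ofReal_inv, Complex.ofReal_add, mul_one]
    field_simp
  · have hc : ((k : ℂ) - l) * Complex.I ≠ 0 := by
      refine mul_ne_zero (sub_ne_zero.2 ?_) Complex.I_ne_zero
      exact_mod_cast hkl
    rw [integral_exp_mul_complex hc]
    have : Complex.exp (((k : ℂ) - l) * Complex.I * ((2 * π : ℝ) : ℂ)) = 1 := by
      rw [Complex.exp_eq_one_iff]
      refine ⟨(k : ℤ) - l, ?_⟩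
      push_cast
      ring
    rw [this]
    simp

theorem hasSum_circleAverage {F : ℕ → ℂ → ℂ} {f : ℂ → ℂ} {r : ℝ} {c : ℕ → ℝ} (hc : Summable c)
    (hF : ∀ k, Continuous (fun θ => F k (circleMap 0 r θ)))
    (hb : ∀ k θ, ‖F k (circleMap 0 r θ)‖ ≤ c k)
    (hs : ∀ θ, HasSum (fun k => F k (circleMap 0 r θ)) (f (circleMap 0 r θ))) :
    HasSum (fun k => circleAverage (F k) 0 r) (circleAverage f 0 r) := by
  simp only [circleAverage_def]
  refine HasSum.const_smul _ ?_
  exact intervalIntegral.hasSum_integral_of_dominated_convergence (fun k _ => c k)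
    (fun k => (hF k).aestronglyMeasurable) (fun k => ae_of_all _ fun θ _ => hb k θ)
    (ae_of_all _ fun θ _ => hc) (by simp) (ae_of_all _ fun θ _ => hs θ)

theorem circleMap_mem_unit_ball {r : ℝ} (h0 : 0 ≤ r) (h1 : r < 1) (θ : ℝ) :
    circleMap 0 r θ ∈ Metric.ball (0 : ℂ) 1 := by
  simp [abs_of_nonneg h0, h1]

/-- Parseval's identity for two power series on a circle inside the unit disc. -/
theorem hasSum_circleAverage_mul_conj {a b : ℕ → ℂ} {f g : ℂ → ℂ} {r : ℝ} (h0 : 0 ≤ r)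
    (h1 : r < 1) (hf : ∀ z ∈ Metric.ball (0 : ℂ) 1, HasSum (fun k => a k * z ^ k) (f z))
    (hg : ∀ z ∈ Metric.ball (0 : ℂ) 1, HasSum (fun k => b k * z ^ k) (g z))
    (hgc : ContinuousOn g (Metric.ball 0 1)) {M : ℝ}
    (hgM : ∀ z ∈ Metric.ball (0 : ℂ) 1, ‖g z‖ ≤ M) :
    HasSum (fun k => a k * conj (b k) * (r : ℂ) ^ (2 * k))
      (circleAverage (fun z => f z * conj (g z)) 0 r) := by
  have hr : (r : ℂ) ∈ Metric.ball (0 : ℂ) 1 := by simp [abs_of_nonneg h0, h1]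
  have hn : ∀ θ k, ‖circleMap 0 r θ ^ k‖ = r ^ k := fun θ k => by simp [abs_of_nonneg h0]
  have hsum : ∀ {u : ℕ → ℂ} {F : ℂ → ℂ},
      (∀ z ∈ Metric.ball (0 : ℂ) 1, HasSum (fun k => u k * z ^ k) (F z)) →
      Summable fun k => ‖u k‖ * r ^ k := fun h => by
    refine ((h _ hr).summable.norm).congr fun k => ?_
    simp [abs_of_nonneg h0]
  -- The two series are integrated termwise one after the other: first `g` against a monomial, then
  -- `f` against the bounded function `conj g`. This avoids a double series.
  have hmono : ∀ k, circleAverage (fun z => z ^ k * conj (g z)) 0 r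
      = conj (b k) * (r : ℂ) ^ (2 * k) := by
    intro k
    have := hasSum_circleAverage (r := r) (F := fun l z => conj (b l) * (z ^ k * conj (z ^ l)))
      (f := fun z => z ^ k * conj (g z)) ((hsum hg).mul_left (r ^ k)) (fun l => by fun_prop)
      (fun l θ => by
        rw [norm_mul, norm_mul, hn, RCLike.norm_conj, RCLike.norm_conj, hn]
        exact le_of_eq (by ring))
      (fun θ => by
        have := ((Complex.hasSum_conj'.2 (by
          simpa using hg _ (circleMap_mem_unit_ball h0 h1 θ))).mul_left (circleMap 0 r θ ^ k) :
            HasSum (fun l => circleMap 0 r θ ^ k * conj (b l * circleMap 0 r θ ^ l))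
              (circleMap 0 r θ ^ k * conj (g (circleMap 0 r θ))))
        refine this.congr_fun fun l => ?_
        rw [map_mul]
        ring)
    have e : (fun l => circleAverage (fun z => conj (b l) * (z ^ k * conj (z ^ l))) 0 r)
        = fun l => if l = k then conj (b k) * (r : ℂ) ^ (2 * k) else 0 := by
      funext l
      have := circleAverage_fun_smul (a := conj (b l)) (f := fun z => z ^ k * conj (z ^ l))
        (c := 0) (R := r)
      simp only [smul_eq_mul] at this
      rw [this, circleAverage_pow_mul_conj_pow]
      rcases eq_or_ne k l with rfl | h
      · simp
      · simp [h, h.symm]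
    rw [e] at this
    exact this.unique (hasSum_ite_eq k _)
  have hM : 0 ≤ M := (norm_nonneg _).trans (hgM _ hr)
  have := hasSum_circleAverage (r := r) (F := fun k z => a k * (z ^ k * conj (g z)))
      (f := fun z => f z * conj (g z)) ((hsum hf).mul_right M)
      (fun k => by
        have : Continuous fun θ => g (circleMap 0 r θ) :=
          hgc.comp_continuous (continuous_circleMap 0 r) (circleMap_mem_unit_ball h0 h1)
        exact continuous_const.mul
          (((continuous_circleMap 0 r).pow k).mul (Complex.continuous_conj.comp this)))
      (fun k θ => by
        rw [norm_mul, norm_mul, hn, RCLike.norm_conj, mul_assoc]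
        gcongr
        exact hgM _ (circleMap_mem_unit_ball h0 h1 θ))
      (fun θ => by
        refine ((hf _ (circleMap_mem_unit_ball h0 h1 θ)).mul_right _).congr_fun fun k => ?_
        ring)
  refine this.congr_fun fun k => ?_
  have := circleAverage_fun_smul (a := a k) (f := fun z => z ^ k * conj (g z)) (c := 0) (R := r)
  simp only [smul_eq_mul] at this
  rw [this, hmono, mul_assoc]

end Parseval

/-! ### Singular inner functions and their Gram matrix -/

section SingularInner

open MeasureTheory Real

/-- The singular inner function `exp(-t (1 - z) / (1 + z))`. -/
noncomputable def singularInner (t : ℝ) (z : ℂ) : ℂ := Complex.exp (-(t * ((1 - z) / (1 + z))))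

theorem one_add_ne_zero_of_mem_ball {z : ℂ} (hz : z ∈ Metric.ball (0 : ℂ) 1) : 1 + z ≠ 0 := by
  intro h
  have : z = -1 := by linear_combination h
  simp [this] at hz

theorem re_cayley (z : ℂ) :
    ((1 - z) / (1 + z)).re = (1 - ‖z‖ ^ 2) / Complex.normSq (1 + z) := by
  rw [Complex.div_re, ← Complex.normSq_eq_norm_sq, ← add_div]
  simp only [Complex.normSq_apply, Complex.sub_re, Complex.add_re, Complex.one_re, Complex.sub_im,
    Complex.add_im, Complex.one_im]
  ring

/-- The Cayley transform has nonnegative real part on the closed disc. At `z = -1` division by zero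
makes the exponent `0`, so this point needs no exception. -/
theorem norm_singularInner_le {t : ℝ} (ht : 0 ≤ t) {z : ℂ} (hz : ‖z‖ ≤ 1) :
    ‖singularInner t z‖ ≤ 1 := by
  rw [singularInner, Complex.norm_exp, Complex.neg_re, Complex.re_ofReal_mul, re_cayley,
    exp_le_one_iff, neg_nonpos]
  have : ‖z‖ ^ 2 ≤ 1 := by nlinarith [norm_nonneg z]
  exact mul_nonneg ht (div_nonneg (by linarith) (Complex.normSq_nonneg _))

theorem differentiableAt_singularInner (t : ℝ) {z : ℂ} (hz : 1 + z ≠ 0) :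
    DifferentiableAt ℂ (singularInner t) z := by
  unfold singularInner
  fun_prop (disch := assumption)

theorem differentiableOn_singularInner (t : ℝ) :
    DifferentiableOn ℂ (singularInner t) (Metric.ball 0 1) := fun _ hz =>
  (differentiableAt_singularInner t (one_add_ne_zero_of_mem_ball hz)).differentiableWithinAt

/-- The Cayley transform is purely imaginary on the unit circle, so conjugation changes the sign of
the exponent. -/
theorem singularInner_mul_conj {s t : ℝ} {z : ℂ} (hz : ‖z‖ = 1) :
    singularInner t z * conj (singularInner s z) = singularInner (t - s) z := by
  have h : conj ((1 - z) / (1 + z)) = -((1 - z) / (1 + z)) := by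
    apply Complex.ext
    · rw [Complex.conj_re, Complex.neg_re, re_cayley, hz]
      simp
    · rw [Complex.conj_im, Complex.neg_im]
  unfold singularInner
  rw [← Complex.exp_conj, ← Complex.exp_add, map_neg, map_mul, h, Complex.conj_ofReal]
  push_cast
  ring_nf

theorem circleAverage_singularInner (t : ℝ) {r : ℝ} (h0 : 0 ≤ r) (h1 : r < 1) :
    circleAverage (singularInner t) 0 r = Complex.exp (-t) := by
  rw [DiffContOnCl.circleAverage]
  · simp [singularInner]
  · refine ((differentiableOn_singularInner t).mono ?_).diffContOnCl
    rw [abs_of_nonneg h0]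
    exact (Metric.closure_ball_subset_closedBall).trans (Metric.closedBall_subset_ball h1)

theorem ae_one_add_circleMap_ne_zero :
    ∀ᵐ θ : ℝ, θ ∈ Set.uIoc 0 (2 * π) → 1 + circleMap 0 1 θ ≠ 0 := by
  have : ∀ᵐ θ : ℝ, θ ≠ π := by
    simp [ae_iff]
  filter_upwards [this] with θ hθ hθ2 h
  rw [Set.uIoc_of_le (by positivity)] at hθ2
  have h2 : Complex.exp (θ * Complex.I) = Complex.exp (π * Complex.I) := by
    rw [Complex.exp_pi_mul_I]
    simp only [circleMap, zero_add, Complex.ofReal_one, one_mul] at h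
    linear_combination h
  rw [Complex.exp_eq_exp_iff_exists_int] at h2
  obtain ⟨n, hn⟩ := h2
  have h3 : θ = π + n * (2 * π) := by
    have := congrArg Complex.im hn
    simpa using this
  have hπ := pi_pos
  have h4 : (n : ℝ) < 1 := by nlinarith [hθ2.2]
  have h5 : (-1 : ℝ) < n := by nlinarith [hθ2.1]
  have h6 : n = 0 := by
    have h4' : n < 1 := by exact_mod_cast h4
    have h5' : -1 < n := by exact_mod_cast h5
    omega
  simp [h6] at h3
  exact hθ h3

/-- Radial limits commute with averages for bounded functions that are continuous off `-1`. -/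
theorem tendsto_circleAverage {F : ℂ → ℂ} {M : ℝ}
    (hF : ∀ z : ℂ, ‖z‖ ≤ 1 → 1 + z ≠ 0 → ContinuousAt F z)
    (hM : ∀ z : ℂ, ‖z‖ ≤ 1 → ‖F z‖ ≤ M) :
    Tendsto (fun r => circleAverage F 0 r) (𝓝[<] 1) (𝓝 (circleAverage F 0 1)) := by
  have hr : ∀ᶠ r : ℝ in 𝓝[<] 1, 0 ≤ r ∧ r < 1 := by
    filter_upwards [Ioo_mem_nhdsLT (show (0 : ℝ) < 1 by norm_num)] with r hr
    exact ⟨hr.1.le, hr.2⟩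
  simp only [circleAverage_def]
  refine Tendsto.const_smul ?_ _
  refine intervalIntegral.tendsto_integral_filter_of_dominated_convergence (fun _ => M) ?_ ?_
    (by simp) ?_
  · filter_upwards [hr] with r hr
    refine Continuous.aestronglyMeasurable ?_
    rw [continuous_iff_continuousAt]
    intro θ
    have hm := circleMap_mem_unit_ball hr.1 hr.2 θ
    refine ContinuousAt.comp ?_ (continuous_circleMap 0 r).continuousAt
    exact hF _ (by simpa using (mem_ball_zero_iff.1 hm).le) (one_add_ne_zero_of_mem_ball hm)
  · filter_upwards [hr] with r hr
    refine ae_of_all _ fun θ _ => hM _ ?_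
    exact (mem_ball_zero_iff.1 (circleMap_mem_unit_ball hr.1 hr.2 θ)).le
  · filter_upwards [ae_one_add_circleMap_ne_zero] with θ hθ hm
    refine (hF _ (by simp) (hθ hm)).tendsto.comp ?_
    have : Continuous fun r : ℝ => circleMap 0 r θ := by
      unfold circleMap
      fun_prop
    exact (this.tendsto 1).mono_left nhdsWithin_le_nhds

theorem continuousAt_singularInner (t : ℝ) {z : ℂ} (hz : 1 + z ≠ 0) :
    ContinuousAt (singularInner t) z := (differentiableAt_singularInner t hz).continuousAt

/-- The means over circles of `singularInner t * conj (singularInner s)` tend to `exp(s - t)`. -/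
theorem tendsto_circleAverage_singularInner {s t : ℝ} (hs : 0 ≤ s) (hst : s ≤ t) :
    Tendsto (fun r => circleAverage (fun z => singularInner t z * conj (singularInner s z)) 0 r)
      (𝓝[<] 1) (𝓝 (Complex.exp (-(t - s : ℝ)))) := by
  have h1 := tendsto_circleAverage (M := 1)
    (F := fun z => singularInner t z * conj (singularInner s z))
    (fun z _ hz => (continuousAt_singularInner t hz).mul
      (Complex.continuous_conj.continuousAt.comp (continuousAt_singularInner s hz)))
    (fun z hz => by
      rw [norm_mul, RCLike.norm_conj]
      exact mul_le_one₀ (norm_singularInner_le (hs.trans hst) hz) (norm_nonneg _)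
        (norm_singularInner_le hs hz))
  have h2 := tendsto_circleAverage (M := 1) (F := singularInner (t - s))
    (fun z _ hz => continuousAt_singularInner _ hz)
    (fun z hz => norm_singularInner_le (sub_nonneg.2 hst) hz)
  -- The product is not analytic inside the disc, but on the circle it agrees with `singularInner (t
  -- - s)`, which is, and whose mean is its value at `0`.
  have h3 : circleAverage (fun z => singularInner t z * conj (singularInner s z)) 0 1
      = circleAverage (singularInner (t - s)) 0 1 :=
    circleAverage_congr_sphere fun z hz => singularInner_mul_conj (by simpa using hz)
  rw [h3]  at h1
  have h4 : circleAverage (singularInner (t - s)) 0 1 = Complex.exp (-(t - s : ℝ)) := by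
    refine tendsto_nhds_unique h2 (tendsto_const_nhds.congr' ?_)
    filter_upwards [Ioo_mem_nhdsLT (show (0 : ℝ) < 1 by norm_num)] with r hr
    rw [circleAverage_singularInner _ hr.1.le hr.2]
  rwa [h4] at h1

/-- The Taylor coefficients at the origin of `singularInner t`. -/
noncomputable def innerCoeff (t : ℝ) (k : ℕ) : ℂ :=
  ((k.factorial : ℂ))⁻¹ * iteratedDeriv k (singularInner t) 0

theorem hasSum_innerCoeff (t : ℝ) : ∀ z ∈ Metric.ball (0 : ℂ) 1,
    HasSum (fun k => innerCoeff t k * z ^ k) (singularInner t z) := by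
  intro z hz
  refine (Complex.hasSum_taylorSeries_on_ball (differentiableOn_singularInner t) hz).congr_fun
    fun k => ?_
  simp [innerCoeff]
  ring

theorem hasSum_innerCoeff_mul_conj {s t r : ℝ} (hs : 0 ≤ s) (h0 : 0 ≤ r) (h1 : r < 1) :
    HasSum (fun k => innerCoeff t k * conj (innerCoeff s k) * (r : ℂ) ^ (2 * k))
      (circleAverage (fun z => singularInner t z * conj (singularInner s z)) 0 r) :=
  hasSum_circleAverage_mul_conj h0 h1 (hasSum_innerCoeff t) (hasSum_innerCoeff s)
    (differentiableOn_singularInner s).continuousOn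
    (fun _ hz => norm_singularInner_le hs (mem_ball_zero_iff.1 hz).le)

/-- By Parseval, the partial sums weighted by `r ^ (2 * k)` are at most the mean of `|singularInner
t|²` on the circle of radius `r`, which tends to `1`. -/
theorem summable_norm_innerCoeff_sq {t : ℝ} (ht : 0 ≤ t) :
    Summable fun k => ‖innerCoeff t k‖ ^ 2 := by
  refine summable_of_sum_le (c := 1) (fun k => by positivity) fun u => ?_
  have key : ∀ r : ℝ, 0 ≤ r → r < 1 → ∑ k ∈ u, ‖innerCoeff t k‖ ^ 2 * r ^ (2 * k) ≤
      (circleAverage (fun z => singularInner t z * conj (singularInner t z)) 0 r).re := by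
    intro r h0 h1
    have h := Complex.hasSum_re (hasSum_innerCoeff_mul_conj (t := t) ht h0 h1)
    have e : ∀ k, (innerCoeff t k * conj (innerCoeff t k) * (r : ℂ) ^ (2 * k)).re
        = ‖innerCoeff t k‖ ^ 2 * r ^ (2 * k) := by
      intro k
      rw [Complex.mul_conj, Complex.normSq_eq_norm_sq]
      norm_cast
    simp only [e] at h
    exact sum_le_hasSum u (fun k _ => by positivity) h
  have l1 : Tendsto (fun r : ℝ => ∑ k ∈ u, ‖innerCoeff t k‖ ^ 2 * r ^ (2 * k)) (𝓝[<] 1)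
      (𝓝 (∑ k ∈ u, ‖innerCoeff t k‖ ^ 2 * 1 ^ (2 * k))) :=
    (Continuous.tendsto (by fun_prop) 1).mono_left nhdsWithin_le_nhds
  have l2 := (Complex.continuous_re.tendsto _).comp
    (tendsto_circleAverage_singularInner ht (le_refl t))
  have := le_of_tendsto_of_tendsto l1 l2 (by
    filter_upwards [Ioo_mem_nhdsLT (show (0 : ℝ) < 1 by norm_num)] with r hr
    exact key r hr.1.le hr.2)
  simpa using this

theorem summable_norm_innerCoeff_mul {s t : ℝ} (hs : 0 ≤ s) (ht : 0 ≤ t) :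
    Summable fun k => ‖innerCoeff t k * conj (innerCoeff s k)‖ := by
  refine Summable.of_nonneg_of_le (fun k => norm_nonneg _) (fun k => ?_)
    ((summable_norm_innerCoeff_sq ht).add (summable_norm_innerCoeff_sq hs))
  rw [norm_mul, RCLike.norm_conj]
  nlinarith [sq_nonneg (‖innerCoeff t k‖ - ‖innerCoeff s k‖), sq_nonneg (‖innerCoeff t k‖),
    sq_nonneg (‖innerCoeff s k‖)]

/-- The Gram matrix of the functions `singularInner t` in the Hardy space of the disc. -/
theorem hasSum_innerCoeff_gram {s t : ℝ} (hs : 0 ≤ s) (hst : s ≤ t) :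
    HasSum (fun k => innerCoeff t k * conj (innerCoeff s k)) (Complex.exp (-(t - s : ℝ))) := by
  have hsum := summable_norm_innerCoeff_mul hs (hs.trans hst)
  -- Abel summation: absolute convergence lets `r → 1` inside the series, and the limit is then
  -- compared with that of the circle means.
  have h : Tendsto (fun r : ℝ => ∑' k, innerCoeff t k * conj (innerCoeff s k) * (r : ℂ) ^ (2 * k))
      (𝓝[<] 1) (𝓝 (∑' k, innerCoeff t k * conj (innerCoeff s k))) := by
    refine tendsto_tsum_of_dominated_convergence hsum (fun k => ?_) ?_
    · have : Continuous fun r : ℝ =>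
        innerCoeff t k * conj (innerCoeff s k) * (r : ℂ) ^ (2 * k) := by fun_prop
      simpa using (this.tendsto 1).mono_left nhdsWithin_le_nhds
    · filter_upwards [Ioo_mem_nhdsLT (show (0 : ℝ) < 1 by norm_num)] with r hr k
      rw [norm_mul, norm_pow, Complex.norm_real, norm_of_nonneg hr.1.le]
      exact mul_le_of_le_one_right (norm_nonneg _) (pow_le_one₀ hr.1.le hr.2.le)
  have h2 := tendsto_nhds_unique h ((tendsto_circleAverage_singularInner hs hst).congr' (by
    filter_upwards [Ioo_mem_nhdsLT (show (0 : ℝ) < 1 by norm_num)] with r hr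
    exact (hasSum_innerCoeff_mul_conj hs hr.1.le hr.2).tsum_eq.symm))
  rw [← h2]
  exact hsum.of_norm.hasSum

end SingularInner

/-! ### Schur's test and operators with prescribed columns -/

section Synthesis

variable {ι H : Type*} [NormedAddCommGroup H] [InnerProductSpace ℂ H]

/-- Schur's test for the Gram matrix of a finite family of vectors. -/
theorem norm_sum_smul_sq_le {ψ : ι → H} {G : ι → ι → ℝ} (hG : ∀ i j, ⟪ψ i, ψ j⟫_ℂ = (G i j : ℂ))
    (hG0 : ∀ i j, 0 ≤ G i j) {p : ι → ℝ} (hp : ∀ i, 0 < p i) {M : ℝ} {S : Finset ι}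
    (hM : ∀ i ∈ S, ∑ j ∈ S, G i j * p j ≤ M * p i) (x : ι → ℂ) :
    ‖∑ i ∈ S, x i • ψ i‖ ^ 2 ≤ M * ∑ i ∈ S, ‖x i‖ ^ 2 := by
  have hsymm : ∀ i j, G i j = G j i := by
    intro i j
    have := inner_conj_symm (𝕜 := ℂ) (ψ i) (ψ j)
    rw [hG, hG, Complex.conj_ofReal] at this
    exact_mod_cast this.symm
  have h1 : ‖∑ i ∈ S, x i • ψ i‖ ^ 2 ≤ ∑ i ∈ S, ∑ j ∈ S, ‖x i‖ * ‖x j‖ * G i j := by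
    have h2 : ‖∑ i ∈ S, x i • ψ i‖ ^ 2
        = ‖⟪∑ i ∈ S, x i • ψ i, ∑ i ∈ S, x i • ψ i⟫_ℂ‖ := by
      rw [inner_self_eq_norm_sq_to_K]
      simp
    rw [h2, sum_inner]
    refine (norm_sum_le _ _).trans (Finset.sum_le_sum fun i _ => ?_)
    rw [inner_sum]
    refine (norm_sum_le _ _).trans (Finset.sum_le_sum fun j _ => ?_)
    rw [inner_smul_left, inner_smul_right, hG, norm_mul, norm_mul, RCLike.norm_conj,
      Complex.norm_real, Real.norm_of_nonneg (hG0 i j), mul_assoc]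
  -- Weighted inequality of the arithmetic and geometric means: the difference of the two sides is a
  -- square times `G i j`. After summation the two halves agree by symmetry.
  have h3 : ∀ i j, ‖x i‖ * ‖x j‖ * G i j ≤
      (‖x i‖ ^ 2 / p i * (G i j * p j) + ‖x j‖ ^ 2 / p j * (G j i * p i)) / 2 := by
    intro i j
    have hi := hp i
    have hj := hp j
    have e : (‖x i‖ ^ 2 / p i * (G i j * p j) + ‖x j‖ ^ 2 / p j * (G j i * p i)) / 2
        - ‖x i‖ * ‖x j‖ * G i j
        = G i j * (‖x i‖ * p j - ‖x j‖ * p i) ^ 2 / (2 * p i * p j) := by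
      rw [hsymm j i]
      field_simp
      ring
    have : 0 ≤ G i j * (‖x i‖ * p j - ‖x j‖ * p i) ^ 2 / (2 * p i * p j) :=
      div_nonneg (mul_nonneg (hG0 i j) (sq_nonneg _)) (by positivity)
    linarith
  refine h1.trans ((Finset.sum_le_sum fun i _ => Finset.sum_le_sum fun j _ => h3 i j).trans ?_)
  simp only [← Finset.sum_div, Finset.sum_add_distrib]
  rw [Finset.sum_comm (f := fun i j => ‖x j‖ ^ 2 / p j * (G j i * p i)), ← two_mul,
    mul_div_cancel_left₀ _ two_ne_zero, Finset.mul_sum]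
  refine Finset.sum_le_sum fun i hi => ?_
  rw [← Finset.mul_sum]
  refine (mul_le_mul_of_nonneg_left (hM i hi) (div_nonneg (sq_nonneg _) (hp i).le)).trans
    (le_of_eq ?_)
  have := (hp i).ne'
  field_simp

theorem lp_hasSum_norm_sq (x : lp (fun _ : ι => ℂ) 2) :
    HasSum (fun i => ‖x i‖ ^ 2) (‖x‖ ^ 2) := by
  have := lp.hasSum_norm (p := 2) (by norm_num) x
  simpa using this

variable [CompleteSpace H]

/-- A family of vectors whose finite combinations are bounded in terms of the `ℓ²` norm of the
coefficients is the image of the standard basis under a bounded operator. -/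
theorem exists_synthesis {ψ : ι → H} {M : ℝ}
    (hM : ∀ (S : Finset ι) (x : ι → ℂ), ‖∑ i ∈ S, x i • ψ i‖ ^ 2 ≤ M * ∑ i ∈ S, ‖x i‖ ^ 2) :
    ∃ C : lp (fun _ : ι => ℂ) 2 →L[ℂ] H,
      (∀ x, HasSum (fun i => x i • ψ i) (C x)) ∧ ∀ y i, C.adjoint y i = ⟪ψ i, y⟫_ℂ := by
  classical
  -- By duality, the hypothesis tested on the coefficients `⟪ψ i, y⟫` bounds the analysis map `y ↦
  -- (⟪ψ i, y⟫)`. The operator sought is its adjoint.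
  have bessel : ∀ (y : H) (S : Finset ι), ∑ i ∈ S, ‖⟪ψ i, y⟫_ℂ‖ ^ 2 ≤ |M| * ‖y‖ ^ 2 := by
    intro y S
    set s := ∑ i ∈ S, ‖⟪ψ i, y⟫_ℂ‖ ^ 2 with hs
    set v := ∑ i ∈ S, ⟪ψ i, y⟫_ℂ • ψ i
    have hs0 : 0 ≤ s := Finset.sum_nonneg fun _ _ => by positivity
    have h1 : ⟪v, y⟫_ℂ = (s : ℂ) := by
      rw [sum_inner, hs]
      push_cast
      refine Finset.sum_congr rfl fun i _ => ?_
      rw [inner_smul_left, mul_comm, Complex.mul_conj, Complex.normSq_eq_norm_sq]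
      push_cast
      rfl
    have h2 : s ≤ ‖v‖ * ‖y‖ := by
      have := norm_inner_le_norm (𝕜 := ℂ) v y
      rwa [h1, Complex.norm_real, Real.norm_of_nonneg hs0] at this
    have h3 : ‖v‖ ^ 2 ≤ |M| * s :=
      (hM S _).trans (mul_le_mul_of_nonneg_right (le_abs_self M) hs0)
    rcases hs0.eq_or_lt with h | h
    · rw [← h]
      positivity
    · have h4 : s ^ 2 ≤ |M| * s * ‖y‖ ^ 2 :=
        calc s ^ 2 ≤ (‖v‖ * ‖y‖) ^ 2 := by gcongr
          _ = ‖v‖ ^ 2 * ‖y‖ ^ 2 := by ring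
          _ ≤ _ := by gcongr
      nlinarith
  let T₀ : H →ₗ[ℂ] lp (fun _ : ι => ℂ) 2 :=
    { toFun := fun y => ⟨fun i => ⟪ψ i, y⟫_ℂ, memℓp_gen' (C := |M| * ‖y‖ ^ 2) fun S => by
        simpa using bessel y S⟩
      map_add' := fun y z => by
        ext i
        exact inner_add_right _ _ _
      map_smul' := fun c y => by
        ext i
        exact inner_smul_right _ _ _ }
  let T : H →L[ℂ] lp (fun _ : ι => ℂ) 2 := T₀.mkContinuous (√|M|) fun y =>
    lp.norm_le_of_forall_sum_le (by norm_num) (by positivity) fun S => by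
      have := bessel y S
      simp only [ENNReal.toReal_ofNat, Real.rpow_ofNat, mul_pow, Real.sq_sqrt (abs_nonneg M)]
      exact this
  have hT : ∀ y i, T y i = ⟪ψ i, y⟫_ℂ := fun y i => rfl
  refine ⟨T.adjoint, fun x => ?_, fun y i => ?_⟩
  · have h := (lp.hasSum_single (p := 2) (by norm_num) x).mapL T.adjoint
    refine h.congr_fun fun i => ?_
    refine ext_inner_right ℂ fun y => ?_
    rw [ContinuousLinearMap.adjoint_inner_left, lp.inner_single_left, hT, inner_smul_left,
      RCLike.inner_apply, mul_comm]
  · rw [ContinuousLinearMap.adjoint_adjoint, hT]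

end Synthesis

/-! ### The images of the basis vectors and their Gram matrix -/

section Symbol

/-- The index `2 ^ k`. -/
def twoPow (k : ℕ) : ℕ+ := 2 ^ k

theorem twoPow_injective : Function.Injective twoPow := fun a b h => by
  have : (2 : ℕ) ^ a = 2 ^ b := by simpa [twoPow] using congrArg PNat.val h
  exact Nat.pow_right_injective (le_refl 2) this

theorem log_nonneg (n : ℕ+) : 0 ≤ Real.log n := Real.log_nonneg (by exact_mod_cast (one_le : 1 ≤ n))

theorem cast_pos (n : ℕ+) : (0 : ℝ) < n := by exact_mod_cast n.pos

/-- The coefficients of the Dirichlet series `n ^ (-φ_α(s))`. -/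
noncomputable def symbolCoeff (α : ℝ) (n : ℕ+) : ℕ+ → ℂ :=
  Function.extend twoPow
    (fun k => ((n : ℝ) ^ (-(1 / 2) : ℝ) : ℝ) * innerCoeff (α * Real.log n) k) 0

theorem symbolCoeff_twoPow (α : ℝ) (n : ℕ+) (k : ℕ) : symbolCoeff α n (twoPow k) =
    ((n : ℝ) ^ (-(1 / 2) : ℝ) : ℝ) * innerCoeff (α * Real.log n) k :=
  twoPow_injective.extend_apply _ _ _

theorem symbolCoeff_of_notMem (α : ℝ) (n : ℕ+) {j : ℕ+} (hj : j ∉ Set.range twoPow) :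
    symbolCoeff α n j = 0 := Function.extend_apply' _ _ _ (by simpa using hj)

theorem memℓp_symbolCoeff {α : ℝ} (hα : 0 ≤ α) (n : ℕ+) : Memℓp (symbolCoeff α n) 2 := by
  refine memℓp_gen ?_
  rw [← twoPow_injective.summable_iff fun j hj => by simp [symbolCoeff_of_notMem α n hj]]
  refine ((summable_norm_innerCoeff_sq (mul_nonneg hα (log_nonneg n))).mul_left
    (((n : ℝ) ^ (-(1 / 2) : ℝ)) ^ 2)).congr fun k => ?_
  simp [symbolCoeff_twoPow, mul_pow]

/-- The Dirichlet series `n ^ (-φ_α(s))`. -/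
noncomputable def symbolPow {α : ℝ} (hα : 0 ≤ α) (n : ℕ+) : DirichletH2 :=
  ⟨symbolCoeff α n, memℓp_symbolCoeff hα n⟩

theorem hardyEntry_comm (α : ℝ) (n m : ℕ+) : hardyEntry α n m = hardyEntry α m n := by
  rw [hardyEntry, hardyEntry, mul_comm, max_comm]

theorem hardyEntry_pos (α : ℝ) (n m : ℕ+) : 0 < hardyEntry α n m := by
  have := cast_pos n
  have := cast_pos m
  have : (0 : ℝ) < max (n : ℝ) m := lt_max_of_lt_left (cast_pos n)
  unfold hardyEntry
  positivity

/-- On each side of the diagonal the entry is a product of a function of `n` and a function of `m`.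
The row sums and the recurrence for eigenvectors rest on this factorization. -/
theorem hardyEntry_of_le (α : ℝ) {n m : ℕ+} (h : m ≤ n) :
    hardyEntry α n m = (n : ℝ) ^ (-(1 / 2) - α) * (m : ℝ) ^ (-(1 / 2) + α) := by
  have h' : (m : ℝ) ≤ n := by exact_mod_cast h
  rw [hardyEntry, max_eq_left h', Real.mul_rpow (cast_pos n).le (cast_pos m).le,
    mul_div_right_comm, ← Real.rpow_sub (cast_pos n)]
  ring_nf

/-- With parameters `α log m` and `α log n`, the Gram value `exp(-(t - s))` is `(m / n) ^ α`. -/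
theorem inner_symbolPow_of_le {α : ℝ} (hα : 0 ≤ α) {m n : ℕ+} (h : m ≤ n) :
    ⟪symbolPow hα m, symbolPow hα n⟫_ℂ = (hardyEntry α n m : ℂ) := by
  have h1 := lp.hasSum_inner (𝕜 := ℂ) (symbolPow hα m) (symbolPow hα n)
  rw [← twoPow_injective.hasSum_iff fun j hj => by
    simp [symbolPow, symbolCoeff_of_notMem α n hj]] at h1
  have hlog : Real.log m ≤ Real.log n :=
    Real.log_le_log (cast_pos m) (by exact_mod_cast h)
  have h2 := (hasSum_innerCoeff_gram (mul_nonneg hα (log_nonneg m))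
    (mul_le_mul_of_nonneg_left hlog hα)).mul_left
      (((n : ℝ) ^ (-(1 / 2) : ℝ) * (m : ℝ) ^ (-(1 / 2) : ℝ) : ℝ) : ℂ)
  refine (h1.unique (h2.congr_fun fun k => ?_)).trans ?_
  · simp only [Function.comp, symbolPow, RCLike.inner_apply, symbolCoeff_twoPow, map_mul,
      Complex.conj_ofReal]
    push_cast
    ring
  · rw [hardyEntry_of_le α h, ← Complex.ofReal_neg, ← Complex.ofReal_exp, ← Complex.ofReal_mul]
    congr 1
    rw [sub_eq_add_neg (-(1 / 2)) α, Real.rpow_add (cast_pos n), Real.rpow_add (cast_pos m),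
      mul_mul_mul_comm]
    congr 1
    rw [Real.rpow_def_of_pos (cast_pos n), Real.rpow_def_of_pos (cast_pos m), ← Real.exp_add]
    ring_nf

theorem inner_symbolPow {α : ℝ} (hα : 0 ≤ α) (m n : ℕ+) :
    ⟪symbolPow hα m, symbolPow hα n⟫_ℂ = (hardyEntry α m n : ℂ) := by
  rcases le_total m n with h | h
  · rw [inner_symbolPow_of_le hα h, hardyEntry_comm]
  · rw [← inner_conj_symm, inner_symbolPow_of_le hα h, Complex.conj_ofReal]

theorem norm_two_cpow_lt {w : ℂ} (hw : w ∈ halfPlane) : (2 : ℂ) ^ (-w) ∈ Metric.ball (0 : ℂ) 1 := by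
  have hw' : 1 / 2 < w.re := hw
  rw [mem_ball_zero_iff]
  have := Complex.norm_natCast_cpow_of_pos (n := 2) two_pos (-w)
  push_cast at this
  rw [this]
  exact Real.rpow_lt_one_of_one_lt_of_neg one_lt_two (by simp; linarith)

/-- Only indices `2 ^ k` contribute, so the pairing is the Taylor series of the singular inner
function at `z = 2 ^ (-w)`. This justifies the coefficients chosen in `symbolCoeff`. -/
theorem inner_kernel_symbolPow {α : ℝ} (hα : 0 ≤ α) (n : ℕ+) (w : halfPlane) :
    ⟪DirichletH2.kernel w, symbolPow hα n⟫_ℂ = (n : ℂ) ^ (-phiSymbol α w) := by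
  have h1 := DirichletH2.hasSum_eval (symbolPow hα n) w
  rw [← twoPow_injective.hasSum_iff fun j hj => by
    simp [symbolPow, symbolCoeff_of_notMem α n hj]] at h1
  have h2 := (hasSum_innerCoeff (α * Real.log n) _ (norm_two_cpow_lt w.2)).mul_left
    (((n : ℝ) ^ (-(1 / 2) : ℝ) : ℝ) : ℂ)
  refine (h1.unique (h2.congr_fun fun k => ?_)).trans ?_
  · have e : ((twoPow k : ℕ+) : ℂ) ^ (-(w : ℂ)) = ((2 : ℂ) ^ (-(w : ℂ))) ^ k := by
      simp only [twoPow, PNat.pow_coe, PNat.val_ofNat, Nat.cast_pow, Nat.cast_ofNat]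
      rw [← Complex.cpow_nat_mul' (by simp [Real.pi_pos]) (by simp [Real.pi_pos.le]),
        Complex.cpow_nat_mul]
    simp only [Function.comp, symbolPow, symbolCoeff_twoPow, e, mul_assoc]
  · have hn : ((n : ℕ) : ℂ) ≠ 0 := by exact_mod_cast n.ne_zero
    rw [singularInner, Complex.ofReal_cpow (cast_pos n).le, phiSymbol, neg_add, Complex.cpow_add _ _ hn]
    push_cast
    congr 1
    rw [Complex.cpow_def_of_ne_zero hn, ← Complex.natCast_log]
    ring_nf

end Symbol

/-! ### Power sums and weighted row sums -/

section PowerInequalities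

theorem one_add_mul_le_rpow_of_nonpos {p s : ℝ} (hp : p ≤ 0) (hs : -1 < s) :
    1 + p * s ≤ (1 + s) ^ p := by
  rw [Real.rpow_def_of_pos (by linarith)]
  have h1 : Real.log (1 + s) ≤ s := by
    have := Real.log_le_sub_one_of_pos (show 0 < 1 + s by linarith)
    linarith
  have h2 := Real.add_one_le_exp (Real.log (1 + s) * p)
  nlinarith

theorem rpow_tangent_of_nonpos {p x y : ℝ} (hp : p ≤ 0) (hx : 0 < x) (hy : 0 < y) :
    x ^ p + p * x ^ (p - 1) * (y - x) ≤ y ^ p := by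
  have h := one_add_mul_le_rpow_of_nonpos hp (s := y / x - 1) (by have := div_pos hy hx; linarith)
  rw [add_sub_cancel, Real.div_rpow hy.le hx.le, le_div_iff₀ (by positivity)] at h
  rw [Real.rpow_sub_one hx.ne']
  refine le_trans (le_of_eq ?_) h
  field_simp

theorem rpow_tangent_of_one_le {p x y : ℝ} (hp : 1 ≤ p) (hx : 0 < x) (hy : 0 ≤ y) :
    x ^ p + p * x ^ (p - 1) * (y - x) ≤ y ^ p := by
  have h := one_add_mul_self_le_rpow_one_add (s := y / x - 1)
    (by have := div_nonneg hy hx.le; linarith) hp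
  rw [add_sub_cancel, Real.div_rpow hy hx.le, le_div_iff₀ (by positivity)] at h
  rw [Real.rpow_sub_one hx.ne']
  refine le_trans (le_of_eq ?_) h
  field_simp

theorem rpow_tangent_of_le_one {p x y : ℝ} (hp0 : 0 ≤ p) (hp : p ≤ 1) (hx : 0 < x) (hy : 0 ≤ y) :
    y ^ p ≤ x ^ p + p * x ^ (p - 1) * (y - x) := by
  have h := rpow_one_add_le_one_add_mul_self (s := y / x - 1)
    (by have := div_nonneg hy hx.le; linarith) hp0 hp
  rw [add_sub_cancel, Real.div_rpow hy hx.le, div_le_iff₀ (by positivity)] at h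
  rw [Real.rpow_sub_one hx.ne']
  refine h.trans (le_of_eq ?_)
  field_simp

theorem mul_add_one_rpow_le {a x : ℝ} (ha : 0 < a) (hx : 0 < x) :
    a * (x + 1) ^ (-a - 1) ≤ x ^ (-a) - (x + 1) ^ (-a) := by
  have := rpow_tangent_of_nonpos (neg_nonpos.2 ha.le) (show 0 < x + 1 by linarith) hx
  linarith

theorem rpow_sub_add_one_rpow_le {a x : ℝ} (ha : 0 < a) (hx : 0 < x) :
    x ^ (-a) - (x + 1) ^ (-a) ≤ a * x ^ (-a - 1) := by
  have := rpow_tangent_of_nonpos (neg_nonpos.2 ha.le) hx (show 0 < x + 1 by linarith)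
  linarith

theorem sum_Ico_le_sub {f g : ℕ → ℝ} {n : ℕ} (h : ∀ k, n ≤ k → g k ≤ f k - f (k + 1)) {N : ℕ}
    (hN : n ≤ N) : ∑ k ∈ Ico n N, g k ≤ f n - f N := by
  induction N, hN using Nat.le_induction with
  | base => simp
  | succ N hN ih =>
    rw [Finset.sum_Ico_succ_top hN]
    linarith [h N hN]

/-- Concavity of `x ^ β` bounds each term by a telescoping difference. The bound has `n` and not `n
+ 1`, which is what yields exactly `2 / α` for `α ≤ 1`. -/
theorem sum_range_add_one_rpow_le_of_le_one {β : ℝ} (hβ : 0 < β) (h1 : β ≤ 1) (n : ℕ) :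
    ∑ k ∈ range n, ((k : ℝ) + 1) ^ (β - 1) ≤ (n : ℝ) ^ β / β := by
  rw [le_div_iff₀ hβ, Finset.sum_mul]
  have := Finset.sum_range_sub (fun k : ℕ => (k : ℝ) ^ β) n
  simp only [Nat.cast_zero, Real.zero_rpow hβ.ne', sub_zero] at this
  rw [← this]
  refine Finset.sum_le_sum fun k _ => ?_
  have hk : (0 : ℝ) ≤ k := k.cast_nonneg
  have := rpow_tangent_of_le_one hβ.le h1 (show 0 < (k : ℝ) + 1 by linarith) hk
  push_cast
  linarith

/-- The terms now increase, so each is compared with the difference to its right, which moves the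
endpoint to `n + 1`. -/
theorem sum_range_add_one_rpow_le_of_one_le {β : ℝ} (h1 : 1 ≤ β) (n : ℕ) :
    ∑ k ∈ range n, ((k : ℝ) + 1) ^ (β - 1) ≤ ((n : ℝ) + 1) ^ β / β := by
  rw [le_div_iff₀ (by linarith), Finset.sum_mul]
  have := Finset.sum_range_sub (fun k : ℕ => ((k : ℝ) + 1) ^ β) n
  have h2 : ∑ k ∈ range n, ((k : ℝ) + 1) ^ (β - 1) * β ≤
      ∑ k ∈ range n, ((((k + 1 : ℕ) : ℝ) + 1) ^ β - ((k : ℝ) + 1) ^ β) := by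
    refine Finset.sum_le_sum fun k _ => ?_
    have hk : (0 : ℝ) ≤ k := k.cast_nonneg
    have := rpow_tangent_of_one_le h1 (show 0 < (k : ℝ) + 1 by linarith)
      (show 0 ≤ (k : ℝ) + 1 + 1 by linarith)
    push_cast
    linarith
  rw [this] at h2
  simp only [Nat.cast_zero, zero_add, Real.one_rpow] at h2
  linarith

theorem sum_range_add_one_rpow_le {β : ℝ} (hβ : 0 < β) (n : ℕ) :
    ∑ k ∈ range n, ((k : ℝ) + 1) ^ (β - 1) ≤ ((n : ℝ) + 1) ^ β / β := by
  rcases le_total 1 β with h | h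
  · exact sum_range_add_one_rpow_le_of_one_le h n
  · refine (sum_range_add_one_rpow_le_of_le_one hβ h n).trans ?_
    have hn : (0 : ℝ) ≤ n := n.cast_nonneg
    gcongr
    linarith

theorem sum_Ico_add_one_rpow_le {a : ℝ} (ha : 0 < a) {n : ℕ} (hn : 0 < n) (N : ℕ) :
    ∑ k ∈ Ico n N, ((k : ℝ) + 1) ^ (-a - 1) ≤ (n : ℝ) ^ (-a) / a := by
  rcases le_total n N with h | h
  · have := sum_Ico_le_sub (f := fun k : ℕ => (k : ℝ) ^ (-a) / a)
      (g := fun k : ℕ => ((k : ℝ) + 1) ^ (-a - 1)) (n := n) (fun k hk => by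
        have hk0 : (0 : ℝ) < k := by exact_mod_cast hn.trans_le hk
        have := mul_add_one_rpow_le ha hk0
        rw [← sub_div, le_div_iff₀ ha]
        push_cast
        linarith) h
    have h2 : (0 : ℝ) ≤ (N : ℝ) ^ (-a) / a := by positivity
    linarith
  · rw [Finset.Ico_eq_empty (by omega)]
    simp only [Finset.sum_empty]
    positivity

theorem sum_pnat_le_sum_nat {g : ℕ → ℝ} (hg : ∀ k, 0 ≤ g k) {S : Finset ℕ+} {T : Finset ℕ}
    (h : ∀ m ∈ S, (m : ℕ) - 1 ∈ T) : ∑ m ∈ S, g ((m : ℕ) - 1) ≤ ∑ k ∈ T, g k := by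
  have hinj : Set.InjOn (fun m : ℕ+ => (m : ℕ) - 1) S := fun a _ b _ hab => by
    have := a.pos
    have := b.pos
    exact PNat.eq (by simp only at hab; omega)
  rw [← Finset.sum_image (f := g) hinj]
  refine Finset.sum_le_sum_of_subset_of_nonneg ?_ fun k _ _ => hg k
  intro k hk
  obtain ⟨m, hm, rfl⟩ := Finset.mem_image.1 hk
  exact h m hm

theorem cast_pred_add_one (m : ℕ+) : (((m : ℕ) - 1 : ℕ) : ℝ) + 1 = (m : ℝ) := by
  have := m.pos
  exact_mod_cast (show (m : ℕ) - 1 + 1 = m by omega)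

/-- The row sums of the matrix, weighted by `m ^ (-1/2)`. -/
theorem sum_hardyEntry_mul_le {α c : ℝ} (hα : 0 < α) {n : ℕ+}
    (hc : ∑ k ∈ range n, ((k : ℝ) + 1) ^ (α - 1) ≤ c * (n : ℝ) ^ α / α) (S : Finset ℕ+) :
    ∑ m ∈ S, hardyEntry α n m * (m : ℝ) ^ (-(1 / 2) : ℝ) ≤
      (c + 1) / α * (n : ℝ) ^ (-(1 / 2) : ℝ) := by
  have hn := cast_pos n
  rw [← Finset.sum_filter_add_sum_filter_not S (fun m => m ≤ n)]
  have h1 : ∑ m ∈ S with m ≤ n, hardyEntry α n m * (m : ℝ) ^ (-(1 / 2) : ℝ) ≤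
      c / α * (n : ℝ) ^ (-(1 / 2) : ℝ) := by
    have e : ∀ m ∈ S.filter (fun m => m ≤ n), hardyEntry α n m * (m : ℝ) ^ (-(1 / 2) : ℝ) =
        (n : ℝ) ^ (-(1 / 2) - α) * ((((m : ℕ) - 1 : ℕ) : ℝ) + 1) ^ (α - 1) := by
      intro m hm
      rw [hardyEntry_of_le α (Finset.mem_filter.1 hm).2, cast_pred_add_one, mul_assoc,
        ← Real.rpow_add (cast_pos m)]
      ring_nf
    rw [Finset.sum_congr rfl e, ← Finset.mul_sum]
    have h2 := (sum_pnat_le_sum_nat (g := fun k => ((k : ℝ) + 1) ^ (α - 1))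
      (fun k => by positivity) (S := S.filter (fun m => m ≤ n)) (T := range n) (fun m hm => by
        have h3 : (m : ℕ) ≤ n := (Finset.mem_filter.1 hm).2
        have := m.pos
        rw [Finset.mem_range]
        omega)).trans hc
    refine (mul_le_mul_of_nonneg_left h2 (by positivity)).trans (le_of_eq ?_)
    rw [Real.rpow_sub hn]
    field_simp
  have h2 : ∑ m ∈ S with ¬m ≤ n, hardyEntry α n m * (m : ℝ) ^ (-(1 / 2) : ℝ) ≤
      1 / α * (n : ℝ) ^ (-(1 / 2) : ℝ) := by
    have e : ∀ m ∈ S.filter (fun m => ¬m ≤ n), hardyEntry α n m * (m : ℝ) ^ (-(1 / 2) : ℝ) =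
        (n : ℝ) ^ (-(1 / 2) + α) * ((((m : ℕ) - 1 : ℕ) : ℝ) + 1) ^ (-α - 1) := by
      intro m hm
      rw [hardyEntry_comm, hardyEntry_of_le α (not_le.1 (Finset.mem_filter.1 hm).2).le,
        cast_pred_add_one, mul_right_comm, ← Real.rpow_add (cast_pos m), mul_comm]
      ring_nf
    rw [Finset.sum_congr rfl e, ← Finset.mul_sum]
    have h2 := (sum_pnat_le_sum_nat (g := fun k => ((k : ℝ) + 1) ^ (-α - 1))
      (fun k => by positivity) (S := S.filter (fun m => ¬m ≤ n))
      (T := Ico (n : ℕ) (S.sup fun m => (m : ℕ))) (fun m hm => by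
        have h3 : (n : ℕ) < m := not_le.1 (Finset.mem_filter.1 hm).2
        have h4 : (m : ℕ) ≤ S.sup fun m => (m : ℕ) :=
          Finset.le_sup (f := fun m : ℕ+ => (m : ℕ)) (Finset.mem_filter.1 hm).1
        rw [Finset.mem_Ico]
        omega)).trans (sum_Ico_add_one_rpow_le hα n.pos _)
    refine (mul_le_mul_of_nonneg_left h2 (by positivity)).trans (le_of_eq ?_)
    rw [Real.rpow_add hn, Real.rpow_neg hn.le α]
    field_simp
  calc _ ≤ _ := add_le_add h1 h2
    _ = _ := by ring

/-- For `α ≤ 1` the weighted row sums are bounded with the constant of the continuous kernel. -/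
theorem sum_hardyEntry_mul_le_of_le_one {α : ℝ} (hα : 0 < α) (h1 : α ≤ 1) (n : ℕ+)
    (S : Finset ℕ+) : ∑ m ∈ S, hardyEntry α n m * (m : ℝ) ^ (-(1 / 2) : ℝ) ≤
      2 / α * (n : ℝ) ^ (-(1 / 2) : ℝ) := by
  have := sum_hardyEntry_mul_le (c := 1) hα (n := n) (by
    rw [one_mul]
    exact sum_range_add_one_rpow_le_of_le_one hα h1 n) S
  norm_num at this ⊢
  exact this

/-- The constant decreases to `2 / α` as `N → ∞`, which controls the essential norm; `N = 1` gives
boundedness. -/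
theorem sum_hardyEntry_mul_le_of_ge {α : ℝ} (hα : 0 < α) {N n : ℕ+} (h : N ≤ n)
    (S : Finset ℕ+) : ∑ m ∈ S, hardyEntry α n m * (m : ℝ) ^ (-(1 / 2) : ℝ) ≤
      ((1 + 1 / (N : ℝ)) ^ α + 1) / α * (n : ℝ) ^ (-(1 / 2) : ℝ) := by
  refine sum_hardyEntry_mul_le hα ((sum_range_add_one_rpow_le hα n).trans ?_) S
  have hn := cast_pos n
  have hN := cast_pos N
  gcongr
  rw [← Real.mul_rpow (by positivity) hn.le]
  have : (1 : ℝ) ≤ 1 / N * n := by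
    rw [one_div_mul_eq_div, le_div_iff₀ hN, one_mul]
    exact_mod_cast h
  gcongr
  linarith

end PowerInequalities

/-! ### The composition operator and its Gram operator -/

section Operator

/-- The composition operator of `φ_α`, through its action on coefficient sequences. -/
theorem exists_composition {α : ℝ} (hα : 0 < α) :
    ∃ C : DirichletH2 →L[ℂ] DirichletH2,
      (∀ x, HasSum (fun i => x i • symbolPow hα.le i) (C x)) ∧
        ∀ y i, C.adjoint y i = ⟪symbolPow hα.le i, y⟫_ℂ :=
  exists_synthesis fun S x => norm_sum_smul_sq_le (inner_symbolPow hα.le)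
    (fun i j => (hardyEntry_pos α i j).le) (p := fun i => (i : ℝ) ^ (-(1 / 2) : ℝ))
    (fun i => Real.rpow_pos_of_pos (cast_pos i) _)
    (fun i _ => sum_hardyEntry_mul_le_of_ge hα (one_le : 1 ≤ i) S) x

variable {α : ℝ} {hα : 0 < α} {C : DirichletH2 →L[ℂ] DirichletH2}

/-- Evaluation at `s` is the inner product with a kernel, hence continuous, and may be applied term
by term. -/
theorem isCompositionOperator_of_hasSum
    (hC : ∀ x, HasSum (fun i => x i • symbolPow hα.le i) (C x)) :
    IsCompositionOperator (phiSymbol α) C := by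
  intro f s hs
  have h1 := (DirichletH2.hasSum_eval (C f) ⟨s, hs⟩).tsum_eq
  have h2 := (hC f).mapL (innerSL ℂ (DirichletH2.kernel ⟨s, hs⟩))
  simp only [innerSL_apply_apply, inner_smul_right, inner_kernel_symbolPow] at h2
  change ∑' n : ℕ+, _ = _
  rw [h1, ← h2.tsum_eq]
  rfl

theorem isMatrixOperator_of_hasSum
    (hC : ∀ x, HasSum (fun i => x i • symbolPow hα.le i) (C x))
    (hC' : ∀ y i, C.adjoint y i = ⟪symbolPow hα.le i, y⟫_ℂ) :
    IsMatrixOperator (hardyEntry α) (C.adjoint ∘L C) := by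
  intro x n
  have h2 := (hC x).mapL (innerSL ℂ (symbolPow hα.le n))
  simp only [innerSL_apply_apply, inner_smul_right, inner_symbolPow] at h2
  rw [ContinuousLinearMap.comp_apply, hC']
  simpa only [mul_comm] using h2

/-- Schur's test uses only the rows in the support of `x`. Restricting it to a predicate `P` serves
both the full norm and the norm on large indices. -/
theorem norm_sq_le_of_row_bound
    (hC : ∀ x, HasSum (fun i => x i • symbolPow hα.le i) (C x)) {P : ℕ+ → Prop} {M : ℝ}
    (hM : ∀ i, P i → ∀ S : Finset ℕ+, ∑ j ∈ S, hardyEntry α i j * (j : ℝ) ^ (-(1 / 2) : ℝ) ≤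
      M * (i : ℝ) ^ (-(1 / 2) : ℝ)) {x : DirichletH2} (hx : ∀ i, ¬P i → x i = 0) :
    ‖C x‖ ^ 2 ≤ M * ‖x‖ ^ 2 := by
  classical
  refine le_of_tendsto_of_tendsto ((hC x).norm.pow 2) ((lp_hasSum_norm_sq x).const_mul M) ?_
  refine Eventually.of_forall fun S => ?_
  have h := norm_sum_smul_sq_le (inner_symbolPow hα.le)
    (fun i j => (hardyEntry_pos α i j).le) (p := fun i => (i : ℝ) ^ (-(1 / 2) : ℝ))
    (fun i => Real.rpow_pos_of_pos (cast_pos i) _) (S := S.filter P)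
    (fun i hi => hM i (Finset.mem_filter.1 hi).2 _) x
  rw [Finset.sum_filter_of_ne fun i _ h => by_contra fun hP => h (by simp [hx i hP]),
    Finset.sum_filter_of_ne fun i _ h => by_contra fun hP => h (by simp [hx i hP])] at h
  exact h

theorem differentiableOn_phiSymbol (α : ℝ) : DifferentiableOn ℂ (phiSymbol α) halfPlane := by
  intro s hs
  have h1 := one_add_ne_zero_of_mem_ball (norm_two_cpow_lt hs)
  have h2 : DifferentiableAt ℂ (fun s : ℂ => (2 : ℂ) ^ (-s)) s :=
    differentiableAt_id.neg.const_cpow (Or.inl two_ne_zero)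
  unfold phiSymbol
  have h3 : DifferentiableAt ℂ (fun s : ℂ => (1 - (2 : ℂ) ^ (-s)) / (1 + (2 : ℂ) ^ (-s))) s :=
    (h2.const_sub 1).div (h2.const_add 1) h1
  exact ((h3.const_mul _).const_add _).differentiableWithinAt

theorem mapsTo_phiSymbol {α : ℝ} (hα : 0 < α) : Set.MapsTo (phiSymbol α) halfPlane halfPlane := by
  intro s hs
  have hb := norm_two_cpow_lt hs
  have h1 := one_add_ne_zero_of_mem_ball hb
  have h2 := mem_ball_zero_iff.1 hb
  change 1 / 2 < (phiSymbol α s).re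
  rw [phiSymbol, Complex.add_re, Complex.re_ofReal_mul, re_cayley]
  have h3 : ‖(2 : ℂ) ^ (-s)‖ ^ 2 < 1 := by nlinarith [norm_nonneg ((2 : ℂ) ^ (-s))]
  have := mul_pos hα (div_pos (sub_pos.2 h3) (Complex.normSq_pos.2 h1))
  norm_num
  exact this

end Operator

/-! ### Head and tail sums of a row -/

section Decomposition

/-- The sum over `m ≤ N + 1` in row `N + 1` of the matrix, without the factor depending on the
row; `X k` is the coordinate of index `k + 1`. -/
noncomputable def headSum (α : ℝ) (X : ℕ → ℝ) (N : ℕ) : ℝ :=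
  ∑ k ∈ range (N + 1), ((k : ℝ) + 1) ^ (α - 1 / 2) * X k

/-- The sum over `m > N + 1` in row `N + 1` of the matrix, without the factor depending on the
row; `X k` is the coordinate of index `k + 1`. -/
noncomputable def tailSum (α : ℝ) (X : ℕ → ℝ) (N : ℕ) : ℝ :=
  ∑' k : ℕ, ((k : ℝ) + N + 2) ^ (-α - 1 / 2) * X (k + (N + 1))

theorem hasSum_pnat_iff {f : ℕ+ → ℝ} {y : ℝ} :
    HasSum (fun k : ℕ => f k.succPNat) y ↔ HasSum f y :=
  Equiv.pnatEquivNat.symm.hasSum_iff (f := f)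

theorem cast_succPNat (k : ℕ) : ((k.succPNat : ℕ) : ℝ) = (k : ℝ) + 1 := by
  simp

theorem succPNat_le {k N : ℕ} (h : k ≤ N) : k.succPNat ≤ N.succPNat :=
  Nat.succPNat_mono h

variable {α : ℝ} {x : ℕ+ → ℝ} {y : ℝ} {N : ℕ}

theorem summable_tailSum (h : HasSum (fun m => hardyEntry α N.succPNat m * x m) y) :
    Summable fun k : ℕ => ((k : ℝ) + N + 2) ^ (-α - 1 / 2) * x (k + (N + 1)).succPNat := by
  have h1 := (summable_nat_add_iff (N + 1)).2 (hasSum_pnat_iff.2 h).summable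
  have hN : (0 : ℝ) < (N : ℝ) + 1 := by positivity
  refine (h1.mul_left (((N : ℝ) + 1) ^ (1 / 2 - α))).congr fun k => ?_
  have hk : (0 : ℝ) ≤ k := k.cast_nonneg
  rw [hardyEntry_comm, hardyEntry_of_le α (succPNat_le (by omega)), cast_succPNat, cast_succPNat]
  push_cast
  rw [mul_assoc, mul_left_comm, ← mul_assoc (_ ^ (1 / 2 - α)), ← Real.rpow_add hN]
  ring_nf
  simp

/-- The factorization of the entries on the two sides of the diagonal; the diagonal term is counted
in the head. -/
theorem sqrt_mul_eq_headSum_add_tailSum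
    (h : HasSum (fun m => hardyEntry α N.succPNat m * x m) y) :
    ((N : ℝ) + 1) ^ (1 / 2 : ℝ) * y =
      ((N : ℝ) + 1) ^ (-α) * headSum α (fun k => x k.succPNat) N +
      ((N : ℝ) + 1) ^ α * tailSum α (fun k => x k.succPNat) N := by
  have h0 := hasSum_pnat_iff.2 h
  have hN : (0 : ℝ) < (N : ℝ) + 1 := by positivity
  rw [← h0.tsum_eq, ← h0.summable.sum_add_tsum_nat_add (N + 1), mul_add, headSum, tailSum,
    Finset.mul_sum, Finset.mul_sum, ← tsum_mul_left, ← tsum_mul_left]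
  congr 1
  · refine Finset.sum_congr rfl fun k hk => ?_
    rw [hardyEntry_of_le α (succPNat_le (by have := Finset.mem_range.1 hk; omega)), cast_succPNat,
      cast_succPNat, ← mul_assoc, ← mul_assoc, ← Real.rpow_add hN]
    ring_nf
  · refine tsum_congr fun k => ?_
    have hk : (0 : ℝ) ≤ k := k.cast_nonneg
    rw [hardyEntry_comm, hardyEntry_of_le α (succPNat_le (by omega)), cast_succPNat,
      cast_succPNat, mul_comm (_ ^ (-(1 / 2) - α)), ← mul_assoc, ← mul_assoc, ← Real.rpow_add hN]
    push_cast
    ring_nf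

theorem headSum_succ (α : ℝ) (X : ℕ → ℝ) (N : ℕ) :
    headSum α X (N + 1) = headSum α X N + ((N : ℝ) + 2) ^ (α - 1 / 2) * X (N + 1) := by
  rw [headSum, Finset.sum_range_succ, ← headSum]
  push_cast
  ring_nf

theorem tailSum_eq_add {X : ℕ → ℝ}
    (h : Summable fun k : ℕ => ((k : ℝ) + N + 2) ^ (-α - 1 / 2) * X (k + (N + 1))) :
    tailSum α X N = ((N : ℝ) + 2) ^ (-α - 1 / 2) * X (N + 1) + tailSum α X (N + 1) := by
  rw [tailSum, h.tsum_eq_zero_add, tailSum]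
  congr 1
  · simp
  · refine tsum_congr fun k => ?_
    push_cast
    ring_nf

end Decomposition

/-! ### Lower bound on reproducing kernels -/

section KernelLowerBound

/-- A real point of the half-plane. -/
def realPoint (σ : ℝ) (hσ : 1 / 2 < σ) : halfPlane := ⟨(σ : ℂ), by simpa [halfPlane] using hσ⟩

theorem kernel_realPoint_apply {σ : ℝ} (hσ : 1 / 2 < σ) (n : ℕ+) :
    DirichletH2.kernel (realPoint σ hσ) n = (((n : ℝ) ^ (-σ) : ℝ) : ℂ) := by
  rw [Complex.ofReal_cpow (cast_pos n).le]
  simp [DirichletH2.kernel, realPoint]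

theorem hasSum_norm_kernel_sq {σ : ℝ} (hσ : 1 / 2 < σ) :
    HasSum (fun k : ℕ => ((k : ℝ) + 1) ^ (-(2 * σ))) (‖DirichletH2.kernel (realPoint σ hσ)‖ ^ 2) := by
  have h := hasSum_pnat_iff.2 (lp_hasSum_norm_sq (DirichletH2.kernel (realPoint σ hσ)))
  refine h.congr_fun fun k => ?_
  rw [kernel_realPoint_apply, Complex.norm_real, cast_succPNat, Real.norm_of_nonneg (by positivity),
    ← Real.rpow_mul_natCast (by positivity)]
  push_cast
  ring_nf

/-- The norm of the reproducing kernel at a real point blows up at the boundary. -/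
theorem exists_lt_norm_kernel_sq (D : ℝ) : ∃ ε > 0, ∀ σ, ∀ hσ : 1 / 2 < σ, σ < 1 / 2 + ε →
    D < ‖DirichletH2.kernel (realPoint σ hσ)‖ ^ 2 := by
  -- At `σ = 1/2` the squared norm becomes the divergent harmonic series; a partial sum exceeding
  -- `D` still exceeds it for `σ` nearby.
  obtain ⟨n, hn⟩ :=
    (Real.tendsto_sum_range_one_div_nat_succ_atTop.eventually (eventually_gt_atTop D)).exists
  have hc : Continuous fun σ : ℝ => ∑ k ∈ range n, ((k : ℝ) + 1) ^ (-(2 * σ)) := by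
    refine continuous_finsetSum _ fun k _ => ?_
    exact Continuous.rpow continuous_const (by fun_prop) fun σ => Or.inl (by positivity)
  have h1 : D < ∑ k ∈ range n, ((k : ℝ) + 1) ^ (-(2 * (1 / 2 : ℝ))) := by
    refine hn.trans_le (le_of_eq (Finset.sum_congr rfl fun k _ => ?_))
    norm_num
    rw [Real.rpow_neg_one]
  obtain ⟨ε, hε, h2⟩ := Metric.eventually_nhds_iff.1 (hc.continuousAt.eventually (lt_mem_nhds h1))
  refine ⟨ε, hε, fun σ hσ hσε => ?_⟩
  refine (h2 (y := σ) ?_).trans_le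
    (sum_le_hasSum (range n) (fun k _ => by positivity) (hasSum_norm_kernel_sq hσ))
  rw [Real.dist_eq, abs_of_pos (by linarith)]
  linarith

theorem le_headSum_rpow {β : ℝ} (hβ : 0 < β) (N : ℕ) :
    (((N : ℝ) + 1) ^ β - 1) / β ≤ ∑ k ∈ range (N + 1), ((k : ℝ) + 1) ^ (β - 1) := by
  rw [div_le_iff₀ hβ, Finset.sum_mul]
  have hN : (0 : ℝ) ≤ N := N.cast_nonneg
  rcases le_total 1 β with h | h
  · have e := Finset.sum_range_sub (fun k : ℕ => (k : ℝ) ^ β) (N + 1)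
    simp only [Nat.cast_zero, Real.zero_rpow hβ.ne', sub_zero] at e
    have : ((N + 1 : ℕ) : ℝ) ^ β ≤ ∑ k ∈ range (N + 1), ((k : ℝ) + 1) ^ (β - 1) * β := by
      rw [← e]
      refine Finset.sum_le_sum fun k _ => ?_
      have hk : (0 : ℝ) ≤ k := k.cast_nonneg
      have := rpow_tangent_of_one_le h (show 0 < (k : ℝ) + 1 by linarith) hk
      push_cast
      linarith
    push_cast at this
    linarith
  · have e := Finset.sum_range_sub (fun k : ℕ => ((k : ℝ) + 1) ^ β) (N + 1)
    simp only [Nat.cast_zero, zero_add, Real.one_rpow] at e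
    have h1 : ((N + 1 : ℕ) + 1 : ℝ) ^ β - 1 ≤ ∑ k ∈ range (N + 1), ((k : ℝ) + 1) ^ (β - 1) * β := by
      rw [← e]
      refine Finset.sum_le_sum fun k _ => ?_
      have hk : (0 : ℝ) ≤ k := k.cast_nonneg
      have := rpow_tangent_of_le_one hβ.le h (show 0 < (k : ℝ) + 1 by linarith)
        (show 0 ≤ (k : ℝ) + 1 + 1 by linarith)
      push_cast
      linarith
    have h2 : ((N : ℝ) + 1) ^ β ≤ ((N + 1 : ℕ) + 1 : ℝ) ^ β := by
      push_cast
      gcongr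
      linarith
    linarith

theorem summable_nat_add_rpow {a c : ℝ} (ha : 0 < a) (hc : 0 ≤ c) :
    Summable fun k : ℕ => ((k : ℝ) + c) ^ (-a - 1) := by
  refine (Real.summable_nat_rpow.2 (show -a - 1 < -1 by linarith)).of_norm_bounded_eventually_nat ?_
  filter_upwards [eventually_gt_atTop 0] with k hk
  have hk : (0 : ℝ) < k := by exact_mod_cast hk
  rw [Real.norm_of_nonneg (by positivity)]
  exact Real.rpow_le_rpow_of_nonpos hk (by linarith) (by linarith)

theorem tendsto_nat_add_rpow_neg {a c : ℝ} (ha : 0 < a) :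
    Tendsto (fun k : ℕ => ((k : ℝ) + c) ^ (-a)) atTop (𝓝 0) :=
  (tendsto_rpow_neg_atTop ha).comp
    (tendsto_atTop_add_const_right _ _ tendsto_natCast_atTop_atTop)

theorem hasSum_nat_add_rpow_sub {a c : ℝ} (ha : 0 < a) (hc : 0 < c) :
    HasSum (fun k : ℕ => ((k : ℝ) + c) ^ (-a) - ((k : ℝ) + c + 1) ^ (-a)) (c ^ (-a)) := by
  rw [hasSum_iff_tendsto_nat_of_nonneg]
  · have e : ∀ n : ℕ, ∑ k ∈ range n, (((k : ℝ) + c) ^ (-a) - ((k : ℝ) + c + 1) ^ (-a))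
        = c ^ (-a) - ((n : ℝ) + c) ^ (-a) := by
      intro n
      have := Finset.sum_range_sub' (fun k : ℕ => ((k : ℝ) + c) ^ (-a)) n
      simp only [Nat.cast_zero, zero_add] at this
      rw [← this]
      refine Finset.sum_congr rfl fun k _ => ?_
      push_cast
      ring_nf
    simp only [e]
    simpa using (tendsto_nat_add_rpow_neg (c := c) ha).const_sub (c ^ (-a))
  · intro k
    rw [sub_nonneg]
    exact Real.rpow_le_rpow_of_nonpos (by positivity) (by linarith) (by linarith)

/-- The tail of a convergent `p`-series is at least the corresponding integral. -/
theorem le_tsum_nat_add_rpow {a c : ℝ} (ha : 0 < a) (hc : 0 < c) :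
    c ^ (-a) / a ≤ ∑' k : ℕ, ((k : ℝ) + c) ^ (-a - 1) := by
  have h1 := (hasSum_nat_add_rpow_sub ha hc).div_const a
  refine hasSum_le (fun k => ?_) h1 (summable_nat_add_rpow ha hc.le).hasSum
  rw [div_le_iff₀ ha, mul_comm]
  exact rpow_sub_add_one_rpow_le ha (by positivity)

variable {α : ℝ} {hα : 0 < α} {C : DirichletH2 →L[ℂ] DirichletH2}

theorem hasSum_re_of_isMatrixOperator {a : ℕ+ → ℕ+ → ℝ} {K : DirichletH2 →L[ℂ] DirichletH2}
    (hK : IsMatrixOperator a K) (x : DirichletH2) (n : ℕ+) :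
    HasSum (fun m => a n m * (x m).re) (K x n).re := by
  have := Complex.hasSum_re (hK x n)
  simpa only [Complex.re_ofReal_mul] using this

theorem hasSum_norm_composition_sq (C : DirichletH2 →L[ℂ] DirichletH2) (x : DirichletH2) :
    HasSum (fun n => ((C.adjoint ∘L C) x n * conj (x n)).re) (‖C x‖ ^ 2) := by
  have h := Complex.hasSum_re (lp.hasSum_inner (𝕜 := ℂ) x ((C.adjoint ∘L C) x))
  rw [ContinuousLinearMap.comp_apply, ContinuousLinearMap.adjoint_inner_right,
    inner_self_eq_norm_sq_to_K] at h
  convert h using 1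
  · rfl
  exact (Complex.ofReal_re (‖C x‖ ^ 2)).symm.trans (by push_cast; rfl)

/-- On the reproducing kernels near the boundary, the composition operator is at least as large as
the operator on `L²(0, ∞)` with the kernel of the same formula. -/
theorem le_norm_composition_kernel_sq
    (hK : IsMatrixOperator (hardyEntry α) (C.adjoint ∘L C)) (hα : 0 < α) :
    ∃ D : ℝ, ∀ σ, ∀ hσ : 1 / 2 < σ, σ < 1 / 2 + α / 2 →
      2 / α * ‖DirichletH2.kernel (realPoint σ hσ)‖ ^ 2 - D ≤
        ‖C (DirichletH2.kernel (realPoint σ hσ))‖ ^ 2 := by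
  have s1 := (summable_nat_add_rpow hα zero_le_one).mul_left (2 / α)
  have s2 := summable_nat_add_rpow one_pos zero_le_one
  -- The constant sums the endpoint errors of the comparisons with integrals, one for the head and
  -- one for the tail, bounded uniformly in `σ`.
  refine ⟨∑' k : ℕ, (2 / α * ((k : ℝ) + 1) ^ (-α - 1) + ((k : ℝ) + 1) ^ (-1 - 1 : ℝ)),
    fun σ hσ hσα => ?_⟩
  set x := DirichletH2.kernel (realPoint σ hσ) with hx
  refine hasSum_le (fun N => ?_) (((hasSum_norm_kernel_sq hσ).mul_left (2 / α)).sub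
    (s1.add s2).hasSum) (hasSum_pnat_iff.2 (hasSum_norm_composition_sq C x))
  have hrow := hasSum_re_of_isMatrixOperator hK x N.succPNat
  have hX : ∀ k : ℕ, (x k.succPNat).re = ((k : ℝ) + 1) ^ (-σ) := by
    intro k
    rw [hx, kernel_realPoint_apply, cast_succPNat, Complex.ofReal_re]
  have hdec := sqrt_mul_eq_headSum_add_tailSum hrow
  set y := ((C.adjoint ∘L C) x N.succPNat).re
  have e : ((C.adjoint ∘L C) x N.succPNat * conj (x N.succPNat)).re
      = y * ((N : ℝ) + 1) ^ (-σ) := by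
    rw [hx, kernel_realPoint_apply, cast_succPNat, Complex.conj_ofReal, mul_comm,
      Complex.re_ofReal_mul, mul_comm]
  rw [e]
  set δ := σ - 1 / 2 with hδ
  have hδ0 : 0 < δ := by linarith
  set β := α - δ with hβ
  set a := α + δ with ha
  have hβ0 : α / 2 < β := by linarith
  have hβ00 : 0 < β := by linarith
  have ha0 : 0 < a := by linarith
  set t := (N : ℝ) + 1 with ht
  have ht1 : 1 ≤ t := by
    have : (0 : ℝ) ≤ N := N.cast_nonneg
    linarith
  have ht0 : 0 < t := by linarith
  have hA : (t ^ β - 1) / β ≤ headSum α (fun k => (x k.succPNat).re) N := by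
    refine (le_headSum_rpow hβ00 N).trans (le_of_eq ?_)
    rw [headSum]
    refine Finset.sum_congr rfl fun k _ => ?_
    rw [hX, ← Real.rpow_add (by positivity)]
    congr 1
    rw [hβ, hδ]
    ring
  have hB : t ^ (-a) / a - t ^ (-a - 1) ≤ tailSum α (fun k => (x k.succPNat).re) N := by
    have h1 := le_tsum_nat_add_rpow ha0 (show 0 < t + 1 by linarith)
    have h2 : tailSum α (fun k => (x k.succPNat).re) N
        = ∑' k : ℕ, ((k : ℝ) + (t + 1)) ^ (-a - 1) := by
      rw [tailSum]
      refine tsum_congr fun k => ?_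
      have hk : (0 : ℝ) ≤ k := k.cast_nonneg
      rw [hX, ht]
      push_cast
      have e1 : (k : ℝ) + (N + 1) + 1 = k + N + 2 := by ring
      have e2 : (k : ℝ) + (N + 1 + 1) = k + N + 2 := by ring
      rw [e1, e2, ← Real.rpow_add (by positivity)]
      congr 1
      rw [ha, hδ]
      ring
    rw [h2]
    refine le_trans ?_ h1
    have h3 := rpow_sub_add_one_rpow_le ha0 ht0
    rw [le_div_iff₀ ha0, sub_mul, div_mul_cancel₀ _ ha0.ne']
    linarith
  have hlow : t ^ (-1 - δ) * (t ^ (-α) * ((t ^ β - 1) / β) +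
      t ^ α * (t ^ (-a) / a - t ^ (-a - 1))) ≤ y * t ^ (-σ) := by
    have e3 : y * t ^ (-σ) = t ^ (-1 - δ) * (t ^ (1 / 2 : ℝ) * y) := by
      rw [mul_comm, ← mul_assoc, ← Real.rpow_add ht0]
      congr 2
      rw [hδ]
      ring
    rw [e3, hdec]
    gcongr
  have p1 : t ^ (-1 - δ) * (t ^ (-α) * t ^ β) = t ^ (-(2 * σ)) := by
    rw [← Real.rpow_add ht0, ← Real.rpow_add ht0]
    congr 1
    rw [hβ, hδ]
    ring
  have p2 : t ^ (-1 - δ) * (t ^ α * t ^ (-a)) = t ^ (-(2 * σ)) := by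
    rw [← Real.rpow_add ht0, ← Real.rpow_add ht0]
    congr 1
    rw [ha, hδ]
    ring
  have p3 : t ^ (-1 - δ) * t ^ (-α) ≤ t ^ (-α - 1) := by
    rw [← Real.rpow_add ht0]
    exact Real.rpow_le_rpow_of_exponent_le ht1 (by linarith)
  have p4 : t ^ (-1 - δ) * (t ^ α * t ^ (-a - 1)) ≤ t ^ (-1 - 1 : ℝ) := by
    rw [← Real.rpow_add ht0, ← Real.rpow_add ht0]
    exact Real.rpow_le_rpow_of_exponent_le ht1 (by linarith)
  -- Head and tail contribute `1 / (α - δ)` and `1 / (α + δ)`; by convexity their sum is at least `2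
  -- / α`.
  have q1 : 2 / α ≤ 1 / β + 1 / a := by
    rw [div_add_div _ _ hβ00.ne' ha0.ne', div_le_div_iff₀ hα (by positivity)]
    have : β + a = 2 * α := by rw [hβ, ha]; ring
    have : β * a = α ^ 2 - δ ^ 2 := by rw [hβ, ha]; ring
    nlinarith [sq_nonneg δ]
  have q2 : 1 / β ≤ 2 / α := by
    rw [div_le_div_iff₀ hβ00 hα]
    linarith
  have p5 : 1 / β * (t ^ (-1 - δ) * t ^ (-α)) ≤ 2 / α * t ^ (-α - 1) := by gcongr
  have p6 : 2 / α * t ^ (-(2 * σ)) ≤ (1 / β + 1 / a) * t ^ (-(2 * σ)) := by gcongr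
  refine le_trans ?_ hlow
  calc 2 / α * t ^ (-(2 * σ)) - (2 / α * t ^ (-α - 1) + t ^ (-1 - 1 : ℝ))
      ≤ 1 / β * t ^ (-(2 * σ)) - 1 / β * (t ^ (-1 - δ) * t ^ (-α)) + 1 / a * t ^ (-(2 * σ))
        - t ^ (-1 - δ) * (t ^ α * t ^ (-a - 1)) := by linear_combination p4 + p5 + p6
    _ = 1 / β * (t ^ (-1 - δ) * (t ^ (-α) * t ^ β)) - 1 / β * (t ^ (-1 - δ) * t ^ (-α)) +
        1 / a * (t ^ (-1 - δ) * (t ^ α * t ^ (-a))) - t ^ (-1 - δ) * (t ^ α * t ^ (-a - 1)) := by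
      rw [p1, p2]
    _ = _ := by ring

/-- A bound for the composition operator on the reproducing kernels is at least `2 / α`. -/
theorem two_div_le_of_kernel_bound
    (hK : IsMatrixOperator (hardyEntry α) (C.adjoint ∘L C)) (hα : 0 < α) {c : ℝ}
    (hc : ∀ w : halfPlane, ‖C (DirichletH2.kernel w)‖ ^ 2 ≤ c * ‖DirichletH2.kernel w‖ ^ 2) :
    2 / α ≤ c := by
  obtain ⟨D, hD⟩ := le_norm_composition_kernel_sq hK hα
  -- If `c < 2 / α`, the lower bound would keep the kernel norms bounded near `1/2`, where they blow
  -- up.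
  by_contra! h
  obtain ⟨ε, hε, h1⟩ := exists_lt_norm_kernel_sq (D / (2 / α - c))
  set σ := 1 / 2 + min ε (α / 2) / 2 with hσ
  have hm : 0 < min ε (α / 2) := lt_min hε (by linarith)
  have hσ0 : 1 / 2 < σ := by linarith
  have h2 := h1 σ hσ0 (by linarith [min_le_left ε (α / 2)])
  have h3 := hD σ hσ0 (by linarith [min_le_right ε (α / 2)])
  have h4 := hc (realPoint σ hσ0)
  rw [div_lt_iff₀ (by linarith)] at h2
  linarith

end KernelLowerBound

/-! ### Trapezoidal and midpoint rules for powers -/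

section Quadrature

/-- The error of the trapezoidal rule for `x ^ e` on `[1, 1 + x]`. -/
noncomputable def trapezoidError (e x : ℝ) : ℝ :=
  x * (1 + (1 + x) ^ e) / 2 - ((1 + x) ^ (e + 1) - 1) / (e + 1)

theorem hasDerivAt_one_add_rpow (p : ℝ) {x : ℝ} (hx : 0 < 1 + x) :
    HasDerivAt (fun x : ℝ => (1 + x) ^ p) (p * (1 + x) ^ (p - 1)) x := by
  have := ((hasDerivAt_id x).const_add 1).rpow_const (p := p) (Or.inl hx.ne')
  simpa using this

/-- The derivative is arranged so that its sign is read off from Bernoulli's inequality with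
exponent `1 - e`. -/
theorem hasDerivAt_trapezoidError {e x : ℝ} (he : e + 1 ≠ 0) (hx : 0 < 1 + x) :
    HasDerivAt (trapezoidError e)
      (1 / 2 * (1 + x) ^ (e - 1) * ((1 + x) ^ (1 - e) - (1 + (1 - e) * x))) x := by
  have h1 := hasDerivAt_one_add_rpow e hx
  have h2 := hasDerivAt_one_add_rpow (e + 1) hx
  have h3 := (((hasDerivAt_id x).mul (h1.const_add 1)).div_const 2).sub
    ((h2.sub_const 1).div_const (e + 1))
  refine h3.congr_deriv ?_
  have p1 : (1 + x) ^ (e - 1) * (1 + x) ^ (1 - e) = 1 := by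
    rw [← Real.rpow_add hx]
    simp
  have p2 : (1 + x) ^ e = (1 + x) ^ (e - 1) * (1 + x) := by
    rw [Real.rpow_sub_one hx.ne']
    field_simp
  rw [add_sub_cancel_right, mul_div_cancel_left₀ _ he, p2]
  simp only [id]
  linear_combination (-1 / 2) * p1

theorem continuousOn_trapezoidError {e : ℝ} (he : e + 1 ≠ 0) :
    ContinuousOn (trapezoidError e) (Set.Ici 0) := fun x hx =>
  (hasDerivAt_trapezoidError he (by have : (0 : ℝ) ≤ x := hx; linarith)).continuousAt.continuousWithinAt

theorem trapezoidError_zero (e : ℝ) : trapezoidError e 0 = 0 := by simp [trapezoidError]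

theorem trapezoidError_pos {e x : ℝ} (he : e < 0) (he1 : e + 1 ≠ 0) (hx : 0 < x) :
    0 < trapezoidError e x := by
  have h : StrictMonoOn (trapezoidError e) (Set.Ici 0) := by
    refine strictMonoOn_of_deriv_pos (convex_Ici 0) (continuousOn_trapezoidError he1) ?_
    intro y hy
    rw [interior_Ici] at hy
    have hy : (0 : ℝ) < y := hy
    rw [(hasDerivAt_trapezoidError he1 (by linarith)).deriv]
    have := one_add_mul_self_lt_rpow_one_add (s := y) (by linarith) hy.ne'
      (show 1 < 1 - e by linarith)
    have : 0 < (1 + y) ^ (1 - e) - (1 + (1 - e) * y) := by linarith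
    positivity
  have := h (Set.self_mem_Ici) (Set.mem_Ici.2 hx.le) hx
  rwa [trapezoidError_zero] at this

theorem trapezoidError_nonpos {e x : ℝ} (he : 0 ≤ e) (he1 : e ≤ 1) (hx : 0 ≤ x) :
    trapezoidError e x ≤ 0 := by
  have hne : e + 1 ≠ 0 := by linarith
  have h : AntitoneOn (trapezoidError e) (Set.Ici 0) := by
    refine antitoneOn_of_deriv_nonpos (convex_Ici 0) (continuousOn_trapezoidError hne) ?_ ?_
    · intro y hy
      rw [interior_Ici] at hy
      have hy : (0 : ℝ) < y := hy
      exact (hasDerivAt_trapezoidError hne (by linarith)).differentiableAt.differentiableWithinAt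
    · intro y hy
      rw [interior_Ici] at hy
      have hy : (0 : ℝ) < y := hy
      rw [(hasDerivAt_trapezoidError hne (by linarith)).deriv]
      have := rpow_one_add_le_one_add_mul_self (s := y) (by linarith)
        (show 0 ≤ 1 - e by linarith) (by linarith)
      exact mul_nonpos_of_nonneg_of_nonpos (by positivity) (by linarith)
  have := h (Set.self_mem_Ici) (Set.mem_Ici.2 hx) hx
  rwa [trapezoidError_zero] at this

theorem trapezoidError_scale {e m : ℝ} (hm : 0 < m) :
    m ^ (e + 1) * trapezoidError e (1 / m) =
      (m ^ e + (m + 1) ^ e) / 2 - ((m + 1) ^ (e + 1) - m ^ (e + 1)) / (e + 1) := by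
  have h1 : 1 + 1 / m = (m + 1) / m := by field_simp
  rw [trapezoidError, h1, Real.div_rpow (by linarith) hm.le, Real.div_rpow (by linarith) hm.le]
  have h2 : m ^ (e + 1) = m ^ e * m := Real.rpow_add_one hm.ne' e
  have h3 : 0 < m ^ e := by positivity
  rw [h2]
  field_simp

/-- The midpoint rule underestimates the integral of `x ^ (-a-1)`. -/
theorem mul_rpow_le_midpoint {a m : ℝ} (ha : 0 < a) (hm : 1 ≤ m) :
    a * m ^ (-a - 1) ≤ (m - 1 / 2) ^ (-a) - (m + 1 / 2) ^ (-a) := by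
  have hd : ∀ x ∈ Set.Ico (0 : ℝ) 1, HasDerivAt
      (fun x : ℝ => (1 + -x) ^ (-a) - (1 + x) ^ (-a) - 2 * a * x)
      (a * ((1 + -x) ^ (-a - 1) + (1 + x) ^ (-a - 1) - 2)) x := by
    intro x hx
    have h1 := (hasDerivAt_one_add_rpow (-a) (show 0 < 1 + -x by linarith [hx.2])).comp x
      (hasDerivAt_neg x)
    have h2 := hasDerivAt_one_add_rpow (-a) (show 0 < 1 + x by linarith [hx.1])
    have h3 := (h1.sub h2).sub ((hasDerivAt_id x).const_mul (2 * a))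
    refine h3.congr_deriv ?_
    ring
  have h : MonotoneOn (fun x : ℝ => (1 + -x) ^ (-a) - (1 + x) ^ (-a) - 2 * a * x)
      (Set.Ico 0 1) := by
    refine monotoneOn_of_deriv_nonneg (convex_Ico 0 1)
      (fun x hx => (hd x hx).continuousAt.continuousWithinAt)
      (fun x hx => (hd x (interior_subset hx)).differentiableAt.differentiableWithinAt) ?_
    intro x hx
    have hx := interior_subset hx
    rw [(hd x hx).deriv]
    have h1 := one_add_mul_le_rpow_of_nonpos (p := -a - 1) (by linarith)
      (show -1 < -x by linarith [hx.2])
    have h2 := one_add_mul_le_rpow_of_nonpos (p := -a - 1) (by linarith)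
      (show -1 < x by linarith [hx.1])
    exact mul_nonneg ha.le (by linarith)
  have hm0 : 0 < m := by linarith
  have hx : 1 / (2 * m) ∈ Set.Ico (0 : ℝ) 1 := by
    refine ⟨by positivity, ?_⟩
    rw [div_lt_one (by positivity)]
    linarith
  have h4 := h (Set.left_mem_Ico.2 one_pos) hx hx.1
  simp only [neg_zero, add_zero, Real.one_rpow, sub_self, mul_zero] at h4
  have e1 : 1 + -(1 / (2 * m)) = (m - 1 / 2) / m := by field_simp; ring
  have e2 : 1 + 1 / (2 * m) = (m + 1 / 2) / m := by field_simp
  rw [e1, e2, Real.div_rpow (by linarith) hm0.le, Real.div_rpow (by linarith) hm0.le,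
    ← sub_div] at h4
  have h5 : 0 < m ^ (-a) := by positivity
  have h6 := (le_div_iff₀ h5).1 (sub_nonneg.1 h4)
  rw [Real.rpow_sub_one hm0.ne']
  refine le_trans (le_of_eq ?_) h6
  field_simp

/-- Telescoping the midpoint inequality. The endpoint `t + 1/2` captures the second term of the
asymptotics, which `not_forall_power_eigen` needs. -/
theorem tsum_nat_add_rpow_le_midpoint {a t : ℝ} (ha : 0 < a) (ht : 0 ≤ t) :
    ∑' k : ℕ, ((k : ℝ) + (t + 1)) ^ (-a - 1) ≤ (t + 1 / 2) ^ (-a) / a := by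
  have h1 := (hasSum_nat_add_rpow_sub ha (show 0 < t + 1 / 2 by linarith)).div_const a
  refine hasSum_le (fun k => ?_) (summable_nat_add_rpow ha (by linarith)).hasSum h1
  have hk : (0 : ℝ) ≤ k := k.cast_nonneg
  have := mul_rpow_le_midpoint ha (show 1 ≤ (k : ℝ) + (t + 1) by linarith)
  rw [le_div_iff₀ ha]
  ring_nf at this ⊢
  exact this

theorem exists_abs_one_add_rpow_sub_one_le (p : ℝ) :
    ∃ L : ℝ, 0 ≤ L ∧ ∀ x : ℝ, 0 ≤ x → x ≤ 1 → |(1 + x) ^ p - 1| ≤ L * x := by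
  refine ⟨|p| * 2 ^ |p - 1|, by positivity, fun x hx hx1 => ?_⟩
  have := Convex.norm_image_sub_le_of_norm_hasDerivWithin_le (𝕜 := ℝ)
    (f := fun x : ℝ => (1 + x) ^ p) (f' := fun x => p * (1 + x) ^ (p - 1))
    (C := |p| * 2 ^ |p - 1|) (s := Set.Icc 0 1)
    (fun y hy => (hasDerivAt_one_add_rpow p (by linarith [hy.1])).hasDerivWithinAt)
    (fun y hy => by
      rw [norm_mul, Real.norm_eq_abs, Real.norm_of_nonneg (by have := hy.1; positivity)]
      gcongr
      calc (1 + y) ^ (p - 1) ≤ (1 + y) ^ |p - 1| :=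
            Real.rpow_le_rpow_of_exponent_le (by linarith [hy.1]) (le_abs_self _)
        _ ≤ 2 ^ |p - 1| := by
            have := hy.1
            gcongr
            linarith [hy.2])
    (convex_Icc 0 1) (Set.left_mem_Icc.2 zero_le_one) ⟨hx, hx1⟩
  simpa [abs_of_nonneg hx] using this

/-- Second order Taylor bound for `(1 + x) ^ p` on `[0, 1]`. -/
theorem exists_abs_one_add_rpow_sub_le (p : ℝ) :
    ∃ L : ℝ, 0 ≤ L ∧ ∀ x : ℝ, 0 ≤ x → x ≤ 1 → |(1 + x) ^ p - 1 - p * x| ≤ L * x ^ 2 := by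
  obtain ⟨L, hL, h⟩ := exists_abs_one_add_rpow_sub_one_le (p - 1)
  refine ⟨|p| * L, by positivity, fun x hx hx1 => ?_⟩
  have := Convex.norm_image_sub_le_of_norm_hasDerivWithin_le (𝕜 := ℝ)
    (f := fun x : ℝ => (1 + x) ^ p - p * x) (f' := fun x => p * (1 + x) ^ (p - 1) - p)
    (C := |p| * L * x) (s := Set.Icc 0 x)
    (fun y hy => by
      have := (hasDerivAt_one_add_rpow p (x := y) (by linarith [hy.1])).sub
        ((hasDerivAt_id y).const_mul p)
      rw [mul_one] at this
      exact this.hasDerivWithinAt)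
    (fun y hy => by
      have e : p * (1 + y) ^ (p - 1) - p = p * ((1 + y) ^ (p - 1) - 1) := by ring
      rw [e, norm_mul, Real.norm_eq_abs, Real.norm_eq_abs, mul_assoc]
      gcongr
      refine (h y hy.1 (hy.2.trans hx1)).trans ?_
      gcongr
      exact hy.2)
    (convex_Icc 0 x) (Set.left_mem_Icc.2 hx) (Set.right_mem_Icc.2 hx)
  simp only [add_zero, Real.one_rpow, mul_zero, sub_zero, Real.norm_eq_abs, abs_of_nonneg hx] at this
  refine le_trans (le_of_eq ?_) (this.trans (le_of_eq ?_))
  · congr 1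
    ring
  · ring

end Quadrature

/-! ### Power sequences are not eigenvectors -/

section PowerSequences

theorem tendsto_add_one_div_rpow (p c : ℝ) :
    Tendsto (fun N : ℕ => (((N : ℝ) + 1 + c) / ((N : ℝ) + 1)) ^ p) atTop (𝓝 1) := by
  have h1 : Tendsto (fun N : ℕ => 1 + c * (1 / ((N : ℝ) + 1))) atTop (𝓝 (1 + c * 0)) :=
    (tendsto_one_div_add_atTop_nhds_zero_nat.const_mul c).const_add 1
  have h2 := h1.rpow_const (p := p) (Or.inl (by simp))
  simp only [mul_zero, add_zero, Real.one_rpow] at h2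
  refine h2.congr fun N => ?_
  congr 1
  field_simp

theorem tendsto_rpow_mul_tsum {a : ℝ} (ha : 0 < a) :
    Tendsto (fun N : ℕ => ((N : ℝ) + 1) ^ a * ∑' k : ℕ, ((k : ℝ) + (N + 1 + 1)) ^ (-a - 1)) atTop
      (𝓝 (1 / a)) := by
  have l1 := (tendsto_add_one_div_rpow (-a) 1).div_const a
  have l2 := (tendsto_add_one_div_rpow (-a) (1 / 2)).div_const a
  have e : ∀ (N : ℕ) (c : ℝ), 0 ≤ c → (((N : ℝ) + 1 + c) / ((N : ℝ) + 1)) ^ (-a) / a =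
      ((N : ℝ) + 1) ^ a * (((N : ℝ) + 1 + c) ^ (-a) / a) := by
    intro N c hc
    rw [Real.div_rpow (by positivity) (by positivity), Real.rpow_neg (x := (N : ℝ) + 1)
      (by positivity), div_inv_eq_mul]
    ring
  refine tendsto_of_tendsto_of_tendsto_of_le_of_le l1 l2 (fun N => ?_) (fun N => ?_)
  · simp only
    rw [e N 1 zero_le_one]
    gcongr
    exact le_tsum_nat_add_rpow ha (by positivity)
  · simp only
    rw [e N _ (by norm_num)]
    gcongr
    exact tsum_nat_add_rpow_le_midpoint ha (by positivity)

theorem tendsto_rpow_mul_sum {β : ℝ} (hβ : 0 < β) :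
    Tendsto (fun N : ℕ => ((N : ℝ) + 1) ^ (-β) * ∑ k ∈ range (N + 1), ((k : ℝ) + 1) ^ (β - 1))
      atTop (𝓝 (1 / β)) := by
  have l1 : Tendsto (fun N : ℕ => (1 - ((N : ℝ) + 1) ^ (-β)) / β) atTop (𝓝 ((1 - 0) / β)) :=
    ((tendsto_nat_add_rpow_neg hβ).const_sub 1).div_const β
  have l2 := (tendsto_add_one_div_rpow β 1).div_const β
  rw [sub_zero] at l1
  refine tendsto_of_tendsto_of_tendsto_of_le_of_le l1 l2 (fun N => ?_) (fun N => ?_)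
  · have h := mul_le_mul_of_nonneg_left (le_headSum_rpow hβ N)
      (show 0 ≤ ((N : ℝ) + 1) ^ (-β) by positivity)
    refine le_trans (le_of_eq ?_) h
    have : ((N : ℝ) + 1) ^ (-β) * ((N : ℝ) + 1) ^ β = 1 := by
      rw [← Real.rpow_add (by positivity)]
      simp
    simp only
    rw [← mul_div_assoc, mul_sub, this, mul_one]
  · have h := mul_le_mul_of_nonneg_left (sum_range_add_one_rpow_le hβ (N + 1))
      (show 0 ≤ ((N : ℝ) + 1) ^ (-β) by positivity)
    refine h.trans (le_of_eq ?_)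
    rw [Real.div_rpow (by positivity) (by positivity), Real.rpow_neg (by positivity)]
    push_cast
    field_simp

/-- Upper bound from the trapezoidal rule for the concave function `x ^ (β - 1)`. -/
theorem sum_rpow_le_trapezoid {β : ℝ} (h1 : 1 ≤ β) (h2 : β ≤ 2) (N : ℕ) :
    ∑ k ∈ range (N + 1), ((k : ℝ) + 1) ^ (β - 1) ≤
      ((N : ℝ) + 1) ^ β / β + ((N : ℝ) + 1) ^ (β - 1) / 2 - (1 / β - 1 / 2) := by
  induction N with
  | zero => simp; linarith
  | succ N ih =>
    rw [Finset.sum_range_succ]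
    have h3 := trapezoidError_scale (e := β - 1) (m := (N : ℝ) + 1) (by positivity)
    have h4 := trapezoidError_nonpos (e := β - 1) (by linarith) (by linarith)
      (show 0 ≤ 1 / ((N : ℝ) + 1) by positivity)
    have h5 : ((N : ℝ) + 1) ^ (β - 1 + 1) * trapezoidError (β - 1) (1 / ((N : ℝ) + 1)) ≤ 0 :=
      mul_nonpos_of_nonneg_of_nonpos (by positivity) h4
    rw [h3, sub_add_cancel, sub_div] at h5
    push_cast
    linarith

/-- The strict trapezoidal bound for the convex function `x ^ (-a - 1)` on `[1, ∞)`. -/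
theorem lt_one_add_tsum_rpow {a : ℝ} (ha : 0 < a) :
    1 / a + 1 / 2 < 1 + ∑' k : ℕ, ((k : ℝ) + 2) ^ (-a - 1) := by
  have hs1 := summable_nat_add_rpow ha zero_le_one
  have hs2 := summable_nat_add_rpow ha zero_le_two
  have hs3 := (hasSum_nat_add_rpow_sub ha one_pos).div_const a
  have h : 1 ^ (-a) / a < ∑' k : ℕ, (((k : ℝ) + 1) ^ (-a - 1) + ((k : ℝ) + 2) ^ (-a - 1)) / 2 := by
    have hlt : ∀ k : ℕ, (((k : ℝ) + 1) ^ (-a) - ((k : ℝ) + 1 + 1) ^ (-a)) / a <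
        (((k : ℝ) + 1) ^ (-a - 1) + ((k : ℝ) + 2) ^ (-a - 1)) / 2 := by
      intro k
      have h3 := trapezoidError_scale (e := -a - 1) (m := (k : ℝ) + 1) (by positivity)
      have h4 := trapezoidError_pos (e := -a - 1) (by linarith) (by linarith)
        (show 0 < 1 / ((k : ℝ) + 1) by positivity)
      have h5 : 0 < ((k : ℝ) + 1) ^ (-a - 1 + 1) * trapezoidError (-a - 1) (1 / ((k : ℝ) + 1)) := by
        positivity
      rw [h3, sub_add_cancel, div_neg, ← neg_div, neg_sub] at h5
      have e : (k : ℝ) + 1 + 1 = k + 2 := by ring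
      rw [e] at h5 ⊢
      linarith
    exact hasSum_lt (fun k => (hlt k).le) (hlt 0) hs3 ((hs1.add hs2).div_const 2).hasSum
  have e1 : ∑' k : ℕ, ((k : ℝ) + 1) ^ (-a - 1) = 1 + ∑' k : ℕ, ((k : ℝ) + 2) ^ (-a - 1) := by
    rw [hs1.tsum_eq_zero_add]
    congr 1
    · simp
    · refine tsum_congr fun k => ?_
      push_cast
      ring_nf
  rw [tsum_div_const, hs1.tsum_add hs2, e1, Real.one_rpow] at h
  linarith

/-- The sequence `n ^ (-σ)` does not satisfy the eigenvalue equation of the matrix. -/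
theorem not_forall_power_eigen {a β μ : ℝ} (ha : 0 < a)
    (h : ∀ N : ℕ, ∑ k ∈ range (N + 1), ((k : ℝ) + 1) ^ (β - 1) +
      ((N : ℝ) + 1) ^ (a + β) * ∑' k : ℕ, ((k : ℝ) + (N + 1 + 1)) ^ (-a - 1)
        = μ * ((N : ℝ) + 1) ^ β) : False := by
  have h' : ∀ N : ℕ, ((N : ℝ) + 1) ^ (-β) * ∑ k ∈ range (N + 1), ((k : ℝ) + 1) ^ (β - 1) +
      ((N : ℝ) + 1) ^ a * ∑' k : ℕ, ((k : ℝ) + (N + 1 + 1)) ^ (-a - 1) = μ := by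
    intro N
    have ht : (0 : ℝ) < (N : ℝ) + 1 := by positivity
    have e1 : ((N : ℝ) + 1) ^ (-β) * ((N : ℝ) + 1) ^ (a + β) = ((N : ℝ) + 1) ^ a := by
      rw [← Real.rpow_add ht]
      ring_nf
    have e2 : ((N : ℝ) + 1) ^ (-β) * ((N : ℝ) + 1) ^ β = 1 := by
      rw [← Real.rpow_add ht]
      simp
    rw [← e1, mul_assoc, ← mul_add, h N, mul_left_comm, e2, mul_one]
  have hlim : Tendsto (fun N : ℕ =>
      ((N : ℝ) + 1) ^ (-β) * ∑ k ∈ range (N + 1), ((k : ℝ) + 1) ^ (β - 1)) atTop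
      (𝓝 (μ - 1 / a)) :=
    ((tendsto_rpow_mul_tsum ha).const_sub μ).congr fun N => by rw [← h' N]; ring
  -- For `β ≤ 0` the normalized head dominates the harmonic sum and diverges. For `β > 0` the limit
  -- forces `μ = 1 / a + 1 / β`, and the first row is then tested against this value.
  rcases le_or_gt β 0 with hβ | hβ
  · refine not_tendsto_nhds_of_tendsto_atTop (tendsto_atTop_mono (fun N => ?_)
      (Real.tendsto_sum_range_one_div_nat_succ_atTop.comp (tendsto_add_atTop_nat 1))) _ hlim
    simp only [Function.comp]
    rw [Finset.mul_sum]
    refine Finset.sum_le_sum fun k hk => ?_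
    have hk0 : (0 : ℝ) < (k : ℝ) + 1 := by positivity
    have hkN : (k : ℝ) + 1 ≤ (N : ℝ) + 1 := by
      have : k ≤ N := by have := Finset.mem_range.1 hk; omega
      have : (k : ℝ) ≤ N := by exact_mod_cast this
      linarith
    calc 1 / ((k : ℝ) + 1) = ((k : ℝ) + 1) ^ (-β) * ((k : ℝ) + 1) ^ (β - 1) := by
          rw [← Real.rpow_add hk0, one_div, ← Real.rpow_neg_one]
          ring_nf
      _ ≤ _ := by
          gcongr
          linarith
  have hμ : μ = 1 / a + 1 / β := by
    have := tendsto_nhds_unique hlim (tendsto_rpow_mul_sum hβ)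
    linarith
  have h0 := h 0
  norm_num at h0
  -- The first row reads `1 + tail = 1 / a + 1 / β`. For `β < 1` the left side is too small; for `β
  -- ≥ 2` it is too large, by the strict trapezoidal bound.
  rcases lt_or_ge β 1 with hβ1 | hβ1
  · have h1 := tsum_nat_add_rpow_le_midpoint ha zero_le_one
    have h2 : (1 + 1 / 2 : ℝ) ^ (-a) / a ≤ 1 / a := by
      gcongr
      exact Real.rpow_le_one_of_one_le_of_nonpos (by norm_num) (by linarith)
    have h3 : 1 < 1 / β := by
      rw [lt_div_iff₀ hβ]
      linarith
    norm_num at h1 h2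
    have h4 : (1 : ℝ) / β = β⁻¹ := one_div β
    have h5 : (1 : ℝ) / a = a⁻¹ := one_div a
    linarith
  rcases le_or_gt 2 β with hβ2 | hβ2
  · have h1 := lt_one_add_tsum_rpow ha
    have h2 : 1 / β ≤ 1 / 2 := by gcongr
    linarith
  obtain ⟨L, hL, hT⟩ := exists_abs_one_add_rpow_sub_le (-a)
  have hc : 0 < 1 / β - 1 / 2 := by
    rw [sub_pos]
    gcongr
  -- For `1 ≤ β < 2` the first row does not decide. In row `N + 1` the terms of order `t ^ β`
  -- cancel, and so do the corrections `± t ^ (β - 1) / 2` of the trapezoidal and midpoint bounds; a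
  -- positive constant is left below a quantity that tends to `0`.
  have hbound : ∀ N : ℕ, 1 / β - 1 / 2 ≤ L / (4 * a) * ((N : ℝ) + 1) ^ (-(2 - β)) := by
    intro N
    have hN := h N
    have h1 := sum_rpow_le_trapezoid hβ1 hβ2.le N
    have h2 := tsum_nat_add_rpow_le_midpoint ha (show (0 : ℝ) ≤ (N : ℝ) + 1 by positivity)
    set t := (N : ℝ) + 1 with ht
    have ht1 : 1 ≤ t := by
      have : (0 : ℝ) ≤ N := N.cast_nonneg
      linarith
    have ht0 : 0 < t := by linarith
    have h3 := (abs_le.1 (hT (1 / (2 * t)) (by positivity) (by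
      rw [div_le_one (by positivity)]
      linarith))).2
    have e1 : 1 + 1 / (2 * t) = (t + 1 / 2) / t := by field_simp
    rw [e1, Real.div_rpow (by positivity) ht0.le, Real.rpow_neg ht0.le, div_inv_eq_mul] at h3
    have h4 : t ^ (a + β) * ∑' k : ℕ, ((k : ℝ) + (t + 1)) ^ (-a - 1) ≤
        t ^ β / a * (1 - a * (1 / (2 * t)) + L * (1 / (2 * t)) ^ 2) := by
      calc _ ≤ t ^ (a + β) * ((t + 1 / 2) ^ (-a) / a) := by gcongr
        _ = t ^ β / a * ((t + 1 / 2) ^ (-a) * t ^ a) := by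
            rw [Real.rpow_add ht0]
            ring
        _ ≤ _ := by
            gcongr
            linarith
    have e2 : t ^ (β - 1) = t ^ β / t := Real.rpow_sub_one ht0.ne' β
    have e3 : t ^ (-(2 - β)) = t ^ β / t ^ 2 := by
      rw [neg_sub, Real.rpow_sub ht0]
      norm_num
    rw [e2] at h1
    rw [e3]
    have e4 : t ^ β / a * (1 - a * (1 / (2 * t)) + L * (1 / (2 * t)) ^ 2)
        = t ^ β / a - t ^ β / t / 2 + L / (4 * a) * (t ^ β / t ^ 2) := by
      field_simp
      ring
    rw [e4] at h4
    rw [hμ] at hN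
    have e5 : (1 / a + 1 / β) * t ^ β = t ^ β / a + t ^ β / β := by ring
    linarith
  have hl := (tendsto_nat_add_rpow_neg (c := 1) (show 0 < 2 - β by linarith)).const_mul (L / (4 * a))
  rw [mul_zero] at hl
  have := ge_of_tendsto' hl hbound
  linarith

end PowerSequences

/-! ### Compactness above the essential norm -/

section Compactness

variable {α : ℝ} {hα : 0 < α} {C : DirichletH2 →L[ℂ] DirichletH2}

/-- The projection onto the coordinates in a finite set. -/
noncomputable def coordProj (S : Finset ℕ+) : DirichletH2 →L[ℂ] DirichletH2 :=
  ∑ i ∈ S, (lp.singleContinuousLinearMap ℂ (fun _ : ℕ+ => ℂ) 2 i) ∘L (lp.evalCLM ℂ (fun _ => ℂ) 2 i)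

theorem coordProj_apply (S : Finset ℕ+) (x : DirichletH2) (n : ℕ+) :
    coordProj S x n = if n ∈ S then x n else 0 := by
  classical
  simp only [coordProj, _root_.sum_apply, lp.coeFn_sum, Finset.sum_apply]
  split_ifs with h
  · rw [Finset.sum_eq_single_of_mem n h]
    · simp
      rfl
    · intro i _ hi
      simp [Pi.single_eq_of_ne hi.symm]
  · refine Finset.sum_eq_zero fun i hi => ?_
    have : n ≠ i := fun e => h (e ▸ hi)
    simp [Pi.single_eq_of_ne this]

theorem exists_tail_bound (hC : ∀ x, HasSum (fun i => x i • symbolPow hα.le i) (C x)) {l : ℝ}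
    (hl : 2 / α < l) : ∃ c < l, ∃ S : Finset ℕ+, ∀ x,
      ‖C (x - coordProj S x)‖ ^ 2 ≤ c * ‖x - coordProj S x‖ ^ 2 := by
  have h1 : Tendsto (fun N : ℕ => ((1 + 1 / ((N : ℝ) + 1)) ^ α + 1) / α) atTop
      (𝓝 (((1 + 0) ^ α + 1) / α)) :=
    (((tendsto_one_div_add_atTop_nhds_zero_nat.const_add 1).rpow_const
      (Or.inr hα.le)).add_const 1).div_const α
  have h2 : ((1 + 0) ^ α + 1) / α < l := by
    norm_num
    exact hl
  obtain ⟨N, hN⟩ := (h1.eventually (gt_mem_nhds h2)).exists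
  refine ⟨_, hN, Finset.Iio N.succPNat, fun x => ?_⟩
  refine norm_sq_le_of_row_bound (hα := hα) hC (P := fun i => N.succPNat ≤ i) (fun i hi S => ?_) ?_
  · have := sum_hardyEntry_mul_le_of_ge hα hi S
    rwa [cast_succPNat] at this
  · intro i hi
    rw [lp.coeFn_sub, Pi.sub_apply, coordProj_apply, if_pos (by simpa using hi), sub_self]

/-- Expand the square and use `‖C* C x‖ ≤ ‖C‖ ‖C x‖`. Thus near-maximizers of `‖C x‖` are
approximate eigenvectors of `C* C`. -/
theorem norm_gram_sub_sq_le {E : Type*} [NormedAddCommGroup E] [InnerProductSpace ℂ E]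
    [CompleteSpace E] (C : E →L[ℂ] E) {x : E} (hx : ‖x‖ = 1) :
    ‖(C.adjoint ∘L C) x - ((‖C‖ ^ 2 : ℝ) : ℂ) • x‖ ^ 2 ≤ ‖C‖ ^ 2 * (‖C‖ ^ 2 - ‖C x‖ ^ 2) := by
  rw [norm_sub_sq (𝕜 := ℂ), inner_smul_right, ContinuousLinearMap.comp_apply,
    ContinuousLinearMap.adjoint_inner_left, inner_self_eq_norm_sq_to_K, norm_smul, hx,
    Complex.norm_real, norm_pow, norm_norm]
  have h1 : ‖C.adjoint (C x)‖ ≤ ‖C‖ * ‖C x‖ := by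
    have := C.adjoint.le_opNorm (C x)
    rwa [LinearIsometryEquiv.norm_map] at this
  have h2 : ‖C.adjoint (C x)‖ ^ 2 ≤ (‖C‖ * ‖C x‖) ^ 2 := by gcongr
  have h3 : RCLike.re (((‖C‖ ^ 2 : ℝ) : ℂ) * ((‖C x‖ : ℝ) : ℂ) ^ 2) = ‖C‖ ^ 2 * ‖C x‖ ^ 2 := by
    rw [← Complex.ofReal_pow, ← Complex.ofReal_mul]
    exact Complex.ofReal_re _
  have h4 : RCLike.re (((‖C‖ ^ 2 : ℝ) : ℂ) * (RCLike.ofReal ‖C x‖ : ℂ) ^ 2)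
      = ‖C‖ ^ 2 * ‖C x‖ ^ 2 := h3
  rw [h4]
  nlinarith

theorem exists_subseq_coordProj (S : Finset ℕ+) {x : ℕ → DirichletH2} (hx : ∀ j, ‖x j‖ = 1) :
    ∃ p, ∃ φ : ℕ → ℕ, StrictMono φ ∧ Tendsto (fun j => coordProj S (x (φ j))) atTop (𝓝 p) := by
  let J : (S → ℂ) → DirichletH2 := fun v =>
    ∑ i : S, lp.singleContinuousLinearMap ℂ (fun _ : ℕ+ => ℂ) 2 i (v i)
  have hJ : Continuous J := by fun_prop
  obtain ⟨a, -, φ, hφ, h⟩ := tendsto_subseq_of_bounded (X := S → ℂ) (s := Metric.closedBall 0 1)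
    Metric.isBounded_closedBall (x := fun j i => x j i) fun j => by
      rw [mem_closedBall_zero_iff, pi_norm_le_iff_of_nonneg zero_le_one]
      intro i
      exact (lp.norm_apply_le_norm (by norm_num) (x j) i).trans (hx j).le
  refine ⟨J a, φ, hφ, ((hJ.tendsto a).comp h).congr fun j => ?_⟩
  simp only [Function.comp, J, coordProj, _root_.sum_apply, ContinuousLinearMap.comp_apply]
  exact Finset.sum_coe_sort S (fun i =>
    lp.singleContinuousLinearMap ℂ (fun _ : ℕ+ => ℂ) 2 i (x (φ j) i))

/-- Above the essential norm, a maximizing sequence has a convergent subsequence, and the limit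
is an eigenvector. -/
theorem exists_subseq_tendsto_eigenvector
    (hC : ∀ x, HasSum (fun i => x i • symbolPow hα.le i) (C x)) (hl : 2 / α < ‖C‖ ^ 2)
    {x : ℕ → DirichletH2} (hx : ∀ j, ‖x j‖ = 1)
    (hlim : Tendsto (fun j => ‖C (x j)‖) atTop (𝓝 ‖C‖)) :
    ∃ φ : ℕ → ℕ, StrictMono φ ∧ ∃ y, Tendsto (x ∘ φ) atTop (𝓝 y) ∧ ‖y‖ = 1 ∧
      (C.adjoint ∘L C) y = ((‖C‖ ^ 2 : ℝ) : ℂ) • y := by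
  obtain ⟨c, hc, S, hS⟩ := exists_tail_bound (hα := hα) hC hl
  set l : ℝ := ‖C‖ ^ 2 with hldef
  set A : DirichletH2 →L[ℂ] DirichletH2 := C.adjoint ∘L C - (l : ℂ) • ContinuousLinearMap.id ℂ _
    with hA
  have hAx : ∀ x, A x = (C.adjoint ∘L C) x - (l : ℂ) • x := fun x => rfl
  have hA0 : Tendsto (fun j => A (x j)) atTop (𝓝 0) := by
    have h1 : Tendsto (fun j => √(l * (l - ‖C (x j)‖ ^ 2))) atTop (𝓝 √(l * (l - l))) :=
      (((hlim.pow 2).const_sub l).const_mul l).sqrt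
    rw [sub_self, mul_zero, Real.sqrt_zero] at h1
    refine squeeze_zero_norm (fun j => ?_) h1
    rw [hAx]
    exact Real.le_sqrt_of_sq_le (norm_gram_sub_sq_le C (hx j))
  obtain ⟨p, φ, hφ, hp⟩ := exists_subseq_coordProj S hx
  -- The pair of `A` and a finite-rank projection is bounded below, because `A` is negative definite
  -- off the coordinates in `S`. So `T` is a closed embedding, and convergence of `T (x (φ j))`
  -- gives convergence of `x (φ j)`.
  set T : DirichletH2 →L[ℂ] DirichletH2 × DirichletH2 := A.prod (coordProj S) with hT
  have hlc : 0 < l - c := sub_pos.2 hc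
  have hanti : ∀ u, ‖u‖ ≤ (⟨1 + (1 + ‖A‖) / (l - c), by positivity⟩ : NNReal) * ‖T u‖ := by
    intro u
    set q := u - coordProj S u with hq
    have h1 : (l - c) * ‖q‖ ^ 2 ≤ ‖q‖ * ‖A q‖ := by
      have h2 : RCLike.re ⟪q, A q⟫_ℂ = ‖C q‖ ^ 2 - l * ‖q‖ ^ 2 := by
        rw [hAx, inner_sub_right, inner_smul_right, ContinuousLinearMap.comp_apply,
          ContinuousLinearMap.adjoint_inner_right, inner_self_eq_norm_sq_to_K,
          inner_self_eq_norm_sq_to_K, map_sub]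
        congr 1
        · exact (by push_cast; rfl : ((‖C q‖ : ℂ) ^ 2) = ((‖C q‖ ^ 2 : ℝ) : ℂ)) ▸
            Complex.ofReal_re _
        · have : (l : ℂ) * ((‖q‖ : ℂ) ^ 2) = ((l * ‖q‖ ^ 2 : ℝ) : ℂ) := by push_cast; rfl
          exact this ▸ Complex.ofReal_re _
      have h3 := abs_le.1 ((RCLike.abs_re_le_norm ⟪q, A q⟫_ℂ).trans (norm_inner_le_norm q (A q)))
      have h4 := hS u
      nlinarith [h3.1]
    have h2 : (l - c) * ‖q‖ ≤ ‖A q‖ := by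
      rcases (norm_nonneg q).eq_or_lt with h | h
      · rw [← h, mul_zero]
        positivity
      · nlinarith
    have h3 : ‖A q‖ ≤ ‖T u‖ + ‖A‖ * ‖T u‖ := by
      rw [hq, map_sub]
      refine (norm_sub_le _ _).trans (add_le_add (norm_fst_le (T u)) ?_)
      exact (A.le_opNorm _).trans (mul_le_mul_of_nonneg_left (norm_snd_le (T u)) (norm_nonneg _))
    have h4 : ‖q‖ ≤ (1 + ‖A‖) / (l - c) * ‖T u‖ := by
      rw [div_mul_eq_mul_div, le_div_iff₀ hlc]
      linarith
    have h5 : ‖u‖ ≤ ‖coordProj S u‖ + ‖q‖ := by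
      have := norm_add_le (coordProj S u) q
      rwa [hq, add_sub_cancel] at this
    have h6 : ‖coordProj S u‖ ≤ ‖T u‖ := norm_snd_le (T u)
    change ‖u‖ ≤ (1 + (1 + ‖A‖) / (l - c)) * ‖T u‖
    linarith
  have hemb := (T.antilipschitz_of_bound hanti).isClosedEmbedding T.uniformContinuous
  have hTx : Tendsto (fun j => T (x (φ j))) atTop (𝓝 (0, p)) :=
    (hA0.comp hφ.tendsto_atTop).prodMk_nhds hp
  obtain ⟨y, hy⟩ := hemb.isClosed_range.mem_of_tendsto hTx
    (Eventually.of_forall fun j => ⟨_, rfl⟩)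
  have hxy : Tendsto (x ∘ φ) atTop (𝓝 y) := by
    rw [hemb.isInducing.tendsto_nhds_iff, hy]
    exact hTx
  refine ⟨φ, hφ, y, hxy, ?_, ?_⟩
  · refine tendsto_nhds_unique hxy.norm (tendsto_const_nhds.congr fun j => ?_)
    simp [hx]
  · have : A y = 0 := congrArg Prod.fst hy
    rwa [hAx, sub_eq_zero] at this

/-- If the norm exceeds the essential norm, it is attained at an eigenvector. -/
theorem exists_eigenvector_of_lt (hC : ∀ x, HasSum (fun i => x i • symbolPow hα.le i) (C x))
    (hl : 2 / α < ‖C‖ ^ 2) :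
    ∃ y, y ≠ 0 ∧ (C.adjoint ∘L C) y = ((‖C‖ ^ 2 : ℝ) : ℂ) • y := by
  have h : ∀ j : ℕ, ∃ x : DirichletH2, ‖x‖ = 1 ∧ ‖C‖ - 1 / ((j : ℝ) + 1) < ‖C x‖ := by
    intro j
    have hC0 : 0 < ‖C‖ := by
      refine (norm_nonneg C).lt_of_ne fun h => ?_
      rw [← h] at hl
      have := div_pos two_pos hα
      norm_num at hl
      linarith
    have hj : (0 : ℝ) < 1 / ((j : ℝ) + 1) := by positivity
    -- The maximum with `0` makes `C x ≠ 0`, so that `x` can be normalized.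
    obtain ⟨x, hx, hx2⟩ := C.exists_lt_apply_of_lt_opNorm
      (max_lt hC0 (show ‖C‖ - 1 / ((j : ℝ) + 1) < ‖C‖ by linarith))
    have hx0 : 0 < ‖x‖ := by
      refine norm_pos_iff.2 fun h => ?_
      rw [h, map_zero, norm_zero] at hx2
      exact absurd hx2 (not_lt.2 (le_max_left _ _))
    refine ⟨((‖x‖⁻¹ : ℝ) : ℂ) • x, ?_, ?_⟩
    · rw [norm_smul, Complex.norm_real, norm_inv, norm_norm, inv_mul_cancel₀ hx0.ne']
    · rw [map_smul, norm_smul, Complex.norm_real, norm_inv, norm_norm]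
      refine ((le_max_right _ _).trans_lt hx2).trans_le ?_
      exact le_mul_of_one_le_left (norm_nonneg _) ((one_le_inv₀ hx0).2 hx.le)
  choose x hx1 hx2 using h
  obtain ⟨φ, -, y, -, hy1, hy2⟩ := exists_subseq_tendsto_eigenvector (hα := hα) hC hl hx1 (by
    refine tendsto_of_tendsto_of_tendsto_of_le_of_le
      (by simpa using tendsto_one_div_add_atTop_nhds_zero_nat.const_sub ‖C‖)
      tendsto_const_nhds (fun j => (hx2 j).le) fun j => ?_
    simpa [hx1] using C.le_opNorm (x j))
  exact ⟨y, fun h => by simp [h] at hy1, hy2⟩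

end Compactness

/-! ### Failure of the thesis above the essential norm -/

section KernelThesis

variable {α : ℝ} {hα : 0 < α} {C : DirichletH2 →L[ℂ] DirichletH2}

theorem half_lt_re (w : halfPlane) : 1 / 2 < (w : ℂ).re := w.2

theorem norm_kernel_apply (w : halfPlane) (n : ℕ+) :
    ‖DirichletH2.kernel w n‖ = (n : ℝ) ^ (-(w : ℂ).re) := by
  have : DirichletH2.kernel w n = ((n : ℕ) : ℂ) ^ (-conj (w : ℂ)) := rfl
  rw [this, Complex.norm_natCast_cpow_of_pos n.pos]
  simp

theorem norm_kernel_eq_realPoint (w : halfPlane) :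
    ‖DirichletH2.kernel w‖ = ‖DirichletH2.kernel (realPoint (w : ℂ).re (half_lt_re w))‖ := by
  have h : ‖DirichletH2.kernel w‖ ^ 2 = ‖DirichletH2.kernel (realPoint (w : ℂ).re (half_lt_re w))‖ ^ 2 := by
    refine (lp_hasSum_norm_sq _).unique ((lp_hasSum_norm_sq _).congr_fun fun n => ?_)
    rw [norm_kernel_apply, norm_kernel_apply]
    simp [realPoint]
  exact (sq_eq_sq₀ (norm_nonneg _) (norm_nonneg _)).1 h

theorem norm_apply_le_of_isMatrixOperator {a : ℕ+ → ℕ+ → ℝ} (ha : ∀ n m, 0 ≤ a n m)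
    {K : DirichletH2 →L[ℂ] DirichletH2} (hK : IsMatrixOperator a K) {x x' : DirichletH2}
    (h : ∀ n, x' n = (‖x n‖ : ℂ)) (n : ℕ+) : ‖K x n‖ ≤ (K x' n).re := by
  have h' := Complex.hasSum_re (hK x' n)
  refine le_of_tendsto_of_tendsto (hK x n).norm h' (Eventually.of_forall fun S => ?_)
  refine (norm_sum_le _ _).trans (Finset.sum_le_sum fun m _ => ?_)
  rw [h m, norm_mul, Complex.norm_real, Real.norm_of_nonneg (ha n m), Complex.re_ofReal_mul,
    Complex.ofReal_re]

/-- Since the matrix has nonnegative entries, real points are extremal. -/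
theorem norm_composition_kernel_le (hK : IsMatrixOperator (hardyEntry α) (C.adjoint ∘L C))
    (w : halfPlane) :
    ‖C (DirichletH2.kernel w)‖ ≤ ‖C (DirichletH2.kernel (realPoint (w : ℂ).re (half_lt_re w)))‖ := by
  set x := DirichletH2.kernel w
  set x' := DirichletH2.kernel (realPoint (w : ℂ).re (half_lt_re w))
  have hx : ∀ n, x' n = (‖x n‖ : ℂ) := fun n => by
    rw [norm_kernel_apply, kernel_realPoint_apply]
  refine (sq_le_sq₀ (norm_nonneg _) (norm_nonneg _)).1 ?_
  refine hasSum_le (fun n => ?_) (hasSum_norm_composition_sq C x) (hasSum_norm_composition_sq C x')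
  have h1 := norm_apply_le_of_isMatrixOperator (fun n m => (hardyEntry_pos α n m).le) hK hx n
  refine (Complex.re_le_norm _).trans ?_
  rw [norm_mul, RCLike.norm_conj, hx n, Complex.conj_ofReal, mul_comm ((C.adjoint ∘L C) x' n),
    Complex.re_ofReal_mul, mul_comm]
  gcongr

/-- Neither a multiple of a reproducing kernel nor a multiple of the first basis vector is an
eigenvector of the matrix. -/
theorem not_eigenvector_multiplicative
    (hK : IsMatrixOperator (hardyEntry α) (C.adjoint ∘L C)) (hα : 0 < α) {y : DirichletH2}
    {ρ θ μ : ℝ} (hρ : 0 < ρ) (hθ : 0 ≤ θ)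
    (hy : ∀ n : ℕ+, y n = ((ρ * θ ^ (Real.log n / Real.log 2) : ℝ) : ℂ))
    (h : (C.adjoint ∘L C) y = (μ : ℂ) • y) : False := by
  have hrow : ∀ n : ℕ+, HasSum
      (fun m : ℕ+ => hardyEntry α n m * (ρ * θ ^ (Real.log m / Real.log 2)))
      (μ * (ρ * θ ^ (Real.log n / Real.log 2))) := by
    intro n
    have h1 := hasSum_re_of_isMatrixOperator hK y n
    rw [h, lp.coeFn_smul, Pi.smul_apply, smul_eq_mul, Complex.re_ofReal_mul] at h1
    simpa only [hy, Complex.ofReal_re] using h1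
  have hlog2 : 0 < Real.log 2 := Real.log_pos one_lt_two
  -- At `θ = 0` the convention `0 ^ 0 = 1` makes `y` a multiple of the first basis vector, and row
  -- `2` is contradicted. Otherwise `θ = 2 ^ (-s)` and `y` is a multiple of `n ^ (-s)`, with `s >
  -- 1/2` by square summability.
  rcases hθ.eq_or_lt with h0 | h0
  · have hlog : ∀ m : ℕ+, m ≠ 1 → Real.log m / Real.log 2 ≠ 0 := by
      intro m hm
      refine (div_pos (Real.log_pos ?_) hlog2).ne'
      have : 1 < m := lt_of_le_of_ne one_le (Ne.symm hm)
      exact_mod_cast this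
    have h2 := hrow 2
    rw [← h0, Real.zero_rpow (hlog 2 (by decide))] at h2
    have h3 : HasSum (fun m : ℕ+ => hardyEntry α 2 m * (ρ * (0 : ℝ) ^ (Real.log m / Real.log 2)))
        (hardyEntry α 2 1 * (ρ * (0 : ℝ) ^ (Real.log (1 : ℕ+) / Real.log 2))) := by
      refine hasSum_single 1 fun m hm => ?_
      rw [Real.zero_rpow (hlog m hm)]
      simp
    have h4 := h2.unique h3
    simp only [PNat.val_ofNat, Nat.cast_one, Real.log_one, zero_div, Real.rpow_zero, mul_zero,
      mul_one] at h4
    exact (mul_pos (hardyEntry_pos α 2 1) hρ).ne h4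
  · set s := -Real.log θ / Real.log 2 with hs
    have hpow : ∀ t : ℝ, 0 < t → θ ^ (Real.log t / Real.log 2) = t ^ (-s) := by
      intro t ht
      rw [Real.rpow_def_of_pos h0, Real.rpow_def_of_pos ht, hs]
      congr 1
      field_simp
    have hs1 : 1 / 2 < s := by
      have h1 := hasSum_pnat_iff.2 (lp_hasSum_norm_sq y)
      have h2 : Summable fun k : ℕ => ((k : ℝ) + 1) ^ (-(2 * s)) := by
        refine (h1.summable.div_const (ρ ^ 2)).congr fun k => ?_
        have hk : (0 : ℝ) < (k : ℝ) + 1 := by positivity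
        rw [hy, cast_succPNat, hpow _ hk, Complex.norm_real, Real.norm_of_nonneg (by positivity),
          mul_pow, mul_div_cancel_left₀ _ (by positivity), ← Real.rpow_mul_natCast hk.le]
        push_cast
        ring_nf
      have h3 : Summable fun k : ℕ => (k : ℝ) ^ (-(2 * s)) := by
        rw [← summable_nat_add_iff 1]
        exact_mod_cast h2
      have := Real.summable_nat_rpow.1 h3
      linarith
    refine not_forall_power_eigen (a := α + (s - 1 / 2)) (β := α - (s - 1 / 2)) (μ := μ)
      (by linarith) fun N => ?_
    have h1 := sqrt_mul_eq_headSum_add_tailSum (hrow N.succPNat)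
    have hX : ∀ k : ℕ, θ ^ (Real.log (k.succPNat : ℕ) / Real.log 2) = ((k : ℝ) + 1) ^ (-s) := by
      intro k
      rw [cast_succPNat]
      exact hpow _ (by positivity)
    have hA : headSum α (fun k => ρ * θ ^ (Real.log (k.succPNat : ℕ) / Real.log 2)) N =
        ρ * ∑ k ∈ range (N + 1), ((k : ℝ) + 1) ^ (α - (s - 1 / 2) - 1) := by
      rw [headSum, Finset.mul_sum]
      refine Finset.sum_congr rfl fun k _ => ?_
      rw [hX, mul_left_comm, ← Real.rpow_add (by positivity)]
      ring_nf
    have hB : tailSum α (fun k => ρ * θ ^ (Real.log (k.succPNat : ℕ) / Real.log 2)) N =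
        ρ * ∑' k : ℕ, ((k : ℝ) + (N + 1 + 1)) ^ (-(α + (s - 1 / 2)) - 1) := by
      rw [tailSum, ← tsum_mul_left]
      refine tsum_congr fun k => ?_
      have e1 : (((k + (N + 1) : ℕ) : ℝ) + 1) = k + (N + 1 + 1) := by push_cast; ring
      have e2 : (k : ℝ) + N + 2 = k + (N + 1 + 1) := by ring
      rw [hX, e1, e2, mul_left_comm, ← Real.rpow_add (by positivity)]
      ring_nf
    rw [hA, hB, hX] at h1
    have ht : (0 : ℝ) < (N : ℝ) + 1 := by positivity
    set t := (N : ℝ) + 1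
    set A := ∑ k ∈ range (N + 1), ((k : ℝ) + 1) ^ (α - (s - 1 / 2) - 1)
    set B := ∑' k : ℕ, ((k : ℝ) + (t + 1)) ^ (-(α + (s - 1 / 2)) - 1)
    have h2 : A + t ^ α * t ^ α * B = μ * (t ^ α * (t ^ (1 / 2 : ℝ) * t ^ (-s))) := by
      have h3 : t ^ α * t ^ (-α) = 1 := by
        rw [← Real.rpow_add ht]
        simp
      have h4 : ρ * (A + t ^ α * t ^ α * B)
          = ρ * (μ * (t ^ α * (t ^ (1 / 2 : ℝ) * t ^ (-s)))) := by
        linear_combination (-t ^ α) * h1 - ρ * A * h3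
      exact mul_left_cancel₀ hρ.ne' h4
    rw [← Real.rpow_add ht, ← Real.rpow_add ht, ← Real.rpow_add ht] at h2
    convert h2 using 3
    · congr 1
      ring
    · ring

/-- Above the essential norm, the norm is not approached along reproducing kernels. -/
theorem not_reproducingKernelThesis_of_lt
    (hC : ∀ x, HasSum (fun i => x i • symbolPow hα.le i) (C x))
    (hK : IsMatrixOperator (hardyEntry α) (C.adjoint ∘L C)) (hl : 2 / α < ‖C‖ ^ 2) :
    ¬ReproducingKernelThesis (phiSymbol α) := by
  rintro ⟨C', hC', hlub⟩
  obtain rfl := hC'.unique (isCompositionOperator_of_hasSum (hα := hα) hC)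
  obtain ⟨u, -, -, hu, hmem⟩ := hlub.exists_seq_monotone_tendsto
    ⟨_, ⟨realPoint 1 (by norm_num), rfl⟩⟩
  choose w hw using hmem
  set σ : ℕ → ℝ := fun j => (w j : ℂ).re with hσ
  set k : ℕ → DirichletH2 := fun j => DirichletH2.kernel (realPoint (σ j) (half_lt_re (w j))) with hk
  have hk0 : ∀ j, 0 < ‖k j‖ := by
    intro j
    refine norm_pos_iff.2 fun h => ?_
    have := kernel_realPoint_apply (half_lt_re (w j)) 1
    rw [show DirichletH2.kernel (realPoint (w j : ℂ).re (half_lt_re (w j))) = 0 from h] at this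
    simp at this
  set x : ℕ → DirichletH2 := fun j => ((‖k j‖⁻¹ : ℝ) : ℂ) • k j with hx
  have hx1 : ∀ j, ‖x j‖ = 1 := by
    intro j
    rw [hx]
    simp only
    rw [norm_smul, Complex.norm_real, norm_inv, norm_norm, inv_mul_cancel₀ (hk0 j).ne']
  -- Replacing `w j` by its real part keeps the norm of the kernel and does not decrease that of its
  -- image, so the sequence is still maximizing.
  have hlim : Tendsto (fun j => ‖C' (x j)‖) atTop (𝓝 ‖C'‖) := by
    refine tendsto_of_tendsto_of_tendsto_of_le_of_le hu tendsto_const_nhds (fun j => ?_)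
      fun j => by simpa [hx1] using C'.le_opNorm (x j)
    simp only [hx, map_smul]
    rw [norm_smul, Complex.norm_real, norm_inv, norm_norm, ← hw j]
    simp only
    rw [norm_kernel_eq_realPoint (w j), div_eq_inv_mul]
    gcongr
    exact norm_composition_kernel_le hK (w j)
  obtain ⟨φ, -, y, hy, hy1, hy2⟩ := exists_subseq_tendsto_eigenvector (hα := hα) hC hl hx1 hlim
  have hxn : ∀ j (n : ℕ+), x j n = ((‖k j‖⁻¹ * (n : ℝ) ^ (-σ j) : ℝ) : ℂ) := by
    intro j n
    have h := kernel_realPoint_apply (half_lt_re (w j)) n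
    simp only [hx, lp.coeFn_smul, Pi.smul_apply, smul_eq_mul]
    rw [show k j n = _ from h]
    push_cast
    rfl
  have hcoord : ∀ n : ℕ+, Tendsto (fun j => ‖k (φ j)‖⁻¹ * (n : ℝ) ^ (-σ (φ j))) atTop
      (𝓝 (y n).re) ∧ (y n).im = 0 := by
    intro n
    have h1 := ((lp.evalCLM ℂ (fun _ : ℕ+ => ℂ) 2 n).continuous.tendsto y).comp hy
    have h2 : Tendsto (fun j => x (φ j) n) atTop (𝓝 (y n)) := h1
    simp only [hxn] at h2
    refine ⟨(Complex.continuous_re.tendsto _).comp h2, ?_⟩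
    exact tendsto_nhds_unique ((Complex.continuous_im.tendsto _).comp h2)
      (tendsto_const_nhds.congr fun j => (Complex.ofReal_im _).symm)
  set ρ := (y 1).re with hρ
  have hr : Tendsto (fun j => ‖k (φ j)‖⁻¹) atTop (𝓝 ρ) := by simpa using (hcoord 1).1
  have hyn0 : ∀ n, 0 ≤ (y n).re := fun n =>
    ge_of_tendsto' (hcoord n).1 fun j => by have := cast_pos n; positivity
  have hynρ : ∀ n, (y n).re ≤ ρ := fun n => le_of_tendsto_of_tendsto' (hcoord n).1 hr fun j => by
    refine mul_le_of_le_one_right (by positivity) ?_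
    have h1 : (1 : ℝ) ≤ (n : ℝ) := by exact_mod_cast (one_le : 1 ≤ n)
    have h2 : 1 / 2 < σ (φ j) := (w (φ j)).2
    exact Real.rpow_le_one_of_one_le_of_nonpos h1 (by linarith)
  -- All coordinates of a kernel at a real point are dominated by the first, so `ρ = 0` would give
  -- `y = 0`. This excludes kernels approaching the boundary.
  have hρ0 : 0 < ρ := by
    refine (hyn0 1).lt_of_ne fun h => ?_
    have : y = 0 := by
      ext n
      have h1 := hynρ n
      rw [hρ, ← h] at h1
      exact Complex.ext (le_antisymm h1 (hyn0 n)) (hcoord n).2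
    simp [this] at hy1
  -- The limit of `2 ^ (-σ)`. It exists even if `σ` tends to infinity, where `θ = 0`; this is why
  -- the limit is written with powers of `θ`.
  set θ := (y 2).re / ρ with hθ
  have hθ0 : 0 ≤ θ := div_nonneg (hyn0 2) hρ0.le
  have hθlim : Tendsto (fun j => (2 : ℝ) ^ (-σ (φ j))) atTop (𝓝 θ) := by
    refine ((hcoord 2).1.div hr hρ0.ne').congr fun j => ?_
    have := (inv_pos.2 (hk0 (φ j))).ne'
    rw [Pi.div_apply, mul_div_cancel_left₀ _ this]
    norm_num
  refine not_eigenvector_multiplicative hK hα hρ0 hθ0 (fun n => ?_) hy2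
  have hlog2 : 0 < Real.log 2 := Real.log_pos one_lt_two
  have h1 : Tendsto (fun j => ‖k (φ j)‖⁻¹ * ((2 : ℝ) ^ (-σ (φ j))) ^ (Real.log n / Real.log 2))
      atTop (𝓝 (ρ * θ ^ (Real.log n / Real.log 2))) :=
    hr.mul (hθlim.rpow_const (Or.inr (div_nonneg (log_nonneg n) hlog2.le)))
  have h2 := tendsto_nhds_unique ((hcoord n).1.congr fun j => by
    rw [← Real.rpow_mul two_pos.le, Real.rpow_def_of_pos (cast_pos n), Real.rpow_def_of_pos two_pos]
    congr 2
    field_simp) h1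
  exact Complex.ext h2 (hcoord n).2

end KernelThesis

/-! ### Decaying solutions of a perturbed recurrence -/

section Recurrence

theorem le_of_tendsto_of_le_succ {g : ℕ → ℝ} {l : ℝ} {n : ℕ} (h : ∀ j, n ≤ j → g j ≤ g (j + 1))
    (hg : Tendsto g atTop (𝓝 l)) : g n ≤ l := by
  have hm : Monotone fun i => g (i + n) := monotone_nat_of_le_succ fun i => by
    have := h (i + n) (by omega)
    rwa [show i + 1 + n = i + n + 1 by ring]
  have := hm.ge_of_tendsto ((tendsto_add_atTop_iff_nat n).2 hg) 0
  simpa using this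

theorem one_div_sq_le (j : ℕ) :
    1 / ((j : ℝ) + 1) ^ 2 ≤ 2 * (1 / ((j : ℝ) + 1) - 1 / ((j : ℝ) + 1 + 1)) := by
  have hj : (0 : ℝ) ≤ j := j.cast_nonneg
  rw [div_sub_div _ _ (by positivity) (by positivity), ← mul_div_assoc,
    div_le_div_iff₀ (by positivity) (by positivity)]
  nlinarith [mul_nonneg hj hj, mul_nonneg (mul_nonneg hj hj) hj]

/-- Since `1 / (j + 1)²` is dominated by a telescoping difference, both `f` and `-f` become monotone
after subtracting `2c / (j + 1)`; they are then compared with their limits. -/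
theorem abs_le_of_abs_sub_succ_le {f : ℕ → ℝ} {c : ℝ} (hc : 0 ≤ c) {n : ℕ}
    (h : ∀ j, n ≤ j → |f (j + 1) - f j| ≤ c * (1 / ((j : ℝ) + 1) ^ 2))
    (hf : Tendsto f atTop (𝓝 0)) : |f n| ≤ 2 * c * (1 / ((n : ℝ) + 1)) := by
  have hlim : Tendsto (fun j : ℕ => 2 * c * (1 / ((j : ℝ) + 1))) atTop (𝓝 (2 * c * 0)) :=
    tendsto_one_div_add_atTop_nhds_zero_nat.const_mul _
  have key : ∀ j, n ≤ j → |f (j + 1) - f j| ≤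
      2 * c * (1 / ((j : ℝ) + 1)) - 2 * c * (1 / (((j + 1 : ℕ) : ℝ) + 1)) := by
    intro j hj
    refine (h j hj).trans ((mul_le_mul_of_nonneg_left (one_div_sq_le j) hc).trans (le_of_eq ?_))
    push_cast
    ring
  rw [mul_zero] at hlim
  have h1 : f n - 2 * c * (1 / ((n : ℝ) + 1)) ≤ 0 := by
    have := le_of_tendsto_of_le_succ (g := fun j : ℕ => f j - 2 * c * (1 / ((j : ℝ) + 1))) (n := n)
      (fun j hj => by
        have := (abs_le.1 (key j hj)).1
        linarith) (hf.sub hlim)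
    simpa using this
  have h2 : -f n - 2 * c * (1 / ((n : ℝ) + 1)) ≤ 0 := by
    have := le_of_tendsto_of_le_succ (g := fun j : ℕ => -f j - 2 * c * (1 / ((j : ℝ) + 1))) (n := n)
      (fun j hj => by
        have := (abs_le.1 (key j hj)).2
        linarith) (hf.neg.sub hlim)
    simpa using this
  exact abs_le.2 ⟨by linarith, by linarith⟩

/-- The loss factors have a positive infinite product. Concretely, `E j (1 - 2M / (j + 1))` is
eventually nondecreasing, nonnegative and tends to `0`. -/
theorem eventually_zero_of_le_mul {E : ℕ → ℝ} {M : ℝ} (hM : 0 ≤ M) (hE0 : ∀ N, 0 ≤ E N)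
    (hE : Tendsto E atTop (𝓝 0))
    (h : ∀ N : ℕ, E N - M * (1 / ((N : ℝ) + 1) ^ 2) * E N ≤ E (N + 1)) :
    ∃ N₀, ∀ N, N₀ ≤ N → E N = 0 := by
  obtain ⟨N₀, hN₀⟩ := exists_nat_gt (2 * M)
  refine ⟨N₀, fun N hN => ?_⟩
  have hw : ∀ j : ℕ, N₀ ≤ j → 0 < 1 - 2 * M * (1 / ((j : ℝ) + 1)) := by
    intro j hj
    have hj' : (N₀ : ℝ) ≤ j := by exact_mod_cast hj
    have hj0 : (0 : ℝ) ≤ j := j.cast_nonneg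
    rw [sub_pos, mul_one_div, div_lt_one (by positivity)]
    linarith
  have hlim : Tendsto (fun j : ℕ => E j * (1 - 2 * M * (1 / ((j : ℝ) + 1)))) atTop
      (𝓝 (0 * (1 - 2 * M * 0))) :=
    hE.mul ((tendsto_one_div_add_atTop_nhds_zero_nat.const_mul _).const_sub 1)
  rw [zero_mul] at hlim
  have := le_of_tendsto_of_le_succ (n := N) (fun j hj => by
    have hj1 := hw (j + 1) (by omega)
    have h1 := mul_le_mul_of_nonneg_right (h j) hj1.le
    refine le_trans ?_ h1
    have h2 := mul_le_mul_of_nonneg_left (one_div_sq_le j) hM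
    have h3 : 0 ≤ M * (1 / ((j : ℝ) + 1) ^ 2) * (2 * M * (1 / (((j + 1 : ℕ) : ℝ) + 1))) := by
      positivity
    push_cast at h3 ⊢
    have h4 : 0 ≤ E j * (2 * M * (1 / ((j : ℝ) + 1)) - 2 * M * (1 / ((j : ℝ) + 1 + 1))
        - M * (1 / ((j : ℝ) + 1) ^ 2)
        + M * (1 / ((j : ℝ) + 1) ^ 2) * (2 * M * (1 / ((j : ℝ) + 1 + 1)))) :=
      mul_nonneg (hE0 j) (by linarith)
    linarith) hlim
  have h5 := hw N hN
  have := hE0 N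
  nlinarith

theorem exists_max_tail {y : ℕ → ℝ} (hy : Tendsto y atTop (𝓝 0)) {N n : ℕ} (hn : N ≤ n)
    (hpos : 0 < y n) : ∃ m, N ≤ m ∧ 0 < y m ∧ ∀ j, N ≤ j → y j ≤ y m := by
  obtain ⟨J, hJ⟩ := eventually_atTop.1 (hy.eventually (gt_mem_nhds hpos))
  obtain ⟨m, hm, hmax⟩ := Finset.exists_max_image (Icc N (max J n)) y ⟨n, by simp [hn]⟩
  have hmn := hmax n (by simp [hn])
  refine ⟨m, (Finset.mem_Icc.1 hm).1, hpos.trans_le hmn, fun j hj => ?_⟩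
  rcases le_total j J with h | h
  · exact hmax j (Finset.mem_Icc.2 ⟨hj, h.trans (le_max_left _ _)⟩)
  · exact (hJ j h).le.trans hmn

/-- Solutions that tend to zero of a summable perturbation of the system
`s' = α d / t`, `d' = -κ s / t` with `κ ≥ 0` vanish eventually. -/
theorem eventually_zero_of_recurrence {α κ L : ℝ} (hα : 0 < α) (hκ : 0 ≤ κ) (hL : 0 ≤ L)
    {s d : ℕ → ℝ} (hs : Tendsto s atTop (𝓝 0)) (hd : Tendsto d atTop (𝓝 0))
    (h1 : ∀ N : ℕ, |s (N + 1) - s N - α * (1 / ((N : ℝ) + 1)) * d N| ≤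
      L * (1 / ((N : ℝ) + 1) ^ 2) * (|s N| + |d N|))
    (h2 : ∀ N : ℕ, |d (N + 1) - d N + κ * (1 / ((N : ℝ) + 1)) * s N| ≤
      L * (1 / ((N : ℝ) + 1) ^ 2) * (|s N| + |d N|)) :
    ∃ N₀, ∀ N, N₀ ≤ N → s N = 0 ∧ d N = 0 := by
  -- For `κ = 0` the energy no longer controls `s`. Instead let `S` be the maximum of `|s| + |d|`
  -- over a tail, attained at `m`: summing the recurrence back from infinity bounds `d`, then `s`,
  -- by `O(S / n)`, which gives `S ≤ c S / (m + 1)` with `m ≥ N₀ > c`.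
  rcases hκ.eq_or_lt with rfl | hκ
  · have hy : Tendsto (fun N => |s N| + |d N|) atTop (𝓝 0) := by
      simpa using hs.abs.add hd.abs
    set c := 2 * (2 * α * L + L) + 2 * L with hc
    obtain ⟨N₀, hN₀⟩ := exists_nat_gt c
    refine ⟨N₀, fun N hN => ?_⟩
    by_contra hne
    have hpos : 0 < |s N| + |d N| := by
      refine (add_nonneg (abs_nonneg _) (abs_nonneg _)).lt_of_ne fun h => hne ?_
      have hs0 := abs_nonneg (s N)
      have hd0 := abs_nonneg (d N)
      exact ⟨abs_eq_zero.1 (by linarith), abs_eq_zero.1 (by linarith)⟩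
    obtain ⟨m, hm, hm0, hmax⟩ := exists_max_tail hy hN hpos
    set S := |s m| + |d m| with hS
    have hd' : ∀ n, N₀ ≤ n → |d n| ≤ 2 * (L * S) * (1 / ((n : ℝ) + 1)) := by
      intro n hn
      refine abs_le_of_abs_sub_succ_le (by positivity) (fun j hj => ?_) hd
      have h3 := h2 j
      rw [zero_mul, zero_mul, add_zero] at h3
      refine h3.trans ?_
      rw [mul_right_comm]
      gcongr
      exact hmax j (hn.trans hj)
    have hs' : |s m| ≤ 2 * ((2 * α * L + L) * S) * (1 / ((m : ℝ) + 1)) := by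
      refine abs_le_of_abs_sub_succ_le (by positivity) (fun j hj => ?_) hs
      have h3 := abs_le.1 (h1 j)
      have h4 := hd' j (hm.trans hj)
      have h5 : |α * (1 / ((j : ℝ) + 1)) * d j| ≤ 2 * α * L * S * (1 / ((j : ℝ) + 1) ^ 2) := by
        rw [abs_mul, abs_of_nonneg (by positivity)]
        refine (mul_le_mul_of_nonneg_left h4 (by positivity)).trans (le_of_eq ?_)
        field_simp
      have h6 : L * (1 / ((j : ℝ) + 1) ^ 2) * (|s j| + |d j|) ≤
          L * (1 / ((j : ℝ) + 1) ^ 2) * S := by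
        gcongr
        exact hmax j (hm.trans hj)
      have h7 := abs_le.1 h5
      rw [abs_le]
      constructor <;> linarith [h3.1, h3.2, h7.1, h7.2]
    have hmt : (0 : ℝ) < (m : ℝ) + 1 := by positivity
    have h8 : S ≤ c * S * (1 / ((m : ℝ) + 1)) := by
      have := hd' m hm
      rw [hc]
      linarith
    rw [mul_one_div, le_div_iff₀ hmt] at h8
    have h9 : (m : ℝ) + 1 ≤ c := by
      have : S * ((m : ℝ) + 1) ≤ S * c := by linarith
      exact le_of_mul_le_mul_left this hm0
    have h10 : (N₀ : ℝ) ≤ m := by exact_mod_cast hm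
    linarith
  · set W := (2 * κ * (1 + α) + 2 * α * (1 + κ)) * L with hW
    have hmin : 0 < min κ α := lt_min hκ hα
    set M := W * 2 / min κ α with hM
    have hE0 : ∀ N, 0 ≤ κ * s N ^ 2 + α * d N ^ 2 := fun N => by positivity
    -- This energy is conserved by the differential system: the cross terms of first order in `r`
    -- cancel (`b8`). What can be lost in a step is of order `r ^ 2` times the energy.
    obtain ⟨N₀, hN₀⟩ := eventually_zero_of_le_mul (E := fun N => κ * s N ^ 2 + α * d N ^ 2)
      (M := M) (by positivity) hE0 (by
        simpa using ((hs.pow 2).const_mul κ).add ((hd.pow 2).const_mul α)) (fun N => by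
        have ht1 : 1 / ((N : ℝ) + 1) ≤ 1 := by
          rw [div_le_one (by positivity)]
          have : (0 : ℝ) ≤ N := N.cast_nonneg
          linarith
        have ht0 : 0 ≤ 1 / ((N : ℝ) + 1) := by positivity
        have htt : 1 / ((N : ℝ) + 1) ^ 2 = (1 / ((N : ℝ) + 1)) ^ 2 := by rw [one_div_pow]
        have h1N := h1 N
        have h2N := h2 N
        rw [htt] at h1N h2N ⊢
        set r := 1 / ((N : ℝ) + 1)
        set y := |s N| + |d N| with hy
        have hy0 : 0 ≤ y := by positivity
        have sq_ge : ∀ {p q e f : ℝ}, 0 ≤ e → |q - p| ≤ e → |p| ≤ f →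
            p ^ 2 - 2 * f * e ≤ q ^ 2 := by
          intro p q e f he hpq hp
          have hf : 0 ≤ f := (abs_nonneg p).trans hp
          have h3 : |p * (q - p)| ≤ f * e := by
            rw [abs_mul]
            gcongr
          nlinarith [(abs_le.1 h3).1, sq_nonneg (q - p)]
        have b1 := sq_ge (p := s N + α * r * d N) (q := s (N + 1)) (e := L * r ^ 2 * y)
          (f := (1 + α) * y) (by positivity) (by rwa [← sub_sub]) (by
            refine (abs_add_le _ _).trans ?_
            rw [abs_mul, abs_of_nonneg (show 0 ≤ α * r by positivity)]
            have e1 : α * r * |d N| ≤ α * 1 * |d N| := by gcongr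
            have e2 : 0 ≤ α * |s N| := by positivity
            have e3 := abs_nonneg (d N)
            rw [hy]
            linarith)
        have b2 := sq_ge (p := d N - κ * r * s N) (q := d (N + 1)) (e := L * r ^ 2 * y)
          (f := (1 + κ) * y) (by positivity) (by
            rw [show d (N + 1) - (d N - κ * r * s N) = d (N + 1) - d N + κ * r * s N by ring]
            exact h2N) (by
            refine (abs_sub _ _).trans ?_
            rw [abs_mul, abs_of_nonneg (show 0 ≤ κ * r by positivity)]
            have e1 : κ * r * |s N| ≤ κ * 1 * |s N| := by gcongr
            have e2 : 0 ≤ κ * |d N| := by positivity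
            have e3 := abs_nonneg (s N)
            rw [hy]
            linarith)
        have b3 := mul_le_mul_of_nonneg_left b1 hκ.le
        have b4 := mul_le_mul_of_nonneg_left b2 hα.le
        have b5 : W * r ^ 2 * y ^ 2 ≤ M * r ^ 2 * (κ * s N ^ 2 + α * d N ^ 2) := by
          have e1 : y ^ 2 ≤ 2 * (s N ^ 2 + d N ^ 2) := by
            have := sq_nonneg (|s N| - |d N|)
            have := sq_abs (s N)
            have := sq_abs (d N)
            rw [hy]
            nlinarith
          have e2 : min κ α * (s N ^ 2 + d N ^ 2) ≤ κ * s N ^ 2 + α * d N ^ 2 := by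
            rw [mul_add]
            gcongr
            · exact min_le_left _ _
            · exact min_le_right _ _
          have e3 : s N ^ 2 + d N ^ 2 ≤ (κ * s N ^ 2 + α * d N ^ 2) / min κ α := by
            rw [le_div_iff₀ hmin]
            linarith
          calc W * r ^ 2 * y ^ 2 ≤ W * r ^ 2 * (2 * ((κ * s N ^ 2 + α * d N ^ 2) / min κ α)) := by
                gcongr
                linarith
            _ = _ := by
                rw [hM]
                ring
        have b6 : 0 ≤ κ * (α * r * d N) ^ 2 := by positivity
        have b7 : 0 ≤ α * (κ * r * s N) ^ 2 := by positivity
        have b8 : κ * ((s N + α * r * d N) ^ 2 - 2 * ((1 + α) * y) * (L * r ^ 2 * y)) +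
            α * ((d N - κ * r * s N) ^ 2 - 2 * ((1 + κ) * y) * (L * r ^ 2 * y)) =
            κ * s N ^ 2 + α * d N ^ 2 + κ * (α * r * d N) ^ 2 + α * (κ * r * s N) ^ 2
              - W * r ^ 2 * y ^ 2 := by
          rw [hW]
          ring
        linarith)
    refine ⟨N₀, fun N hN => ?_⟩
    have h3 := hN₀ N hN
    have h4 : 0 ≤ κ * s N ^ 2 := by positivity
    have h5 : 0 ≤ α * d N ^ 2 := by positivity
    have h6 : κ * s N ^ 2 = 0 := by linarith
    have h7 : α * d N ^ 2 = 0 := by linarith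
    simpa [hκ.ne', hα.ne'] using And.intro h6 h7

end Recurrence

/-! ### Decay of the weighted head and tail sums -/

section Decay

variable {α : ℝ} {X : ℕ → ℝ}

/-- A fixed initial block is killed by `(N + 1) ^ (-α)`. The rest is estimated by Cauchy–Schwarz
with a small tail of the square sum, since the squared weights sum to `O((N + 1) ^ (2α))`. -/
theorem tendsto_headSum (hα : 0 < α) (hX : Summable fun k => X k ^ 2) :
    Tendsto (fun N : ℕ => ((N : ℝ) + 1) ^ (-α) * headSum α X N) atTop (𝓝 0) := by
  set M := (2 : ℝ) ^ (2 * α) / (2 * α) with hM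
  have hM0 : 0 ≤ M := by positivity
  rw [Metric.tendsto_atTop]
  intro ε hε
  set η := (ε / 2) ^ 2 / (M + 1) with hη
  have hη0 : 0 < η := by positivity
  obtain ⟨m, hm⟩ := ((tendsto_sum_nat_add fun k => X k ^ 2).eventually (gt_mem_nhds hη0)).exists
  set c := ∑ k ∈ range m, ((k : ℝ) + 1) ^ (α - 1 / 2) * X k
  have hl : Tendsto (fun N : ℕ => ((N : ℝ) + 1) ^ (-α) * c) atTop (𝓝 (0 * c)) :=
    (tendsto_nat_add_rpow_neg hα).mul_const c
  rw [zero_mul] at hl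
  obtain ⟨N₁, hN₁⟩ := Metric.tendsto_atTop.1 hl (ε / 2) (by positivity)
  refine ⟨max m N₁, fun N hN => ?_⟩
  have hmN : m ≤ N + 1 := by have := (le_max_left _ _).trans hN; omega
  have h1 := hN₁ N ((le_max_right _ _).trans hN)
  rw [Real.dist_eq, sub_zero] at h1 ⊢
  have hsplit : headSum α X N = c + ∑ k ∈ Ico m (N + 1), ((k : ℝ) + 1) ^ (α - 1 / 2) * X k :=
    (Finset.sum_range_add_sum_Ico _ hmN).symm
  set A := ∑ k ∈ Ico m (N + 1), ((k : ℝ) + 1) ^ (α - 1 / 2) * X k with hA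
  set t := (N : ℝ) + 1 with ht
  have ht0 : 0 < t := by positivity
  have h2 : A ^ 2 ≤ (M * t ^ (2 * α)) * η := by
    refine (Finset.sum_mul_sq_le_sq_mul_sq _ _ _).trans ?_
    gcongr
    · calc ∑ k ∈ Ico m (N + 1), (((k : ℝ) + 1) ^ (α - 1 / 2)) ^ 2
          ≤ ∑ k ∈ range (N + 1), (((k : ℝ) + 1) ^ (α - 1 / 2)) ^ 2 := by
            refine Finset.sum_le_sum_of_subset_of_nonneg ?_ fun k _ _ => by positivity
            intro k hk
            exact Finset.mem_range.2 (Finset.mem_Ico.1 hk).2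
        _ = ∑ k ∈ range (N + 1), ((k : ℝ) + 1) ^ (2 * α - 1) := by
            refine Finset.sum_congr rfl fun k _ => ?_
            rw [← Real.rpow_mul_natCast (by positivity)]
            push_cast
            ring_nf
        _ ≤ (((N + 1 : ℕ) : ℝ) + 1) ^ (2 * α) / (2 * α) :=
            sum_range_add_one_rpow_le (by positivity) _
        _ ≤ (2 * t) ^ (2 * α) / (2 * α) := by
            push_cast
            gcongr
            have : (0 : ℝ) ≤ N := N.cast_nonneg
            linarith
        _ = M * t ^ (2 * α) := by
            rw [Real.mul_rpow two_pos.le ht0.le]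
            ring
    · have h3 : ∑ k ∈ Ico m (N + 1), X k ^ 2 ≤ ∑' k, X (k + m) ^ 2 := by
        rw [Finset.sum_Ico_eq_sum_range]
        refine le_trans (le_of_eq ?_) (((summable_nat_add_iff m).2 hX).sum_le_tsum
          (range (N + 1 - m)) fun k _ => sq_nonneg _)
        exact Finset.sum_congr rfl fun k _ => by rw [add_comm]
      exact h3.trans hm.le
  have h4 : |t ^ (-α) * A| < ε / 2 := by
    refine abs_lt_of_sq_lt_sq ?_ (by positivity)
    have e1 : (t ^ (-α)) ^ 2 * t ^ (2 * α) = 1 := by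
      rw [← Real.rpow_mul_natCast ht0.le, ← Real.rpow_add ht0]
      push_cast
      ring_nf
      simp
    calc (t ^ (-α) * A) ^ 2 = (t ^ (-α)) ^ 2 * A ^ 2 := by ring
      _ ≤ (t ^ (-α)) ^ 2 * ((M * t ^ (2 * α)) * η) := by gcongr
      _ = M * η * ((t ^ (-α)) ^ 2 * t ^ (2 * α)) := by ring
      _ = M * η := by rw [e1, mul_one]
      _ < (M + 1) * η := by linarith
      _ = (ε / 2) ^ 2 := by
          rw [hη]
          field_simp
  rw [hsplit, mul_add]
  exact (abs_add_le _ _).trans_lt (by linarith)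

theorem tendsto_tailSum (hα : 0 < α) (hX : Summable fun k => X k ^ 2)
    (hs : ∀ N : ℕ, Summable fun k : ℕ => ((k : ℝ) + N + 2) ^ (-α - 1 / 2) * X (k + (N + 1))) :
    Tendsto (fun N : ℕ => ((N : ℝ) + 1) ^ α * tailSum α X N) atTop (𝓝 0) := by
  have hα2 : 0 < 2 * α := by linarith
  have hbound : ∀ N : ℕ, |((N : ℝ) + 1) ^ α * tailSum α X N| ≤
      √(1 / (2 * α) * ∑' k, X (k + (N + 1)) ^ 2) := by
    intro N
    set t := (N : ℝ) + 1 with ht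
    have ht0 : 0 < t := by positivity
    refine Real.abs_le_sqrt ?_
    have h1 : tailSum α X N ^ 2 ≤ (t ^ (-(2 * α)) / (2 * α)) * ∑' k, X (k + (N + 1)) ^ 2 := by
      refine le_of_tendsto' (((hs N).hasSum).pow 2) fun S => ?_
      refine (Finset.sum_mul_sq_le_sq_mul_sq _ _ _).trans ?_
      gcongr
      · have h2 := (summable_nat_add_rpow hα2 (show 0 ≤ t + 1 by linarith)).sum_le_tsum S
          fun k _ => by positivity
        have h3 := tsum_nat_add_rpow_le_midpoint hα2 ht0.le
        have h4 : (t + 1 / 2) ^ (-(2 * α)) / (2 * α) ≤ t ^ (-(2 * α)) / (2 * α) := by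
          have h5 : t ≤ t + 1 / 2 := by linarith
          exact div_le_div_of_nonneg_right
            (Real.rpow_le_rpow_of_nonpos ht0 h5 (by linarith)) hα2.le
        refine le_trans (le_of_eq (Finset.sum_congr rfl fun k _ => ?_)) (h2.trans (h3.trans h4))
        have e : (k : ℝ) + N + 2 = k + (t + 1) := by rw [ht]; ring
        rw [e, ← Real.rpow_mul_natCast (by positivity)]
        push_cast
        ring_nf
      · exact ((summable_nat_add_iff (N + 1)).2 hX).sum_le_tsum S fun k _ => sq_nonneg _
    have e1 : (t ^ α) ^ 2 * t ^ (-(2 * α)) = 1 := by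
      rw [← Real.rpow_mul_natCast ht0.le, ← Real.rpow_add ht0]
      push_cast
      ring_nf
      simp
    calc (t ^ α * tailSum α X N) ^ 2 = (t ^ α) ^ 2 * tailSum α X N ^ 2 := by ring
      _ ≤ (t ^ α) ^ 2 * ((t ^ (-(2 * α)) / (2 * α)) * ∑' k, X (k + (N + 1)) ^ 2) := by gcongr
      _ = ((t ^ α) ^ 2 * t ^ (-(2 * α))) * (1 / (2 * α) * ∑' k, X (k + (N + 1)) ^ 2) := by ring
      _ = _ := by rw [e1, one_mul]
  have hl := (((tendsto_sum_nat_add fun k => X k ^ 2).comp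
    (tendsto_add_atTop_nat 1)).const_mul (1 / (2 * α))).sqrt
  rw [mul_zero, Real.sqrt_zero] at hl
  exact squeeze_zero_norm hbound hl

end Decay

/-! ### From head and tail sums to their sum and difference -/

section Recurrence

variable {α L ν r r' e f a b a' b' : ℝ}

theorem abs_add_abs_le (a b : ℝ) : |a| + |b| ≤ |a + b| + |b - a| := by
  have h1 : |2 * a| ≤ |a + b| + |b - a| := by
    have := abs_sub (a + b) (b - a)
    rwa [show a + b - (b - a) = 2 * a by ring] at this
  have h2 : |2 * b| ≤ |a + b| + |b - a| := by
    have := abs_add_le (a + b) (b - a)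
    rwa [show a + b + (b - a) = 2 * b by ring] at this
  rw [abs_mul, abs_two] at h1 h2
  linarith

theorem abs_error_le {σ : ℝ} (hL : 0 ≤ L) (hσ : |σ| = 1) (he : |e| ≤ L * r ^ 2)
    (hf : |f| ≤ L * r ^ 2) :
    |f * b + σ * (e * a)| ≤ L * r ^ 2 * (|a + b| + |b - a|) := by
  calc |f * b + σ * (e * a)| ≤ |f * b| + |σ * (e * a)| := abs_add_le _ _
    _ = |f| * |b| + |e| * |a| := by rw [abs_mul, abs_mul σ, abs_mul e, hσ, one_mul]
    _ ≤ L * r ^ 2 * |b| + L * r ^ 2 * |a| :=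
      add_le_add (mul_le_mul_of_nonneg_right hf (abs_nonneg _))
        (mul_le_mul_of_nonneg_right he (abs_nonneg _))
    _ = L * r ^ 2 * (|a| + |b|) := by ring
    _ ≤ L * r ^ 2 * (|a + b| + |b - a|) :=
      mul_le_mul_of_nonneg_left (abs_add_abs_le a b) (by positivity)

theorem abs_sum_step_le (hα : 0 ≤ α) (hν : 0 ≤ ν) (hL : 0 ≤ L) (he : |e| ≤ L * r ^ 2)
    (hf : |f| ≤ L * r ^ 2) (hs : a' + b' = (1 - α * r + e) * a + (1 + α * r + f) * b) :
    |a' + b' - (a + b) - α * r * (b - a)| ≤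
      (L + ν * (1 + α + L)) * r ^ 2 * (|a + b| + |b - a|) := by
  rw [hs, show (1 - α * r + e) * a + (1 + α * r + f) * b - (a + b) - α * r * (b - a)
    = f * b + 1 * (e * a) by ring]
  -- The constant `L` would do here; the surplus matches the constant in `abs_difference_step_le`.
  refine (abs_error_le hL abs_one he hf).trans (mul_le_mul_of_nonneg_right
    (mul_le_mul_of_nonneg_right (le_add_of_nonneg_right ?_) ?_) ?_) <;> positivity

/-- The term `ν r' (a' + b')` is implicit, involving the next step; replacing it by `ν r (a + b)`
costs only second order in `r`. -/
theorem abs_difference_step_le (hα : 0 ≤ α) (hν : 0 ≤ ν) (hL : 0 ≤ L) (hr' : 0 ≤ r')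
    (hr'r : r' ≤ r) (hr1 : r ≤ 1) (hrr : r - r' ≤ r ^ 2) (he : |e| ≤ L * r ^ 2)
    (hf : |f| ≤ L * r ^ 2) (hs : a' + b' = (1 - α * r + e) * a + (1 + α * r + f) * b)
    (hd : b' - a' = (1 + α * r + f) * b - (1 - α * r + e) * a - ν * r' * (a' + b')) :
    |b' - a' - (b - a) + (ν - α) * r * (a + b)| ≤
      (L + ν * (1 + α + L)) * r ^ 2 * (|a + b| + |b - a|) := by
  have hr0 : 0 ≤ r := hr'.trans hr'r
  have hS := abs_nonneg (a + b)
  have hD := abs_nonneg (b - a)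
  have h1 := abs_error_le (a := a) (b := b) hL abs_one he hf
  have h1' := abs_error_le (a := a) (b := b) (σ := -1) hL (by simp) he hf
  have h2 : |r * (a + b) - r' * (a' + b')| ≤ (1 + α + L) * r ^ 2 * (|a + b| + |b - a|) := by
    have e1 : r * (a + b) - r' * (a' + b') = (r - r') * (a + b)
        - r' * (α * r * (b - a)) - r' * (f * b + 1 * (e * a)) := by
      rw [hs]
      ring
    have b1 : |(r - r') * (a + b)| ≤ r ^ 2 * |a + b| := by
      rw [abs_mul, abs_of_nonneg (sub_nonneg.2 hr'r)]
      exact mul_le_mul_of_nonneg_right hrr hS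
    have b2 : |r' * (α * r * (b - a))| ≤ α * r ^ 2 * |b - a| := by
      rw [abs_mul, abs_mul (α * r), abs_of_nonneg hr', abs_of_nonneg (mul_nonneg hα hr0)]
      calc r' * (α * r * |b - a|) ≤ r * (α * r * |b - a|) :=
            mul_le_mul_of_nonneg_right hr'r (by positivity)
        _ = _ := by ring
    have b3 : |r' * (f * b + 1 * (e * a))| ≤ L * r ^ 2 * (|a + b| + |b - a|) := by
      rw [abs_mul, abs_of_nonneg hr']
      exact (mul_le_of_le_one_left (abs_nonneg _) (hr'r.trans hr1)).trans h1
    have b4 : 0 ≤ r ^ 2 * |b - a| + α * r ^ 2 * |a + b| := by positivity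
    rw [e1]
    calc _ ≤ |(r - r') * (a + b)| + |r' * (α * r * (b - a))| + |r' * (f * b + 1 * (e * a))| :=
          (abs_sub _ _).trans (add_le_add_left (abs_sub _ _) _)
      _ ≤ r ^ 2 * |a + b| + α * r ^ 2 * |b - a| + L * r ^ 2 * (|a + b| + |b - a|) :=
          add_le_add (add_le_add b1 b2) b3
      _ ≤ _ := by linarith
  have h3 : b' - a' - (b - a) + (ν - α) * r * (a + b) =
      (f * b + (-1) * (e * a)) + ν * (r * (a + b) - r' * (a' + b')) := by
    rw [hd]
    ring
  rw [h3]
  calc _ ≤ |f * b + (-1) * (e * a)| + |ν * (r * (a + b) - r' * (a' + b'))| := abs_add_le _ _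
    _ ≤ L * r ^ 2 * (|a + b| + |b - a|)
        + ν * ((1 + α + L) * r ^ 2 * (|a + b| + |b - a|)) := by
      rw [abs_mul ν, abs_of_nonneg hν]
      exact add_le_add h1' (mul_le_mul_of_nonneg_left h2 hν)
    _ = _ := by ring

theorem eventually_zero_of_coupled_recurrence {a b : ℕ → ℝ} (hα : 0 < α) (hν : 0 < ν)
    (hκ : 0 ≤ ν - α) (hL : 0 ≤ L) (ha : Tendsto a atTop (𝓝 0)) (hb : Tendsto b atTop (𝓝 0))
    (step : ∀ N : ℕ, ∃ r r' e f : ℝ, r = 1 / ((N : ℝ) + 1) ∧ 0 ≤ r' ∧ r' ≤ r ∧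
      r - r' ≤ r ^ 2 ∧ |e| ≤ L * r ^ 2 ∧ |f| ≤ L * r ^ 2 ∧
      a (N + 1) + b (N + 1) = (1 - α * r + e) * a N + (1 + α * r + f) * b N ∧
      b (N + 1) - a (N + 1) = (1 + α * r + f) * b N - (1 - α * r + e) * a N
        - ν * r' * (a (N + 1) + b (N + 1))) :
    ∃ N₀, ∀ N, N₀ ≤ N → a N = 0 ∧ b N = 0 := by
  obtain ⟨N₀, hN₀⟩ := eventually_zero_of_recurrence (α := α) (κ := ν - α)
    (L := L + ν * (1 + α + L)) hα hκ (by positivity) (s := fun N => a N + b N)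
    (d := fun N => b N - a N) (by simpa using ha.add hb) (by simpa using hb.sub ha)
    (fun N => by
      obtain ⟨r, r', e, f, hr, -, -, -, he, hf, hs, -⟩ := step N
      rw [← one_div_pow, ← hr]
      exact abs_sum_step_le hα.le hν.le hL he hf hs)
    (fun N => by
      obtain ⟨r, r', e, f, hr, hr'0, hr'r, hrr, he, hf, hs, hd⟩ := step N
      have hr1 : r ≤ 1 := by
        rw [hr, div_le_one (by positivity)]
        exact le_add_of_nonneg_left N.cast_nonneg
      rw [← one_div_pow, ← hr]
      exact abs_difference_step_le hα.le hν.le hL hr'0 hr'r hr1 hrr he hf hs hd)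
  refine ⟨N₀, fun N hN => ?_⟩
  obtain ⟨h1, h2⟩ := hN₀ N hN
  constructor <;> linarith

end Recurrence

/-! ### No eigenvalues up to the essential norm -/

section EmbeddedEigenvalues

variable {α μ : ℝ} {x : ℕ+ → ℝ}

/-- In the row `N + 2` the coordinate of index `N + 2` may be counted in either of the two sums. -/
theorem sqrt_mul_succ_eq {y : ℝ} {N : ℕ}
    (h0 : HasSum (fun m => hardyEntry α N.succPNat m * x m) y)
    {z : ℝ} (h : HasSum (fun m => hardyEntry α (N + 1).succPNat m * x m) z) :
    ((N : ℝ) + 2) ^ (1 / 2 : ℝ) * z =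
      ((N : ℝ) + 2) ^ (-α) * headSum α (fun k => x k.succPNat) N +
      ((N : ℝ) + 2) ^ α * tailSum α (fun k => x k.succPNat) N := by
  have h1 := sqrt_mul_eq_headSum_add_tailSum h
  have h2 := tailSum_eq_add (X := fun k => x k.succPNat) (summable_tailSum h0)
  have ht : (0 : ℝ) < (N : ℝ) + 2 := by positivity
  have e : (((N + 1 : ℕ) : ℝ) + 1) = N + 2 := by push_cast; ring
  have e1 : ((N : ℝ) + 2) ^ (-α) * ((N : ℝ) + 2) ^ (α - 1 / 2)
      = ((N : ℝ) + 2) ^ (-(1 / 2) : ℝ) := by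
    rw [← Real.rpow_add ht]
    ring_nf
  have e2 : ((N : ℝ) + 2) ^ α * ((N : ℝ) + 2) ^ (-α - 1 / 2)
      = ((N : ℝ) + 2) ^ (-(1 / 2) : ℝ) := by
    rw [← Real.rpow_add ht]
    ring_nf
  rw [headSum_succ, e] at h1
  rw [h1, h2, mul_add, mul_add, ← mul_assoc, ← mul_assoc, e1, e2]
  ring

theorem sums_eq_zero_of_eq_zero {N : ℕ}
    (h : Summable fun k : ℕ => ((k : ℝ) + N + 2) ^ (-α - 1 / 2) * x (k + (N + 1)).succPNat)
    (hx : x (N + 1).succPNat = 0)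
    (hA : headSum α (fun k => x k.succPNat) (N + 1) = 0)
    (hB : tailSum α (fun k => x k.succPNat) (N + 1) = 0) :
    headSum α (fun k => x k.succPNat) N = 0 ∧ tailSum α (fun k => x k.succPNat) N = 0 := by
  rw [headSum_succ, hx, mul_zero, add_zero] at hA
  refine ⟨hA, ?_⟩
  have h1 := tailSum_eq_add (X := fun k => x k.succPNat) h
  rw [h1, hx, hB, mul_zero, add_zero]

theorem eq_zero_of_headSum_eq_zero (h : ∀ N, headSum α (fun k => x k.succPNat) N = 0) : x = 0 := by
  have hX : ∀ k : ℕ, x k.succPNat = 0 := by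
    intro k
    cases k with
    | zero =>
      have := h 0
      simpa [headSum] using this
    | succ N =>
      have h1 := h (N + 1)
      rw [headSum_succ, h N, zero_add] at h1
      exact (mul_eq_zero.1 h1).resolve_left (by positivity)
  funext n
  rw [← PNat.succPNat_natPred n]
  exact hX _

/-- Rows `N + 1` and `N + 2` can be written with the same head `A` and tail `B`. They give `A + t ^
(2α) B = 0` for two different `t`, so both vanish. -/
theorem eq_zero_of_eigenvalue_zero (hα : 0 < α)
    (h : ∀ n, HasSum (fun m => hardyEntry α n m * x m) 0) : x = 0 := by
  refine eq_zero_of_headSum_eq_zero (α := α) fun N => ?_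
  have h1 := sqrt_mul_eq_headSum_add_tailSum (h N.succPNat)
  have h2 := sqrt_mul_succ_eq (h N.succPNat) (h (N + 1).succPNat)
  set A := headSum α (fun k => x k.succPNat) N
  set B := tailSum α (fun k => x k.succPNat) N
  have hN : (0 : ℝ) ≤ N := N.cast_nonneg
  have aux : ∀ t : ℝ, 0 < t → t ^ (1 / 2 : ℝ) * 0 = t ^ (-α) * A + t ^ α * B →
      A + t ^ (2 * α) * B = 0 := by
    intro t ht h
    have e : t ^ α * t ^ (-α) = 1 := by
      rw [← Real.rpow_add ht]
      simp
    have e2 : t ^ (2 * α) = t ^ α * t ^ α := by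
      rw [← Real.rpow_add ht]
      ring_nf
    rw [e2]
    linear_combination -(t ^ α) * h - A * e
  have h3 := aux _ (by positivity) h1
  have h4 := aux _ (by positivity) h2
  have h5 : ((N : ℝ) + 1) ^ (2 * α) < ((N : ℝ) + 2) ^ (2 * α) :=
    Real.rpow_lt_rpow (by positivity) (by linarith) (by positivity)
  have h6 : (((N : ℝ) + 2) ^ (2 * α) - ((N : ℝ) + 1) ^ (2 * α)) * B = 0 := by linarith
  have h7 : B = 0 := (mul_eq_zero.1 h6).resolve_left (by linarith)
  rw [h7] at h3
  linarith

/-- There are no square summable eigenvectors for the eigenvalues in `[0, 2 / α]`. -/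
theorem eq_zero_of_eigenvalue_le (hα : 0 < α) (hμ0 : 0 ≤ μ) (hμ : μ ≤ 2 / α)
    (hx : Summable fun n => x n ^ 2)
    (h : ∀ n, HasSum (fun m => hardyEntry α n m * x m) (μ * x n)) : x = 0 := by
  rcases hμ0.eq_or_lt with rfl | hμ0
  · exact eq_zero_of_eigenvalue_zero hα fun n => by simpa using h n
  set A := headSum α (fun k => x k.succPNat) with hA
  set B := tailSum α (fun k => x k.succPNat) with hB
  have hs : ∀ N : ℕ, Summable fun k : ℕ =>
      ((k : ℝ) + N + 2) ^ (-α - 1 / 2) * x (k + (N + 1)).succPNat :=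
    fun N => summable_tailSum (h N.succPNat)
  have hX : Summable fun k : ℕ => x k.succPNat ^ 2 := (hasSum_pnat_iff.2 hx.hasSum).summable
  set a : ℕ → ℝ := fun N => ((N : ℝ) + 1) ^ (-α) * A N with ha
  set b : ℕ → ℝ := fun N => ((N : ℝ) + 1) ^ α * B N with hb
  have hal : Tendsto a atTop (𝓝 0) := tendsto_headSum hα hX
  have hbl : Tendsto b atTop (𝓝 0) := tendsto_tailSum hα hX hs
  have hab : ∀ N : ℕ, ((N : ℝ) + 1) ^ (1 / 2 : ℝ) * (μ * x N.succPNat) = a N + b N :=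
    fun N => sqrt_mul_eq_headSum_add_tailSum (h N.succPNat)
  obtain ⟨L₁, hL₁, hq⟩ := exists_abs_one_add_rpow_sub_le (-α)
  obtain ⟨L₂, hL₂, hp⟩ := exists_abs_one_add_rpow_sub_le α
  set L := max L₁ L₂ with hL
  have hL0 : 0 ≤ L := hL₁.trans (le_max_left _ _)
  set ν := 2 / μ with hν
  have hν0 : 0 < ν := by positivity
  -- Here `μ ≤ 2 / α` enters: it makes the limiting system oscillatory, or degenerate in case of
  -- equality, instead of hyperbolic.
  have hκ : 0 ≤ ν - α := by
    rw [sub_nonneg, hν, le_div_iff₀ hμ0]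
    rw [le_div_iff₀ hα] at hμ
    linarith
  -- one step of the recurrence, up to errors of second order in `r = 1 / (N + 1)`
  have step : ∀ N : ℕ, ∃ r r' e f : ℝ, r = 1 / ((N : ℝ) + 1) ∧ 0 ≤ r' ∧ r' ≤ r ∧ r - r' ≤ r ^ 2 ∧
      |e| ≤ L * r ^ 2 ∧ |f| ≤ L * r ^ 2 ∧
      a (N + 1) + b (N + 1) = (1 - α * r + e) * a N + (1 + α * r + f) * b N ∧
      b (N + 1) - a (N + 1) = (1 + α * r + f) * b N - (1 - α * r + e) * a N
        - ν * r' * (a (N + 1) + b (N + 1)) := by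
    intro N
    have hN : (0 : ℝ) ≤ N := N.cast_nonneg
    set t := (N : ℝ) + 1 with ht
    have ht0 : 0 < t := by positivity
    have ht2 : (N : ℝ) + 2 = t + 1 := by rw [ht]; ring
    have hr1 : 1 / t ≤ 1 := by
      rw [div_le_one ht0]
      linarith
    have hscale : ∀ c : ℝ, ((N : ℝ) + 2) ^ c = (1 + 1 / t) ^ c * t ^ c := by
      intro c
      rw [← Real.mul_rpow (by positivity) ht0.le, ht2]
      congr 1
      field_simp
    have h1 := sqrt_mul_succ_eq (h N.succPNat) (h (N + 1).succPNat)
    have hA1 : A (N + 1) = A N + ((N : ℝ) + 2) ^ (α - 1 / 2) * x (N + 1).succPNat :=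
      headSum_succ _ _ _
    have hB1 : B N = ((N : ℝ) + 2) ^ (-α - 1 / 2) * x (N + 1).succPNat + B (N + 1) :=
      tailSum_eq_add (X := fun k => x k.succPNat) (hs N)
    -- Passing to the next row moves the same quantity `v` from tail to head, so it cancels in `a +
    -- b`. By the eigenvalue equation, `2 * v` is `ν / (t + 1)` times the new sum `a + b`.
    set v := ((N : ℝ) + 2) ^ (-(1 / 2) : ℝ) * x (N + 1).succPNat with hv
    have hT : (0 : ℝ) < (N : ℝ) + 2 := by positivity
    have e1 : ((N : ℝ) + 2) ^ (-α) * ((N : ℝ) + 2) ^ (α - 1 / 2)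
        = ((N : ℝ) + 2) ^ (-(1 / 2) : ℝ) := by
      rw [← Real.rpow_add hT]
      ring_nf
    have e2 : ((N : ℝ) + 2) ^ α * ((N : ℝ) + 2) ^ (-α - 1 / 2)
        = ((N : ℝ) + 2) ^ (-(1 / 2) : ℝ) := by
      rw [← Real.rpow_add hT]
      ring_nf
    have e3 : (((N + 1 : ℕ) : ℝ) + 1) = (N : ℝ) + 2 := by push_cast; ring
    have ea : a (N + 1) = (1 + 1 / t) ^ (-α) * a N + v := by
      simp only [ha, e3, hA1]
      rw [mul_add, ← mul_assoc, e1, hscale (-α), mul_assoc]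
    have eb : b (N + 1) = (1 + 1 / t) ^ α * b N - v := by
      have hB2 : B (N + 1) = B N - ((N : ℝ) + 2) ^ (-α - 1 / 2) * x (N + 1).succPNat := by
        linarith
      simp only [hb, e3, hB2]
      rw [mul_sub, ← mul_assoc, e2, hscale α, mul_assoc]
    have ev : ν * (1 / (t + 1)) * (a (N + 1) + b (N + 1)) = 2 * v := by
      have h2 := hab (N + 1)
      rw [e3] at h2
      have e4 : ((N : ℝ) + 2) ^ (-(1 / 2) : ℝ) * (t + 1) = ((N : ℝ) + 2) ^ (1 / 2 : ℝ) := by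
        rw [← ht2, ← Real.rpow_add_one hT.ne']
        norm_num
      rw [← h2, hν, hv, ← e4]
      field_simp
    have hq' := hq (1 / t) (by positivity) hr1
    have hp' := hp (1 / t) (by positivity) hr1
    refine ⟨1 / t, 1 / (t + 1), (1 + 1 / t) ^ (-α) - 1 - -α * (1 / t),
      (1 + 1 / t) ^ α - 1 - α * (1 / t), rfl, by positivity, ?_, ?_, ?_, ?_, ?_, ?_⟩
    · gcongr
      linarith
    · rw [div_sub_div _ _ ht0.ne' (by positivity), one_div_pow,
        div_le_div_iff₀ (by positivity) (by positivity)]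
      nlinarith
    · refine hq'.trans ?_
      gcongr
      exact le_max_left _ _
    · refine hp'.trans ?_
      gcongr
      exact le_max_right _ _
    · rw [ea, eb]
      ring
    · rw [ev, ea, eb]
      ring
  obtain ⟨N₀, hN₀⟩ := eventually_zero_of_coupled_recurrence hα hν0 hκ hL0 hal hbl step
  have hzero : ∀ N, a N + b N = 0 → x N.succPNat = 0 := by
    intro N hN
    have h1 := hab N
    rw [hN] at h1
    have h2 := (mul_eq_zero.1 h1).resolve_left (by positivity)
    exact (mul_eq_zero.1 h2).resolve_left hμ0.ne'
  have hAB : ∀ N, A N = 0 → B N = 0 → x N.succPNat = 0 := fun N h1 h2 =>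
    hzero N (by simp [ha, hb, h1, h2])
  have hlarge : ∀ N, N₀ ≤ N → A N = 0 ∧ B N = 0 := by
    intro N hN
    obtain ⟨h3, h4⟩ := hN₀ N hN
    exact ⟨(mul_eq_zero.1 h3).resolve_left (by positivity),
      (mul_eq_zero.1 h4).resolve_left (by positivity)⟩
  -- Vanishing propagates backwards: if both sums vanish in a row, so does its diagonal coordinate,
  -- and with it the sums in the row before.
  have hall : ∀ j N, N₀ ≤ N + j → A N = 0 ∧ B N = 0 := by
    intro j
    induction j with
    | zero => exact hlarge
    | succ j ih =>
      intro N hN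
      obtain ⟨h1, h2⟩ := ih (N + 1) (by omega)
      exact sums_eq_zero_of_eq_zero (hs N) (hAB (N + 1) h1 h2) h1 h2
  exact eq_zero_of_headSum_eq_zero (α := α) fun N => (hall N₀ N (by omega)).1

end EmbeddedEigenvalues

/-! ### The criterion and the explicit ranges of `α` -/

section Main

variable {α : ℝ} {hα : 0 < α} {C : DirichletH2 →L[ℂ] DirichletH2}

theorem reproducingKernelThesis_of_le
    (hC : ∀ x, HasSum (fun i => x i • symbolPow hα.le i) (C x))
    (hK : IsMatrixOperator (hardyEntry α) (C.adjoint ∘L C)) (hl : ‖C‖ ^ 2 ≤ 2 / α) :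
    ReproducingKernelThesis (phiSymbol α) := by
  refine ⟨C, isCompositionOperator_of_hasSum (hα := hα) hC, ?_, fun c hc => ?_⟩
  · rintro _ ⟨w, rfl⟩
    exact C.ratio_le_opNorm _
  · have hc0 : 0 ≤ c := le_trans (by positivity) (hc ⟨realPoint 1 (by norm_num), rfl⟩)
    have h : 2 / α ≤ c ^ 2 := by
      refine two_div_le_of_kernel_bound hK hα fun w => ?_
      have h1 : ‖C (DirichletH2.kernel w)‖ ≤ c * ‖DirichletH2.kernel w‖ := by
        rcases (norm_nonneg (DirichletH2.kernel w)).eq_or_lt with h0 | h0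
        · rw [norm_eq_zero.1 h0.symm]
          simp
        · exact (div_le_iff₀ h0).1 (hc ⟨w, rfl⟩)
      rw [← mul_pow]
      exact pow_le_pow_left₀ (norm_nonneg _) h1 2
    exact le_of_sq_le_sq (hl.trans h) hc0

theorem re_eq_zero_of_eigenvector (hα : 0 < α)
    (hK : IsMatrixOperator (hardyEntry α) (C.adjoint ∘L C)) {μ : ℝ} (hμ0 : 0 ≤ μ)
    (hμ : μ ≤ 2 / α) {x : DirichletH2} (hx : (C.adjoint ∘L C) x = (μ : ℂ) • x) (n : ℕ+) :
    (x n).re = 0 := by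
  refine congrFun (eq_zero_of_eigenvalue_le (x := fun n => (x n).re) hα hμ0 hμ ?_ fun n => ?_) n
  · refine (lp_hasSum_norm_sq x).summable.of_nonneg_of_le (fun n => sq_nonneg _) fun n => ?_
    rw [sq_le_sq, abs_norm]
    exact Complex.abs_re_le_norm _
  · have := hasSum_re_of_isMatrixOperator hK x n
    have e : ((μ : ℂ) • x) n = (μ : ℂ) * x n := rfl
    rwa [hx, e, Complex.re_ofReal_mul] at this

theorem not_hasEigenvalue_of_le (hα : 0 < α)
    (hK : IsMatrixOperator (hardyEntry α) (C.adjoint ∘L C)) (hl : ‖C‖ ^ 2 ≤ 2 / α) (μ : ℂ) :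
    ¬Module.End.HasEigenvalue ((C.adjoint ∘L C : DirichletH2 →L[ℂ] DirichletH2) :
      DirichletH2 →ₗ[ℂ] DirichletH2) μ := by
  intro hμ
  obtain ⟨x, hx⟩ := hμ.exists_hasEigenvector
  have hx0 : x ≠ 0 := hx.2
  have hx1 : (C.adjoint ∘L C) x = μ • x := hx.apply_eq_smul
  have hpos : 0 < ‖x‖ ^ 2 := by positivity
  have h1 : μ * ((‖x‖ ^ 2 : ℝ) : ℂ) = ((‖C x‖ ^ 2 : ℝ) : ℂ) := by
    have h2 : ⟪x, (C.adjoint ∘L C) x⟫_ℂ = ⟪C x, C x⟫_ℂ :=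
      ContinuousLinearMap.adjoint_inner_right C x (C x)
    rw [hx1, inner_smul_right, inner_self_eq_norm_sq_to_K, inner_self_eq_norm_sq_to_K] at h2
    exact_mod_cast h2
  obtain ⟨ν, rfl⟩ : ∃ ν : ℝ, μ = ν := by
    refine ⟨‖C x‖ ^ 2 / ‖x‖ ^ 2, ?_⟩
    rw [Complex.ofReal_div, ← h1, mul_div_cancel_right₀]
    exact_mod_cast hpos.ne'
  have h3 : ν * ‖x‖ ^ 2 = ‖C x‖ ^ 2 := by exact_mod_cast h1
  have hν0 : 0 ≤ ν := nonneg_of_mul_nonneg_left (h3 ▸ by positivity) hpos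
  have hν : ν ≤ 2 / α := by
    refine le_trans (le_of_mul_le_mul_right ?_ hpos) hl
    rw [h3, ← mul_pow]
    exact pow_le_pow_left₀ (norm_nonneg _) (C.le_opNorm x) 2
  -- The recurrence argument is for real sequences. The real parts of `x` and of `I • x` together
  -- give all of `x`.
  have hI : (C.adjoint ∘L C) (Complex.I • x) = (ν : ℂ) • (Complex.I • x) := by
    rw [map_smul, hx1, smul_comm]
  refine hx0 (lp.ext (funext fun n => Complex.ext ?_ ?_))
  · exact re_eq_zero_of_eigenvector hα hK hν0 hν hx1 n
  · simpa using re_eq_zero_of_eigenvector hα hK hν0 hν hI n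

theorem hasEigenvalue_of_lt
    (hC : ∀ x, HasSum (fun i => x i • symbolPow hα.le i) (C x)) (hl : 2 / α < ‖C‖ ^ 2) :
    Module.End.HasEigenvalue ((C.adjoint ∘L C : DirichletH2 →L[ℂ] DirichletH2) :
      DirichletH2 →ₗ[ℂ] DirichletH2) ((‖C‖ ^ 2 : ℝ) : ℂ) := by
  obtain ⟨y, hy, h⟩ := exists_eigenvector_of_lt (hα := hα) hC hl
  exact Module.End.hasEigenvalue_of_hasEigenvector (Module.End.hasEigenvector_iff.2
    ⟨Module.End.mem_eigenspace_iff.2 h, hy⟩)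

theorem reproducingKernelThesis_iff
    (hC : ∀ x, HasSum (fun i => x i • symbolPow hα.le i) (C x))
    (hK : IsMatrixOperator (hardyEntry α) (C.adjoint ∘L C)) :
    ReproducingKernelThesis (phiSymbol α) ↔ ‖C‖ ^ 2 ≤ 2 / α :=
  ⟨fun h => not_lt.1 fun hl => not_reproducingKernelThesis_of_lt (hα := hα) hC hK hl h,
    reproducingKernelThesis_of_le (hα := hα) hC hK⟩

theorem norm_sq_le_of_le_one (hC : ∀ x, HasSum (fun i => x i • symbolPow hα.le i) (C x))
    (h1 : α ≤ 1) : ‖C‖ ^ 2 ≤ 2 / α := by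
  have h : ‖C‖ ≤ √(2 / α) := by
    refine C.opNorm_le_bound (Real.sqrt_nonneg _) fun x => ?_
    refine le_of_sq_le_sq ?_ (by positivity)
    rw [mul_pow, Real.sq_sqrt (by positivity)]
    exact norm_sq_le_of_row_bound (hα := hα) hC (P := fun _ => True)
      (fun i _ S => sum_hardyEntry_mul_le_of_le_one hα h1 i S) fun i hi => (hi trivial).elim
  exact (Real.le_sqrt (norm_nonneg _) (by positivity)).1 h

/-- The first column has entry `1` on the diagonal and a positive entry below it, so its norm
exceeds `1`. -/
theorem one_lt_norm_sq (hK : IsMatrixOperator (hardyEntry α) (C.adjoint ∘L C)) :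
    1 < ‖C‖ ^ 2 := by
  set e : DirichletH2 := lp.single 2 (1 : ℕ+) (1 : ℂ) with he
  have hne : ‖e‖ = 1 := by
    rw [he, lp.norm_single (by norm_num)]
    simp
  have hK1 : ∀ n, (C.adjoint ∘L C) e n = (hardyEntry α n 1 : ℂ) := by
    intro n
    refine (hK e n).unique ?_
    convert hasSum_single (1 : ℕ+) ?_ using 1
    · simp [he]
    · intro m hm
      simp [he, hm]
  have h11 : hardyEntry α 1 1 = 1 := by simp [hardyEntry]
  have h2 : 1 + hardyEntry α 2 1 ^ 2 ≤ ‖(C.adjoint ∘L C) e‖ ^ 2 := by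
    have := sum_le_hasSum {1, 2} (fun n _ => by positivity) (lp_hasSum_norm_sq ((C.adjoint ∘L C) e))
    rw [Finset.sum_pair (by decide), hK1, hK1, h11] at this
    simpa using this
  have h3 : 0 < hardyEntry α 2 1 := hardyEntry_pos α 2 1
  have h4 : ‖(C.adjoint ∘L C) e‖ ≤ ‖C‖ ^ 2 := by
    have h5 : ‖C.adjoint ∘L C‖ = ‖C‖ ^ 2 := by
      rw [sq]
      exact ContinuousLinearMap.norm_adjoint_comp_self C
    simpa [h5, hne] using (C.adjoint ∘L C).le_opNorm e
  have h6 : 1 < ‖(C.adjoint ∘L C) e‖ := by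
    rw [← one_lt_sq_iff₀ (norm_nonneg _)]
    have := pow_pos h3 2
    linarith
  exact h6.trans_le h4

theorem isBoundedSymbol_phiSymbol (hα : 0 < α) : IsBoundedSymbol (phiSymbol α) := by
  obtain ⟨C, hC, -⟩ := exists_composition hα
  exact ⟨differentiableOn_phiSymbol α, mapsTo_phiSymbol hα, C,
    isCompositionOperator_of_hasSum (hα := hα) hC⟩

theorem reproducingKernelThesis_phiSymbol (hα : 0 < α) (h1 : α ≤ 1) :
    ReproducingKernelThesis (phiSymbol α) := by
  obtain ⟨C, hC, hC'⟩ := exists_composition hα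
  exact reproducingKernelThesis_of_le (hα := hα) hC
    (isMatrixOperator_of_hasSum (hα := hα) hC hC') (norm_sq_le_of_le_one (hα := hα) hC h1)

theorem not_reproducingKernelThesis_phiSymbol (h2 : 2 ≤ α) :
    ¬ReproducingKernelThesis (phiSymbol α) := by
  have hα : 0 < α := two_pos.trans_le h2
  obtain ⟨C, hC, hC'⟩ := exists_composition hα
  have hK := isMatrixOperator_of_hasSum (hα := hα) hC hC'
  exact not_reproducingKernelThesis_of_lt (hα := hα) hC hK
    (((div_le_one hα).2 h2).trans_lt (one_lt_norm_sq hK))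

end Main
end DirichletComposition

open DirichletComposition

theorem theoremD :
    (∀ α : ℝ, 0 < α →
      IsBoundedSymbol (phiSymbol α) ∧
      ∃ K : lp (fun _ : ℕ+ => ℂ) 2 →L[ℂ] lp (fun _ : ℕ+ => ℂ) 2,
        IsMatrixOperator (hardyEntry α) K ∧
        (ReproducingKernelThesis (phiSymbol α) ↔
          ∀ μ : ℂ, ¬ Module.End.HasEigenvalue
            (K : lp (fun _ : ℕ+ => ℂ) 2 →ₗ[ℂ] lp (fun _ : ℕ+ => ℂ) 2) μ)) ∧
    (∀ α : ℝ, 0 < α → α ≤ 1 → ReproducingKernelThesis (phiSymbol α)) ∧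
    (∀ α : ℝ, 2 ≤ α → ¬ ReproducingKernelThesis (phiSymbol α)) ∧
    ¬ ∀ φ : ℂ → ℂ, IsBoundedSymbol φ → ReproducingKernelThesis φ := by
  refine ⟨fun α hα => ?_, fun α => reproducingKernelThesis_phiSymbol,
    fun α => not_reproducingKernelThesis_phiSymbol, fun h =>
      not_reproducingKernelThesis_phiSymbol le_rfl (h _ (isBoundedSymbol_phiSymbol two_pos))⟩
  obtain ⟨C, hC, hC'⟩ := exists_composition hα
  have hK := isMatrixOperator_of_hasSum (hα := hα) hC hC'
  refine ⟨isBoundedSymbol_phiSymbol hα, C.adjoint ∘L C, hK, ?_⟩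
  rw [reproducingKernelThesis_iff (hα := hα) hC hK]
  exact ⟨not_hasEigenvalue_of_le hα hK, fun h => not_lt.1 fun hl =>
    h _ (hasEigenvalue_of_lt (hα := hα) hC hl)⟩
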